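/- **Definitions.** Inductive limits are C*-algebraic limits of sequences $(A_i,\phi_{ij})_{i\le j\in\mathbb N}$; the connecting *-homomorphisms are not required to be unital or injective. The covering dimension is denoted by $\dim$, and $\otimes$ is the minimal C*-tensor product. *Recursive subhomogeneous (RSH) algebras.* (1) If $X$ is compact Hausdorff and $n\ge 1$, then $C(X,M_n)$ is RSH, with total space $X$. (2) If $A$ is RSH with total space $Y$, $X$ is compact Hausdorff, $X^{(0)}\subseteq X$ is closed, $n\ge 1$ and $\phi:A\to C(X^{(0)},M_n)$ is a unital *-homomorphism, then the pullback $\{(a,f)\in A\oplus C(X,M_n) : \phi(a)=f|_{X^{(0)}}\}$ is RSH, with total space $Y\sqcup X$. Every algebra isomorphic to one so obtained is RSH. A presentation of this kind is a decomposition of the algebra; with respect to it every element $a$ (and every matrix over the algebra) has a matrix value $a(y)$ at each point $y$ of the total space. The topological dimension function $d$ assigns to $y$ the covering dimension of the connected component of $y$ in the total space. All RSH algebras are assumed, and all decompositions are chosen, to have total spaces of finite covering dimension. *Slow dimension growth.* A direct system $(A_i,\phi_{ij})$ of RSH algebras with chosen decompositions, total spaces $X_i$ and topological dimension functions $d_i$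 has slow dimension growth if for every $i$, every $k$, every projection $p\in M_k(A_i)$ and every $N\in\mathbb N$ there is $j_0$ such that for all $j\ge j_0$ (with $j \geq i$) and $x\in X_j$, $$\phi_{ij}(p)(x)=0\quad\text{or}\quad \operatorname{rank}(\phi_{ij}(p)(x))\ge N d_j(x).$$ It has strict slow dimension growth if for every $i$, $k$, every nonzero projection $p\in M_k(A_i)$ and every $N$ there is $j_0$ such that for all $j\ge j_0$ (with $j \geq i$) and $x\in X_j$ one has $\phi_{ij}(p)(x)\neq0$ and $\operatorname{rank}(\phi_{ij}(p)(x))\ge N d_j(x)$. A C*-algebra has (strict) slow dimension growth if it is the limit of such a system with (strict) slow dimension growth. *AH algebras.* An AH algebra is an inductive limit of algebras $A_i=\bigoplus_{t=1}^{r_i}P_{i,t}C(X_{i,t},M_{m_{i,t}})P_{i,t}$, where the $X_{i,t}$ are compact metrizable and the $P_{i,t}$ are projections. It has very slow dimension growth if the system can be chosen such that $(\dim X_{j,t})^3/\operatorname{rank}P_{j,t}\to 0$ as $j\to\infty$, uniformly in $t$, and such that for every $i$ and every direct summand of $A_i$, with unit $e$, $(\dim X_{j,t})^3/\operatorname{rank}\big(\phi_{ij}(e)_t\big)\to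 0$ as $j\to\infty$, uniformly over all $t$ and all points of $X_{j,t}$ at which the $t$-th component $\phi_{ij}(e)_t$ of $\phi_{ij}(e)$ does not vanish. (Precisely: for every $N\in\mathbb N$ there is $j_0$ such that for all $j\ge j_0$ and all $t$ one has $\operatorname{rank}P_{j,t}(x)\ge N(\dim X_{j,t})^3$ at all $x\in X_{j,t}$; and similarly, for each $i$ and $e$, with $\phi_{ij}(e)_t(x)$ in place of $P_{j,t}(x)$ where it is not $0$.) *Strongly self-absorbing.* A separable, unital, nonzero C*-algebra $D\not\cong\mathbb C$ is strongly self-absorbing if there are an isomorphism $\varphi:D\to D\otimes D$ and unitaries $v_n\in D\otimes D$ with $\|v_n^*\varphi(d)v_n-d\otimes 1\|\to0$ for all $d\in D$. A C*-algebra $A$ is $D$-stable if $A\otimes D\cong A$. **Theorem.** Let $A$ and $D$ be unital C*-algebras which are inductive limits of recursive subhomogeneous algebras. Suppose that $D$ is strongly self-absorbing and that $A$ is $D$-stable. Then: 1. $A$ has slow dimension growth; 2. if $A$ is simple (that is, $A\ne0$ and its only closed two-sided ideals are $0$ and $A$), then $A$ has strict slow dimension growth; 3. if $A$ and $D$ are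 AH algebras, then $A$ has very slow dimension growth. -/

import Mathlib

open scoped TensorProduct
open Filter Topology

universe u

namespace StronglySelfAbsorbingPaper

/-! Covering dimension -/

/-- Every finite open cover of `X` has a finite open refinement such that each point of `X` lies
in at most `m + 1` of its members. -/
def CoveringDimLE (X : Type u) [TopologicalSpace X] (m : ℕ) : Prop :=
  ∀ (k : ℕ) (U : Fin k → Set X), (∀ i, IsOpen (U i)) → (⋃ i, U i) = Set.univ →
    ∃ (l : ℕ) (V : Fin l → Set X), (∀ j, IsOpen (V j)) ∧ (⋃ j, V j) = Set.univ ∧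
      (∀ j, ∃ i, V j ⊆ U i) ∧ ∀ x, {j | x ∈ V j}.ncard ≤ m + 1

/-- The (Lebesgue) covering dimension, `⊤` if it is infinite (and `0` for the empty space). -/
noncomputable def coveringDim (X : Type u) [TopologicalSpace X] : ℕ∞ :=
  ⨅ (m : ℕ) (_ : CoveringDimLE X m), (m : ℕ∞)

/-! Sequential inductive limits of C*-algebras -/

/-- A direct sequence of (unital) C*-algebras; the connecting *-homomorphisms need be neither
unital nor injective. -/
structure CStarSystem : Type (u + 1) where
  obj : ℕ → Type u
  [cstar : ∀ i, CStarAlgebra (obj i)]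
  map : ∀ {i j : ℕ}, i ≤ j → (obj i →⋆ₙₐ[ℂ] obj j)
  map_self : ∀ (i : ℕ) (a : obj i), map (le_refl i) a = a
  map_map : ∀ {i j k : ℕ} (hij : i ≤ j) (hjk : j ≤ k) (a : obj i),
    map hjk (map hij a) = map (hij.trans hjk) a

attribute [instance] CStarSystem.cstar

/-- `A`, with the canonical maps `ι i`, is the C*-algebraic inductive limit of the system `S`:
the maps are compatible, the union of their ranges is dense, and `‖ι i a‖ = lim_j ‖φ_{ij} a‖`. -/
structure IsInductiveLimit (S : CStarSystem.{u}) (A : Type u) [CStarAlgebra A]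
    (ι : ∀ i, S.obj i →⋆ₙₐ[ℂ] A) : Prop where
  compat : ∀ {i j : ℕ} (hij : i ≤ j) (a : S.obj i), ι j (S.map hij a) = ι i a
  dense : Dense (⋃ i, Set.range (ι i))
  norm_eq : ∀ (i : ℕ) (a : S.obj i),
    Tendsto (fun k : ℕ => ‖S.map (Nat.le_add_right i k) a‖) atTop (𝓝 ‖ι i a‖)

/-! Recursive subhomogeneous algebras -/

/-- Recursive subhomogeneous decompositions of a C*-algebra.
* `base`: an isomorphism with `C(X, M_n)`, `X` compact Hausdorff, `n ≥ 1`.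
* `step`: `B` is isomorphic, through `b ↦ (p b, q b)`, to the pullback
  `{(a, f) ∈ A ⊕ C(X, M_n) | φ a = f|_{X₀}}`, where `A` already carries a decomposition, `X` is
  compact Hausdorff, `X₀ ⊆ X` is closed and `φ : A → C(X₀, M_n)` is a unital *-homomorphism. -/
inductive RSHDecomposition : (A : Type u) → [CStarAlgebra A] → Type (u + 1)
  | base {A : Type u} [CStarAlgebra A]
      (X : Type u) [TopologicalSpace X] [CompactSpace X] [T2Space X]
      (n : ℕ) (hn : 0 < n) (e : A ≃⋆ₐ[ℂ] C(X, Matrix (Fin n) (Fin n) ℂ)) : RSHDecomposition A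
  | step {A B : Type u} [CStarAlgebra A] [CStarAlgebra B] (R : RSHDecomposition A)
      (X : Type u) [TopologicalSpace X] [CompactSpace X] [T2Space X]
      (X₀ : Set X) (hX₀ : IsClosed X₀) (n : ℕ) (hn : 0 < n)
      (φ : A →⋆ₐ[ℂ] C(X₀, Matrix (Fin n) (Fin n) ℂ))
      (p : B →⋆ₐ[ℂ] A) (q : B →⋆ₐ[ℂ] C(X, Matrix (Fin n) (Fin n) ℂ))
      (hinj : Function.Injective (fun b : B => (p b, q b)))
      (hrange : ∀ (a : A) (f : C(X, Matrix (Fin n) (Fin n) ℂ)),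
        (∃ b : B, p b = a ∧ q b = f) ↔ φ a = f.restrict X₀) : RSHDecomposition B

/-- A topological space `X` over which the elements of `A` have matrix values: `value y a` is the
value `a(y)` of `a`, a matrix of size `size y`. -/
structure MatrixValuedSpace (A : Type u) : Type (u + 1) where
  X : Type u
  [top : TopologicalSpace X]
  size : X → ℕ
  value : (y : X) → A → Matrix (Fin (size y)) (Fin (size y)) ℂ

attribute [instance] MatrixValuedSpace.top

/-- The total space of `B = A ⊕_{C(X₀, M_n)} C(X, M_n)` is the disjoint union of the total space
`Y` of `A` and of `X`; the value of `(p b, q b)` is `(p b)(y)` at `y` in `Y`, and `(q b)(x)` at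
`x` in `X`. -/
def MatrixValuedSpace.adjoin {A B : Type u} (Y : MatrixValuedSpace A) (X : Type u)
    [TopologicalSpace X] (n : ℕ) (p : B → A) (q : B → X → Matrix (Fin n) (Fin n) ℂ) :
    MatrixValuedSpace B where
  X := Y.X ⊕ X
  size := Sum.elim Y.size (fun _ => n)
  value z := match z with
    | Sum.inl y => fun b => Y.value y (p b)
    | Sum.inr x => fun b => q b x

namespace RSHDecomposition

/-- The total space of a decomposition (the disjoint union of its base spaces), with the values of
the elements of the algebra at its points. -/
noncomputable def total : {A : Type u} → [CStarAlgebra A] → RSHDecomposition A → MatrixValuedSpace A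
  | _, _, base X n _ e => { X := X, size := fun _ => n, value := fun x a => e a x }
  | _, _, step R X _ _ n _ _ p q _ _ => R.total.adjoin X n p (fun b => q b)

variable {A : Type u} [CStarAlgebra A]

/-- The topological dimension of the decomposition is finite. -/
def FiniteDim (R : RSHDecomposition A) : Prop := coveringDim R.total.X ≠ ⊤

/-- The topological dimension function: the covering dimension of the connected component of
`y`. -/
noncomputable def dimFunction (R : RSHDecomposition A) (y : R.total.X) : ℕ∞ :=
  coveringDim (connectedComponent y)

/-- The value at `y` of an element of `M_k(A)`, as a complex matrix of size `k * size y`. -/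
noncomputable def matrixValue (R : RSHDecomposition A) {k : ℕ} (p : Matrix (Fin k) (Fin k) A)
    (y : R.total.X) : Matrix (Fin k × Fin (R.total.size y)) (Fin k × Fin (R.total.size y)) ℂ :=
  Matrix.comp _ _ _ _ ℂ (p.map (R.total.value y))

end RSHDecomposition

/-- `A` is an inductive limit of recursive subhomogeneous algebras (which admit decompositions of
finite topological dimension). -/
def IsRSHLimit (A : Type u) [CStarAlgebra A] : Prop :=
  ∃ (S : CStarSystem.{u}) (R : ∀ i, RSHDecomposition (S.obj i)) (ι : ∀ i, S.obj i →⋆ₙₐ[ℂ] A),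
    (∀ i, (R i).FiniteDim) ∧ IsInductiveLimit S A ι

/-- Slow dimension growth of a direct system with chosen decompositions; a projection in
`M_∞` of an algebra is a projection in `M_k` of it for some `k`. -/
def SystemSlowDimGrowth (S : CStarSystem.{u}) (R : ∀ i, RSHDecomposition (S.obj i)) : Prop :=
  ∀ (i k : ℕ) (p : Matrix (Fin k) (Fin k) (S.obj i)), IsStarProjection p → ∀ N : ℕ,
    ∃ j₀ : ℕ, ∀ (j : ℕ) (hij : i ≤ j), j₀ ≤ j → ∀ x : (R j).total.X,
      (R j).matrixValue (p.map (S.map hij)) x = 0 ∨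
      (N : ℕ∞) * (R j).dimFunction x ≤
        (((R j).matrixValue (p.map (S.map hij)) x).rank : ℕ∞)

/-- Strict slow dimension growth: the value `0` is not allowed for `p ≠ 0`. -/
def SystemStrictSlowDimGrowth (S : CStarSystem.{u}) (R : ∀ i, RSHDecomposition (S.obj i)) :
    Prop :=
  ∀ (i k : ℕ) (p : Matrix (Fin k) (Fin k) (S.obj i)), IsStarProjection p → p ≠ 0 → ∀ N : ℕ,
    ∃ j₀ : ℕ, ∀ (j : ℕ) (hij : i ≤ j), j₀ ≤ j → ∀ x : (R j).total.X,
      (R j).matrixValue (p.map (S.map hij)) x ≠ 0 ∧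
      (N : ℕ∞) * (R j).dimFunction x ≤
        (((R j).matrixValue (p.map (S.map hij)) x).rank : ℕ∞)

def HasSlowDimensionGrowth (A : Type u) [CStarAlgebra A] : Prop :=
  ∃ (S : CStarSystem.{u}) (R : ∀ i, RSHDecomposition (S.obj i)) (ι : ∀ i, S.obj i →⋆ₙₐ[ℂ] A),
    (∀ i, (R i).FiniteDim) ∧ IsInductiveLimit S A ι ∧ SystemSlowDimGrowth S R

def HasStrictSlowDimensionGrowth (A : Type u) [CStarAlgebra A] : Prop :=
  ∃ (S : CStarSystem.{u}) (R : ∀ i, RSHDecomposition (S.obj i)) (ι : ∀ i, S.obj i →⋆ₙₐ[ℂ] A),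
    (∀ i, (R i).FiniteDim) ∧ IsInductiveLimit S A ι ∧ SystemStrictSlowDimGrowth S R

/-! AH algebras -/

/-- An isomorphism of `A` with a finite direct sum `⨁_t P_t C(X_t, M_{m_t}) P_t`, where the `X_t`
are compact metrizable spaces and the `P_t` are projections in `C(X_t, M_{m_t})`; `coord t` is the
`t`-th coordinate map. -/
structure HomogeneousDecomposition (A : Type u) [CStarAlgebra A] : Type (u + 1) where
  r : ℕ
  X : Fin r → Type u
  [top : ∀ t, TopologicalSpace (X t)]
  [compact : ∀ t, CompactSpace (X t)]
  [metrizable : ∀ t, TopologicalSpace.MetrizableSpace (X t)]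
  m : Fin r → ℕ
  P : ∀ t, C(X t, Matrix (Fin (m t)) (Fin (m t)) ℂ)
  isStarProjection_P : ∀ t, IsStarProjection (P t)
  coord : ∀ t, A →⋆ₙₐ[ℂ] C(X t, Matrix (Fin (m t)) (Fin (m t)) ℂ)
  injective : Function.Injective (fun (a : A) t => coord t a)
  range_eq : ∀ f : (∀ t, C(X t, Matrix (Fin (m t)) (Fin (m t)) ℂ)),
    (∃ a : A, ∀ t, coord t a = f t) ↔ ∀ t, P t * f t * P t = f t

attribute [instance] HomogeneousDecomposition.top HomogeneousDecomposition.compact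
  HomogeneousDecomposition.metrizable

/-- `e` is the unit of the `s`-th direct summand of `A`. -/
def HomogeneousDecomposition.IsSummandUnit {A : Type u} [CStarAlgebra A]
    (H : HomogeneousDecomposition A) (s : Fin H.r) (e : A) : Prop :=
  H.coord s e = H.P s ∧ ∀ t, t ≠ s → H.coord t e = 0

/-- AH algebras: inductive limits of finite direct sums of homogeneous algebras
`P C(X, M_m) P` with `X` compact metrizable. -/
def IsAH (A : Type u) [CStarAlgebra A] : Prop :=
  ∃ (S : CStarSystem.{u}) (_ : ∀ i, HomogeneousDecomposition (S.obj i))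
    (ι : ∀ i, S.obj i →⋆ₙₐ[ℂ] A), IsInductiveLimit S A ι

/-- Very slow dimension growth of a direct system `A_i = ⨁_t P_{i,t} C(X_{i,t}, M_{m_{i,t}}) P_{i,t}`:
* `(dim X_{j,t})³ / rank P_{j,t} → 0` uniformly in `t` as `j → ∞`;
* for every summand of every `A_i`, with unit `e`, the same with the rank of the component in the
  `t`-th summand of the image of `e` in `A_j`, where this image does not vanish. -/
def SystemVerySlowDimGrowth (S : CStarSystem.{u})
    (H : ∀ i, HomogeneousDecomposition (S.obj i)) : Prop :=
  (∀ N : ℕ, ∃ j₀ : ℕ, ∀ j : ℕ, j₀ ≤ j → ∀ (t : Fin (H j).r) (x : (H j).X t),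
    (N : ℕ∞) * coveringDim ((H j).X t) ^ 3 ≤ (((H j).P t x).rank : ℕ∞)) ∧
  (∀ (i : ℕ) (s : Fin (H i).r) (e : S.obj i), (H i).IsSummandUnit s e → ∀ N : ℕ,
    ∃ j₀ : ℕ, ∀ (j : ℕ) (hij : i ≤ j), j₀ ≤ j → ∀ (t : Fin (H j).r) (x : (H j).X t),
      (H j).coord t (S.map hij e) x = 0 ∨
      (N : ℕ∞) * coveringDim ((H j).X t) ^ 3 ≤
        (((H j).coord t (S.map hij e) x).rank : ℕ∞))

def HasVerySlowDimensionGrowth (A : Type u) [CStarAlgebra A] : Prop :=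
  ∃ (S : CStarSystem.{u}) (H : ∀ i, HomogeneousDecomposition (S.obj i))
    (ι : ∀ i, S.obj i →⋆ₙₐ[ℂ] A), IsInductiveLimit S A ι ∧ SystemVerySlowDimGrowth S H

/-! Tensor products and strongly self-absorbing algebras -/

/-- The Hilbert space tensor product. -/
abbrev HilbertTensor (H K : Type u) [NormedAddCommGroup H] [InnerProductSpace ℂ H]
    [NormedAddCommGroup K] [InnerProductSpace ℂ K] : Type u :=
  UniformSpace.Completion (H ⊗[ℂ] K)

/-- `E` is the minimal (spatial) C*-tensor product `A ⊗ B`, with `ιA a = a ⊗ 1` and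
`ιB b = 1 ⊗ b`: for faithful representations `π` of `A` on `H` and `ρ` of `B` on `K`, `E` is
identified by `Θ` with the closed subalgebra of the bounded operators on the Hilbert space tensor
product of `H` and `K` that is generated by the `π a ⊗ 1` and the `1 ⊗ ρ b`. -/
def IsMinTensorProduct (A B E : Type u) [CStarAlgebra A] [CStarAlgebra B] [CStarAlgebra E]
    (ιA : A →⋆ₐ[ℂ] E) (ιB : B →⋆ₐ[ℂ] E) : Prop :=
  Dense (Submodule.span ℂ {z : E | ∃ a b, z = ιA a * ιB b} : Set E) ∧
  ∃ (H K : Type u) (_ : NormedAddCommGroup H) (_ : InnerProductSpace ℂ H) (_ : CompleteSpace H)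
    (_ : NormedAddCommGroup K) (_ : InnerProductSpace ℂ K) (_ : CompleteSpace K)
    (π : A →⋆ₐ[ℂ] (H →L[ℂ] H)) (ρ : B →⋆ₐ[ℂ] (K →L[ℂ] K))
    (Θ : E →⋆ₐ[ℂ] (HilbertTensor H K →L[ℂ] HilbertTensor H K)),
    Function.Injective π ∧ Function.Injective ρ ∧ Function.Injective Θ ∧
    (∀ (a : A) (h : H) (k : K),
      Θ (ιA a) (h ⊗ₜ[ℂ] k : H ⊗[ℂ] K) = ((π a h ⊗ₜ[ℂ] k : H ⊗[ℂ] K) : HilbertTensor H K)) ∧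
    (∀ (b : B) (h : H) (k : K),
      Θ (ιB b) (h ⊗ₜ[ℂ] k : H ⊗[ℂ] K) = ((h ⊗ₜ[ℂ] ρ b k : H ⊗[ℂ] K) : HilbertTensor H K))

/-- Approximate unitary equivalence of *-homomorphisms into a unital algebra. -/
def ApproxUnitarilyEquiv {A B : Type u} [CStarAlgebra A] [CStarAlgebra B]
    (φ ψ : A →⋆ₐ[ℂ] B) : Prop :=
  ∃ v : ℕ → unitary B, ∀ a : A,
    Tendsto (fun n => ‖star (v n : B) * φ a * (v n : B) - ψ a‖) atTop (𝓝 0)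

/-- `D` is separable, (unital,) nonzero, not isomorphic to `ℂ`, and there is an isomorphism
`φ : D → D ⊗ D` that is approximately unitarily equivalent to `d ↦ d ⊗ 1`. -/
def IsStronglySelfAbsorbing (D : Type u) [CStarAlgebra D] : Prop :=
  TopologicalSpace.SeparableSpace D ∧ Nontrivial D ∧ IsEmpty (D ≃⋆ₐ[ℂ] ℂ) ∧
  ∃ (E : Type u) (_ : CStarAlgebra E) (ι₁ ι₂ : D →⋆ₐ[ℂ] E),
    IsMinTensorProduct D D E ι₁ ι₂ ∧
    ∃ φ : D ≃⋆ₐ[ℂ] E, ApproxUnitarilyEquiv (φ : D →⋆ₐ[ℂ] E) ι₁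

/-- `A` is `D`-stable: `A ⊗ D ≅ A`. -/
def IsTensorStable (A D : Type u) [CStarAlgebra A] [CStarAlgebra D] : Prop :=
  ∃ (E : Type u) (_ : CStarAlgebra E) (ι₁ : A →⋆ₐ[ℂ] E) (ι₂ : D →⋆ₐ[ℂ] E),
    IsMinTensorProduct A D E ι₁ ι₂ ∧ Nonempty (E ≃⋆ₐ[ℂ] A)

/-- Simplicity: `A ≠ 0` has no closed two-sided ideals but `0` and `A`. -/
def IsSimpleCStar (A : Type u) [CStarAlgebra A] : Prop :=
  Nontrivial A ∧ ∀ I : TwoSidedIdeal A, IsClosed (I : Set A) → I = ⊥ ∨ I = ⊤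

end StronglySelfAbsorbingPaper

-- Tensoring with many copies of `D` makes dimensions grow linearly and ranks grow exponentially;
-- slow dimension growth expresses that the second growth wins. Copies of `D`. The map `d ↦ d ⊗ 1`
-- is approximately unitarily equivalent to an isomorphism, so an approximate intertwining
-- (`exists_intertwining`) produces commuting unital homomorphisms `l 0, l 1, …` from `D` to `D`
-- whose images generate `D` (`IsStronglySelfAbsorbing.exists_commuting_homs`). Let `A` be exhausted
-- by images of recursive subhomogeneous algebras `B i` of dimension `a i`, and `D` by images of
-- such algebras `C i` of dimension `b i`. Inside `A ≅ A ⊗ D` let `S i n` be generated by `B i` in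
-- the first factor and by the copies `l 0, …, l n` of `C i` in the second. Dimensions add, so `S i
-- n` has dimension at most `a i + (n + 1) * b i`. The required system consists of the `S j (n j)`
-- for a rapidly growing sequence `n` (`exists_growing_sequence`). Ranks. The `i`-th stage commutes
-- with the copies `l m` for `n i < m ≤ n j`. If a matrix over the `i`-th stage has a nonzero value
-- over the `j`-th, the range of this value carries `n j - n i` commuting unital representations of
-- a stage of `D`. If that stage is generated by its commutators as an ideal, none of its
-- representations on a nonzero space is scalar, and passing to the kernel and the range of `T - c`,
-- for a nonscalar `T` with eigenvalue `c`, doubles the dimension once per representation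
-- (`two_pow_le_finrank`). So the rank is at least `2 ^ (n j - n i)`, which beats `j` times the cube
-- of the dimension. Such a stage exists because `D` has no characters: slicing `D ⊗ D` by a
-- character would make every element of `D` scalar (`IsStronglySelfAbsorbing.isEmpty_character`).
-- If `A` is simple, a nonzero entry of a projection generates the unit ideal of a later stage, so
-- its values vanish nowhere from then on. Dimensions. That commuting recursive subhomogeneous
-- algebras generate one of the expected dimension (`RSHDimLE.tensor`) is proved by peeling off one
-- layer `C₀(X ∖ X₀, M_n)` of each factor. The closed ideal of `E` generated by the products of two
-- layers is identified with the matrix functions on a closed subset of `X × Y` that vanish on a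
-- smaller closed set: characters of commutative corners give injectivity
-- (`LayerPair.comp_eq_zero`), Stone–Weierstrass gives surjectivity. So `E` is a pullback over its
-- quotient by this ideal, and the quotient is handled by induction. Since only generation by
-- commuting images is assumed, the statement passes to quotients. The inequality for the dimension
-- of `X × Y` comes from Ostrand's colouring theorem. AH algebras are treated alike, with one layer
-- per direct summand. Their base spaces may have infinite dimension, so the stages are first
-- replaced by subalgebras depending on finitely many coordinate functions (`IsAH.hasExhaustion`).

universe v

namespace StronglySelfAbsorbingPaper

/-! ### Covering dimension of products, closed subspaces and cubes. -/

section CoveringDimension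

variable {X : Type u} {Y : Type v} [TopologicalSpace X] [TopologicalSpace Y]

/-- A refinement of a cover, coloured by `Fin (m + 1)` and disjoint in each colour, witnesses
covering dimension at most `m`. -/
theorem exists_refinement_of_colored {m k : ℕ} {U : Fin k → Set X} {ι : Type*} [Finite ι]
    (W : Fin (m + 1) → ι → Set X) (hopen : ∀ c i, IsOpen (W c i))
    (hdisj : ∀ c i j x, x ∈ W c i → x ∈ W c j → i = j) (hsub : ∀ c i, ∃ s, W c i ⊆ U s)
    (hcover : ∀ x, ∃ c i, x ∈ W c i) :
    ∃ (l : ℕ) (V : Fin l → Set X), (∀ j, IsOpen (V j)) ∧ (⋃ j, V j) = Set.univ ∧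
      (∀ j, ∃ i, V j ⊆ U i) ∧ ∀ x, {j | x ∈ V j}.ncard ≤ m + 1 := by
  obtain ⟨l, ⟨e⟩⟩ := Finite.exists_equiv_fin (Fin (m + 1) × ι)
  refine ⟨l, fun j => W (e.symm j).1 (e.symm j).2, fun j => hopen _ _, ?_, fun j => hsub _ _, ?_⟩
  · refine Set.eq_univ_of_forall fun x => ?_
    obtain ⟨c, i, h⟩ := hcover x
    exact Set.mem_iUnion.2 ⟨e (c, i), by simpa using h⟩
  · intro x
    have : Set.InjOn (fun j => (e.symm j).1) {j | x ∈ W (e.symm j).1 (e.symm j).2} := by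
      intro j hj j' hj' hjj
      simp only [Set.mem_ofPred_eq] at hj hj' hjj
      apply e.symm.injective
      refine Prod.ext hjj ?_
      rw [hjj] at hj
      exact hdisj _ _ _ x hj hj'
    calc _ ≤ (Set.univ : Set (Fin (m + 1))).ncard :=
          Set.ncard_le_ncard_of_injOn _ (fun _ _ => Set.mem_univ _) this
      _ = m + 1 := by simp

/-- Ostrand's colouring theorem: for every number `c` of colours there is a refinement of a given
cover by `c` disjoint families such that each point is missed by at most `m` of them. -/
theorem CoveringDimLE.exists_colored [NormalSpace X] {m : ℕ} (h : CoveringDimLE X m) {k : ℕ}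
    (U : Fin k → Set X) (hU : ∀ i, IsOpen (U i)) (hcov : (⋃ i, U i) = Set.univ) (c : ℕ) :
    ∃ (ι : Type) (_ : Finite ι) (W : Fin c → ι → Set X), (∀ r i, IsOpen (W r i)) ∧
      (∀ r i j x, x ∈ W r i → x ∈ W r j → i = j) ∧ (∀ r i, ∃ s, W r i ⊆ U s) ∧
      ∀ x, {r | ∀ i, x ∉ W r i}.ncard ≤ m := by
  obtain ⟨l, V, hVo, hVc, hVU, hVn⟩ := h k U hU hcov
  obtain ⟨ρ, hρ⟩ := PartitionOfUnity.exists_isSubordinate_of_locallyFinite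
    (isClosed_univ (X := X)) V hVo (locallyFinite_of_finite V) hVc.symm.subset
  have hsupp : ∀ i x, 0 < ρ i x → x ∈ V i := fun i x hx =>
    hρ i (subset_tsupport _ (Function.mem_support.2 hx.ne'))
  have hsum : ∀ x, ∑ i, ρ i x = 1 := fun x => by
    rw [← finsum_eq_sum_of_fintype]; exact ρ.sum_eq_one (Set.mem_univ x)
  -- At most `m + 1` of the functions are nonzero at `x`, and they add up to `1`.
  have hmax : ∀ x, ∃ i, 1 / ((m : ℝ) + 1) ≤ ρ i x := by
    intro x
    by_contra! hcon
    classical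
    have hfin : ({i | x ∈ V i} : Set (Fin l)).ncard = (Finset.univ.filter fun i => x ∈ V i).card := by
      rw [← Set.ncard_coe_finset]; simp
    have h1 : ∑ i, ρ i x = ∑ i ∈ Finset.univ.filter (fun i => x ∈ V i), ρ i x := by
      symm
      apply Finset.sum_subset (Finset.filter_subset _ _)
      intro i _ hi
      by_contra hne
      exact hi (by simpa using hsupp i x (lt_of_le_of_ne (ρ.nonneg i x) (Ne.symm hne)))
    have hne : (Finset.univ.filter fun i => x ∈ V i).Nonempty := by
      rw [Finset.nonempty_iff_ne_empty]
      intro h0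
      rw [h0, hsum x] at h1
      simp at h1
    have h2 : ∑ i ∈ Finset.univ.filter (fun i => x ∈ V i), ρ i x
        < ∑ i ∈ Finset.univ.filter (fun i => x ∈ V i), 1 / ((m : ℝ) + 1) :=
      Finset.sum_lt_sum_of_nonempty hne fun i _ => hcon i
    rw [← h1, hsum x, Finset.sum_const, nsmul_eq_mul, ← hfin] at h2
    have h3 : (({i | x ∈ V i} : Set (Fin l)).ncard : ℝ) ≤ m + 1 := by exact_mod_cast hVn x
    have h4 : (({i | x ∈ V i} : Set (Fin l)).ncard : ℝ) * (1 / ((m : ℝ) + 1)) ≤ 1 := by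
      rw [mul_one_div, div_le_one (by positivity)]; exact h3
    linarith
  -- One threshold per colour, all distinct and below `1 / (m + 1)`. The members of colour `r` sort
  -- the points by the set of indices whose functions exceed `τ r`.
  let τ : Fin c → ℝ := fun r => 1 / (((m : ℝ) + 1) * (r + 2))
  have hτpos : ∀ r, 0 < τ r := fun r => by positivity
  have hτlt : ∀ r, τ r < 1 / ((m : ℝ) + 1) := fun r => by
    apply one_div_lt_one_div_of_lt (by positivity)
    have : (0 : ℝ) ≤ (r : ℕ) := Nat.cast_nonneg _
    nlinarith [(Nat.cast_nonneg m : (0 : ℝ) ≤ m)]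
  have hτinj : Function.Injective τ := by
    intro r s hrs
    have hm : (m : ℝ) + 1 ≠ 0 := by positivity
    have h1 : ((m : ℝ) + 1) * ((r : ℕ) + 2) = ((m : ℝ) + 1) * ((s : ℕ) + 2) := by
      have := congrArg (fun z => z⁻¹) hrs
      simpa only [τ, one_div, inv_inv] using this
    have h2 := mul_left_cancel₀ hm h1
    have h3 : ((r : ℕ) : ℝ) = (s : ℕ) := by linarith
    exact Fin.ext (by exact_mod_cast h3)
  refine ⟨{S : Finset (Fin l) // S.Nonempty}, inferInstance,
    fun r S => {x | (∀ i ∈ S.1, τ r < ρ i x) ∧ ∀ i ∉ S.1, ρ i x < τ r}, ?_, ?_, ?_, ?_⟩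
  · intro r S
    have : {x | (∀ i ∈ S.1, τ r < ρ i x) ∧ ∀ i ∉ S.1, ρ i x < τ r}
        = (⋂ i ∈ S.1, {x | τ r < ρ i x}) ∩ ⋂ i ∈ {i | i ∉ S.1}, {x | ρ i x < τ r} := by
      ext x; simp
    change IsOpen {x | (∀ i ∈ S.1, τ r < ρ i x) ∧ ∀ i ∉ S.1, ρ i x < τ r}
    rw [this]
    exact (isOpen_biInter_finset fun i _ => isOpen_lt continuous_const (ρ i).continuous).inter
      ((Set.toFinite _).isOpen_biInter fun i _ => isOpen_lt (ρ i).continuous continuous_const)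
  · rintro r S T x ⟨h1, h2⟩ ⟨h3, h4⟩
    ext i
    constructor
    · intro hi; by_contra hT; exact absurd (h1 i hi) (h4 i hT).not_gt
    · intro hi; by_contra hT; exact absurd (h3 i hi) (h2 i hT).not_gt
  · rintro r ⟨S, i, hi⟩
    obtain ⟨s, hs⟩ := hVU i
    exact ⟨s, fun x hx => hs (hsupp i x ((hτpos r).trans (hx.1 i hi)))⟩
  · intro x
    obtain ⟨i₀, hi₀⟩ := hmax x
    -- Colour `r` misses `x` only if some `ρ i x` equals `τ r`. As the thresholds are distinct, the
    -- missing colours inject into the indices with `x ∈ V i`, and they avoid `i₀`, whose function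
    -- exceeds all thresholds; this saves one.
    have key : ∀ r ∈ {r | ∀ i : {S : Finset (Fin l) // S.Nonempty},
        x ∉ {x | (∀ j ∈ i.1, τ r < ρ j x) ∧ ∀ j ∉ i.1, ρ j x < τ r}}, ∃ i, ρ i x = τ r := by
      intro r hr
      by_contra! hne
      classical
      refine hr ⟨Finset.univ.filter fun i => τ r < ρ i x, i₀, ?_⟩ ⟨?_, ?_⟩
      · simpa using (hτlt r).trans_le hi₀
      · intro j hj; simpa using hj
      · intro j hj
        simp only [Finset.mem_filter, Finset.mem_univ, true_and, not_lt] at hj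
        exact lt_of_le_of_ne hj (hne j)
    have : Nonempty (Fin l) := ⟨i₀⟩
    choose! g hg using key
    have h1 : ({r | ∀ i : {S : Finset (Fin l) // S.Nonempty},
        x ∉ {x | (∀ j ∈ i.1, τ r < ρ j x) ∧ ∀ j ∉ i.1, ρ j x < τ r}} : Set (Fin c)).ncard
        ≤ ({i | x ∈ V i} \ {i₀} : Set (Fin l)).ncard := by
      apply Set.ncard_le_ncard_of_injOn g
      · intro r hr
        refine ⟨hsupp _ _ (by rw [hg r hr]; exact hτpos r), fun h => ?_⟩
        rw [Set.mem_singleton_iff] at h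
        have := hg r hr
        rw [h] at this
        linarith [hτlt r]
      · intro r hr s hs hrs
        exact hτinj (by rw [← hg r hr, ← hg s hs, hrs])
    have h2 : i₀ ∈ ({i | x ∈ V i} : Set (Fin l)) :=
      hsupp _ _ (lt_of_lt_of_le (by positivity) hi₀)
    have h3 := Set.ncard_sdiff_singleton_add_one h2
    have h4 := hVn x
    refine h1.trans ?_
    omega

theorem iUnion_equivFin_symm_eq_univ {Z : Type*} {f : Z → Set Z} {s : Finset Z}
    (hs : Set.univ ⊆ ⋃ x ∈ s, f x) :
    (⋃ i : Fin s.card, f (s.equivFin.symm i)) = Set.univ := by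
  refine Set.eq_univ_of_forall fun z => ?_
  obtain ⟨x, hx, hz⟩ := Set.mem_iUnion₂.1 (hs (Set.mem_univ z))
  exact Set.mem_iUnion.2 ⟨s.equivFin ⟨x, hx⟩, by simpa using hz⟩

/-- Colour both factors with `a + b + 1` colours. At most `a` colours miss the first coordinate of a
point and at most `b` miss the second, so some colour catches both; the products of two sets of one
colour again form a disjoint family. -/
theorem CoveringDimLE.prod [CompactSpace X] [T2Space X] [CompactSpace Y] [T2Space Y] {a b : ℕ}
    (hX : CoveringDimLE X a) (hY : CoveringDimLE Y b) : CoveringDimLE (X × Y) (a + b) := by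
  intro k U hU hcov
  -- The uniformities turn smallness relative to the cover `U` into conditions on the two factors
  -- separately.
  let := uniformSpaceOfCompactR1 (γ := X)
  let := uniformSpaceOfCompactR1 (γ := Y)
  obtain ⟨E, hE, hEU⟩ := lebesgue_number_lemma (isCompact_univ (X := X × Y)) hU hcov.symm.subset
  rw [uniformity_prod, Filter.mem_inf_iff_superset] at hE
  obtain ⟨E₁, hE₁, E₂, hE₂, hE₁₂⟩ := hE
  obtain ⟨F, hF, hF₁⟩ := Filter.mem_comap.1 hE₁
  obtain ⟨G, hG, hG₂⟩ := Filter.mem_comap.1 hE₂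
  obtain ⟨s, hs⟩ := (isCompact_univ (X := X)).elim_finite_subcover
    (fun x => interior (UniformSpace.ball x F)) (fun x => isOpen_interior)
    fun x _ => Set.mem_iUnion.2 ⟨x, mem_interior_iff_mem_nhds.2 (UniformSpace.ball_mem_nhds x hF)⟩
  obtain ⟨t, ht⟩ := (isCompact_univ (X := Y)).elim_finite_subcover
    (fun x => interior (UniformSpace.ball x G)) (fun x => isOpen_interior)
    fun x _ => Set.mem_iUnion.2 ⟨x, mem_interior_iff_mem_nhds.2 (UniformSpace.ball_mem_nhds x hG)⟩
  obtain ⟨ι, _, W, hW1, hW2, hW3, hW4⟩ := hX.exists_colored _ (fun i => isOpen_interior)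
    (iUnion_equivFin_symm_eq_univ hs) (a + b + 1)
  obtain ⟨κ, _, W', hW'1, hW'2, hW'3, hW'4⟩ := hY.exists_colored _ (fun i => isOpen_interior)
    (iUnion_equivFin_symm_eq_univ ht) (a + b + 1)
  refine exists_refinement_of_colored (ι := ι × κ) (fun c p => W c p.1 ×ˢ W' c p.2)
    (fun c p => (hW1 _ _).prod (hW'1 _ _)) ?_ ?_ ?_
  · rintro c ⟨i, j⟩ ⟨i', j'⟩ ⟨x, y⟩ ⟨h1, h2⟩ ⟨h3, h4⟩
    exact Prod.ext (hW2 c _ _ x h1 h3) (hW'2 c _ _ y h2 h4)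
  · rintro c ⟨i, j⟩
    obtain ⟨p, hp⟩ := hW3 c i
    obtain ⟨q, hq⟩ := hW'3 c j
    obtain ⟨r, hr⟩ := hEU (((s.equivFin.symm p : s) : X), ((t.equivFin.symm q : t) : Y))
      (Set.mem_univ _)
    refine ⟨r, fun z hz => hr ?_⟩
    have h1 : z.1 ∈ UniformSpace.ball _ F := interior_subset (hp hz.1)
    have h2 : z.2 ∈ UniformSpace.ball _ G := interior_subset (hq hz.2)
    exact hE₁₂ ⟨hF₁ h1, hG₂ h2⟩
  · rintro ⟨x, y⟩
    by_contra! hcon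
    have : (Set.univ : Set (Fin (a + b + 1))) ⊆ {r | ∀ i, x ∉ W r i} ∪ {r | ∀ i, y ∉ W' r i} := by
      intro c _
      by_contra hc
      simp only [Set.mem_union, Set.mem_ofPred_eq, not_or, not_forall, not_not] at hc
      obtain ⟨⟨i, hi⟩, ⟨j, hj⟩⟩ := hc
      exact hcon c (i, j) ⟨hi, hj⟩
    have h1 := (Set.ncard_le_ncard this).trans (Set.ncard_union_le _ _)
    have h2 := hW4 x
    have h3 := hW'4 y
    simp only [Set.ncard_univ, Nat.card_eq_fintype_card, Fintype.card_fin] at h1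
    omega

theorem CoveringDimLE.of_isClosedEmbedding {m : ℕ} (h : CoveringDimLE X m) {f : Y → X}
    (hf : IsClosedEmbedding f) : CoveringDimLE Y m := by
  intro k U hU hcov
  choose O hO hOU using fun i => hf.isInducing.isOpen_iff.1 (hU i)
  obtain ⟨l, V, hVo, hVc, hVU, hVn⟩ := h (k + 1)
    (Fin.cons (Set.range f)ᶜ O) (by
      intro i
      refine Fin.cases ?_ (fun i => ?_) i
      · simpa using hf.isClosed_range
      · simpa using hO i) (by
      refine Set.eq_univ_of_forall fun x => ?_
      by_cases hx : x ∈ Set.range f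
      · obtain ⟨y, rfl⟩ := hx
        obtain ⟨i, hi⟩ := Set.mem_iUnion.1 (hcov.symm.subset (Set.mem_univ y))
        exact Set.mem_iUnion.2 ⟨i.succ, by rw [← hOU i] at hi; simpa using hi⟩
      · exact Set.mem_iUnion.2 ⟨0, by simpa using hx⟩)
  classical
  -- A member inside the complement of the range has empty preimage, and still needs some `U i`
  -- containing it; there is one unless `Y` is empty.
  by_cases hY : Nonempty Y
  · obtain ⟨y₀⟩ := hY
    obtain ⟨i₀, -⟩ := Set.mem_iUnion.1 (hcov.symm.subset (Set.mem_univ y₀))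
    refine ⟨l, fun j => f ⁻¹' V j, fun j => (hVo j).preimage hf.continuous, ?_, ?_, fun y => hVn (f y)⟩
    · rw [← Set.preimage_iUnion, hVc, Set.preimage_univ]
    · intro j
      obtain ⟨i, hi⟩ := hVU j
      revert hi
      refine Fin.cases ?_ (fun i => ?_) i
      · intro hi
        refine ⟨i₀, fun y hy => ?_⟩
        simpa using hi hy
      · intro hi
        exact ⟨i, fun y hy => by rw [← hOU i]; simpa using hi hy⟩
  · rw [not_nonempty_iff] at hY
    exact ⟨0, fun i => i.elim0, fun i => i.elim0, Set.eq_univ_of_forall fun y => hY.elim y,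
      fun i => i.elim0, fun y => hY.elim y⟩

theorem CoveringDimLE.subtype_of_isClosed {m : ℕ} (h : CoveringDimLE X m) {s : Set X}
    (hs : IsClosed s) : CoveringDimLE s m :=
  h.of_isClosedEmbedding hs.isClosedEmbedding_subtypeVal

theorem CoveringDimLE.mono {m m' : ℕ} (h : CoveringDimLE X m) (hm : m ≤ m') :
    CoveringDimLE X m' := by
  intro k U hU hcov
  obtain ⟨l, V, h1, h2, h3, h4⟩ := h k U hU hcov
  exact ⟨l, V, h1, h2, h3, fun x => (h4 x).trans (by omega)⟩

theorem CoveringDimLE.sum {m : ℕ} (hX : CoveringDimLE X m) (hY : CoveringDimLE Y m) :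
    CoveringDimLE (X ⊕ Y) m := by
  intro k U hU hcov
  obtain ⟨l, V, h1, h2, h3, h4⟩ := hX k (fun i => Sum.inl ⁻¹' U i)
    (fun i => (hU i).preimage continuous_inl) (by rw [← Set.preimage_iUnion, hcov, Set.preimage_univ])
  obtain ⟨l', V', h1', h2', h3', h4'⟩ := hY k (fun i => Sum.inr ⁻¹' U i)
    (fun i => (hU i).preimage continuous_inr) (by rw [← Set.preimage_iUnion, hcov, Set.preimage_univ])
  refine ⟨l + l', Fin.append (fun j => Sum.inl '' V j) (fun j => Sum.inr '' V' j), ?_, ?_, ?_, ?_⟩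
  · intro j
    refine Fin.addCases (fun j => ?_) (fun j => ?_) j
    · simpa using isOpenMap_inl _ (h1 j)
    · simpa using isOpenMap_inr _ (h1' j)
  · refine Set.eq_univ_of_forall fun z => ?_
    rcases z with x | y
    · obtain ⟨j, hj⟩ := Set.mem_iUnion.1 (h2.symm.subset (Set.mem_univ x))
      exact Set.mem_iUnion.2 ⟨Fin.castAdd _ j, by simpa using hj⟩
    · obtain ⟨j, hj⟩ := Set.mem_iUnion.1 (h2'.symm.subset (Set.mem_univ y))
      exact Set.mem_iUnion.2 ⟨Fin.natAdd _ j, by simpa using hj⟩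
  · intro j
    refine Fin.addCases (fun j => ?_) (fun j => ?_) j
    · obtain ⟨i, hi⟩ := h3 j
      exact ⟨i, by simpa using hi⟩
    · obtain ⟨i, hi⟩ := h3' j
      exact ⟨i, by simpa using hi⟩
  · rintro (x | y)
    · refine le_trans ?_ (h4 x)
      have : {j | Sum.inl x ∈ Fin.append (fun j => (Sum.inl '' V j : Set (X ⊕ Y)))
          (fun j => Sum.inr '' V' j) j} ⊆ Fin.castAdd l' '' {j | x ∈ V j} := by
        intro j
        refine Fin.addCases (fun j => ?_) (fun j => ?_) j
        · intro hj; exact ⟨j, by simpa using hj, rfl⟩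
        · intro hj; simp at hj
      exact (Set.ncard_le_ncard this).trans (Set.ncard_image_le)
    · refine le_trans ?_ (h4' y)
      have : {j | Sum.inr y ∈ Fin.append (fun j => (Sum.inl '' V j : Set (X ⊕ Y)))
          (fun j => Sum.inr '' V' j) j} ⊆ Fin.natAdd l '' {j | y ∈ V' j} := by
        intro j
        refine Fin.addCases (fun j => ?_) (fun j => ?_) j
        · intro hj; simp at hj
        · intro hj; exact ⟨j, by simpa using hj, rfl⟩
      exact (Set.ncard_le_ncard this).trans (Set.ncard_image_le)

theorem CoveringDimLE.of_isEmpty [IsEmpty X] (m : ℕ) : CoveringDimLE X m := fun _ _ _ _ =>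
  ⟨0, fun i => i.elim0, fun i => i.elim0, Set.eq_univ_of_forall fun y => isEmptyElim y,
    fun i => i.elim0, fun y => isEmptyElim y⟩

theorem coveringDim_le {m : ℕ} (h : CoveringDimLE X m) : coveringDim X ≤ m :=
  iInf₂_le m h

theorem exists_coveringDimLE (h : coveringDim X ≠ ⊤) : ∃ m, CoveringDimLE X m := by
  by_contra! hcon
  exact h (by simp [coveringDim, hcon])

theorem coveringDimLE_unitInterval : CoveringDimLE unitInterval 1 := by
  intro k U hU hcov
  obtain ⟨δ, hδ, hδU⟩ := lebesgue_number_lemma_of_metric (isCompact_univ (X := unitInterval)) hU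
    hcov.symm.subset
  obtain ⟨M, hM⟩ := exists_nat_one_div_lt hδ
  have hM0 : (0 : ℝ) < (M : ℝ) + 1 := by positivity
  have small : ∀ s : Set unitInterval, (∀ x ∈ s, ∀ y ∈ s, |x.1 * (M + 1) - y.1 * (M + 1)| < 1) →
      ∃ i, s ⊆ U i := by
    intro s hs
    rcases s.eq_empty_or_nonempty with rfl | ⟨x, hx⟩
    · obtain ⟨i, -⟩ := Set.mem_iUnion.1 (hcov.symm.subset (Set.mem_univ 0))
      exact ⟨i, Set.empty_subset _⟩
    · obtain ⟨i, hi⟩ := hδU x (Set.mem_univ x)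
      refine ⟨i, fun y hy => hi ?_⟩
      have := hs y hy x hx
      rw [← sub_mul, abs_mul, abs_of_pos hM0, ← lt_div_iff₀ hM0] at this
      rw [Metric.mem_ball, Subtype.dist_eq, Real.dist_eq]
      linarith
  have hc : ∀ c : ℝ, Continuous fun x : unitInterval => x.1 * ((M : ℝ) + 1) - c := fun c => by
    fun_prop
  -- After scaling by `M + 1`, colour `0` consists of the open intervals between consecutive
  -- integers and colour `1` of the balls of radius `1 / 4` about the integers `0, …, M + 1`.
  refine exists_refinement_of_colored (m := 1) (ι := Fin (M + 2))
    (fun c i => if c = 0 then {x | 0 < x.1 * ((M : ℝ) + 1) - i ∧ x.1 * ((M : ℝ) + 1) - i < 1}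
      else {x | |x.1 * ((M : ℝ) + 1) - i| < 1 / 4}) ?_ ?_ ?_ ?_
  · intro c i
    split_ifs
    · exact (isOpen_lt continuous_const (hc _)).inter (isOpen_lt (hc _) continuous_const)
    · exact isOpen_lt (hc _).abs continuous_const
  · intro c i j x hi hj
    have key : |((i : ℕ) : ℝ) - (j : ℕ)| < 1 := by
      split_ifs at hi hj
      · rw [abs_lt]; constructor <;> linarith [hi.1, hi.2, hj.1, hj.2]
      · have h1 := abs_lt.1 hi.out
        have h2 := abs_lt.1 hj.out
        rw [abs_lt]; constructor <;> linarith [h1.1, h1.2, h2.1, h2.2]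
    have h3 : |((i : ℕ) : ℤ) - (j : ℕ)| < 1 := by exact_mod_cast key
    rw [Int.abs_lt_one_iff] at h3
    exact Fin.ext (by omega)
  · intro c i
    refine small _ fun x hx y hy => ?_
    split_ifs at hx hy
    · rw [abs_lt]; constructor <;> linarith [hx.1, hx.2, hy.1, hy.2]
    · have h1 := abs_lt.1 hx.out
      have h2 := abs_lt.1 hy.out
      rw [abs_lt]; constructor <;> linarith [h1.1, h1.2, h2.1, h2.2]
  · intro x
    have hx0 : 0 ≤ x.1 * ((M : ℝ) + 1) := mul_nonneg x.2.1 hM0.le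
    have hx1 : x.1 * ((M : ℝ) + 1) ≤ M + 1 := by nlinarith [x.2.2]
    have h1 := Nat.floor_le hx0
    have h2 := Nat.lt_floor_add_one (x.1 * ((M : ℝ) + 1))
    have h3 : ⌊x.1 * ((M : ℝ) + 1)⌋₊ < M + 2 := by
      have : ⌊x.1 * ((M : ℝ) + 1)⌋₊ ≤ M + 1 := by
        apply Nat.floor_le_of_le; push_cast; exact hx1
      omega
    rcases h1.eq_or_lt with h | h
    · refine ⟨1, ⟨_, h3⟩, ?_⟩
      rw [if_neg (by decide)]
      change |x.1 * ((M : ℝ) + 1) - (⌊x.1 * ((M : ℝ) + 1)⌋₊ : ℕ)| < 1 / 4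
      rw [h]; norm_num
    · refine ⟨0, ⟨_, h3⟩, ?_⟩
      rw [if_pos rfl]
      exact ⟨by simpa using h, by simp only; linarith⟩

theorem coveringDimLE_cube (n : ℕ) : CoveringDimLE (Fin n → unitInterval) n := by
  induction n with
  | zero =>
    intro k U hU hcov
    obtain ⟨i, hi⟩ := Set.mem_iUnion.1 (hcov.symm.subset (Set.mem_univ (default : Fin 0 → _)))
    refine ⟨1, fun _ => Set.univ, fun _ => isOpen_univ, Set.iUnion_const _, fun _ => ⟨i, fun x _ => ?_⟩,
      fun x => by simp⟩
    rwa [Subsingleton.elim x default]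
  | succ n ih =>
    let F : (Fin (n + 1) → unitInterval) → unitInterval × (Fin n → unitInterval) :=
      fun x => (x 0, fun i : Fin n => x i.succ)
    have hc : Continuous F := by fun_prop
    have he : IsClosedEmbedding F := by
      refine hc.isClosedEmbedding fun x y hxy => funext fun i => ?_
      exact Fin.cases (congrArg Prod.fst hxy) (fun j => congrFun (congrArg Prod.snd hxy) j) i
    exact ((coveringDimLE_unitInterval.prod ih).mono (add_comm 1 n).le).of_isClosedEmbedding he

/-- A compact space on which `n` real functions separate the points has dimension at most `n`. -/
theorem coveringDimLE_of_separating [CompactSpace X] {κ : Type*} [Fintype κ] (f : κ → C(X, ℝ))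
    (hf : ∀ x y, (∀ i, f i x = f i y) → x = y) : CoveringDimLE X (Fintype.card κ) := by
  let F : X → Fin (Fintype.card κ) → unitInterval := fun x i =>
    unitInterval.sigmoid (f ((Fintype.equivFin κ).symm i) x)
  have hF : Continuous F := by
    refine continuous_pi fun i => ?_
    exact unitInterval.continuous_sigmoid.comp (f _).continuous
  refine (coveringDimLE_cube _).of_isClosedEmbedding (hF.isClosedEmbedding fun x y hxy => ?_)
  refine hf x y fun i => ?_
  have := congrFun hxy (Fintype.equivFin κ i)
  simpa [F] using unitInterval.sigmoid_strictMono.injective this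

end CoveringDimension

/-! ### Quotients of C*-algebras by closed ideals. -/

section Quotient

variable {E : Type*} [CStarAlgebra E]

/-- For every `l` and `ε > 0` there is a self-adjoint contraction `w` with `l * w` small and
`1 - w` a multiple of `star l * l`. -/
theorem exists_cutoff (l : E) {ε : ℝ} (hε : 0 < ε) :
    ∃ w g : E, star w = w ∧ ‖w‖ ≤ 1 ∧ ‖l * w‖ ≤ ε ∧ 1 - w = g * (star l * l) := by
  set h : E := star l * l with hh
  have hsa : IsSelfAdjoint h := IsSelfAdjoint.star_mul_self l
  have hpos : ∀ t ∈ spectrum ℝ h, 0 ≤ t := spectrum_star_mul_self_nonneg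
  -- For `w = δ / (h + δ)` the squared norm of `l * w` is at most the supremum of `t * (δ / (t + δ))
  -- ^ 2`, which is at most `δ`; moreover `1 - w = h / (h + δ)`.
  set δ : ℝ := ε ^ 2 with hδ
  have hδ0 : 0 < δ := by positivity
  have hc1 : ContinuousOn (fun t : ℝ => δ / (t + δ)) (spectrum ℝ h) :=
    continuousOn_const.div (by fun_prop) fun t ht => by have := hpos t ht; positivity
  have hc2 : ContinuousOn (fun t : ℝ => 1 / (t + δ)) (spectrum ℝ h) :=
    continuousOn_const.div (by fun_prop) fun t ht => by have := hpos t ht; positivity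
  have hid : ContinuousOn (fun t : ℝ => t) (spectrum ℝ h) := continuousOn_id
  set w : E := cfc (fun t : ℝ => δ / (t + δ)) h with hw
  have hwsa : star w = w := (cfc_predicate (R := ℝ) _ h : IsSelfAdjoint w).star_eq
  refine ⟨w, cfc (fun t : ℝ => 1 / (t + δ)) h, hwsa, ?_, ?_, ?_⟩
  · refine norm_cfc_le zero_le_one fun t ht => ?_
    have := hpos t ht
    rw [Real.norm_eq_abs, abs_of_nonneg (by positivity), div_le_one (by positivity)]
    linarith
  · have h1 : star (l * w) * (l * w)
        = cfc (fun t : ℝ => δ / (t + δ) * (t * (δ / (t + δ)))) h := by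
      rw [cfc_mul (fun t : ℝ => δ / (t + δ)) (fun t : ℝ => t * (δ / (t + δ))) h hc1 (hid.mul hc1),
        cfc_mul (fun t : ℝ => t) _ h hid hc1, ← hw, cfc_id' ℝ h, star_mul, hwsa]
      simp only [hh, mul_assoc]
    have h2 : ‖star (l * w) * (l * w)‖ ≤ ε ^ 2 := by
      rw [h1]
      refine norm_cfc_le (by positivity) fun t ht => ?_
      have ht0 := hpos t ht
      rw [Real.norm_eq_abs, abs_of_nonneg (by positivity)]
      have h3 : δ / (t + δ) ≤ 1 := by rw [div_le_one (by positivity)]; linarith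
      have h4 : t * (δ / (t + δ)) ≤ δ := by
        rw [mul_div_assoc', div_le_iff₀ (by positivity)]; nlinarith
      have h5 : 0 ≤ t * (δ / (t + δ)) := by positivity
      nlinarith
    rw [CStarRing.norm_star_mul_self, ← sq] at h2
    exact le_of_sq_le_sq h2 hε.le
  · have h1 : (1 : E) = cfc (fun _ : ℝ => (1 : ℝ)) h := by rw [cfc_const_one ℝ h]
    have h2 : cfc (fun t : ℝ => 1 / (t + δ)) h * h
        = cfc (fun t : ℝ => 1 / (t + δ) * t) h := by
      rw [cfc_mul (fun t : ℝ => 1 / (t + δ)) (fun t : ℝ => t) h hc2 hid, cfc_id' ℝ h]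
    rw [h2, h1, hw, ← cfc_sub _ _ h continuousOn_const hc1]
    refine cfc_congr fun t ht => ?_
    have := hpos t ht
    have : t + δ ≠ 0 := by positivity
    field_simp
    ring

/-- Closed two-sided ideals are invariant under the involution. -/
theorem TwoSidedIdeal.star_mem_of_isClosed {L : TwoSidedIdeal E} (hcl : IsClosed (L : Set E)) {x : E}
    (hx : x ∈ L) : star x ∈ L := by
  have : star x ∈ closure (L : Set E) := by
    refine Metric.mem_closure_iff.2 fun ε hε => ?_
    -- For `l = star x` the element `star l * l = x * star x` lies in `L`, hence so does `1 - w`.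
    obtain ⟨w, g, -, -, hw, hg⟩ := exists_cutoff (star x) (half_pos hε)
    refine ⟨star x * (1 - w), L.mul_mem_left _ _ ?_, ?_⟩
    · rw [hg, star_star]
      exact L.mul_mem_left _ _ (L.mul_mem_right _ _ hx)
    · rw [dist_eq_norm, mul_sub, mul_one, sub_sub_cancel]
      linarith
  rwa [hcl.closure_eq] at this

/-- The quotient of a C*-algebra by a closed two-sided ideal is a C*-algebra. -/
theorem exists_quotient {E : Type u} [CStarAlgebra E] (L : TwoSidedIdeal E)
    (hcl : IsClosed (L : Set E)) :
    ∃ (Q : Type u) (_ : CStarAlgebra Q) (π : E →⋆ₐ[ℂ] Q), Function.Surjective π ∧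
      ∀ x, π x = 0 ↔ x ∈ L := by
  have hstar : ∀ x ∈ L, star x ∈ L := fun x hx => TwoSidedIdeal.star_mem_of_isClosed hcl hx
  set I : Ideal E := TwoSidedIdeal.asIdeal L with hI
  have hIL : ∀ x, x ∈ I ↔ x ∈ L := fun x => TwoSidedIdeal.mem_asIdeal
  have : IsClosed (I : Set E) := by
    have : (I : Set E) = L := Set.ext hIL
    rwa [this]
  have nlt : ∀ (x : E ⧸ I) {ε : ℝ}, 0 < ε → ∃ r : E, Ideal.Quotient.mk I r = x ∧ ‖r‖ < ‖x‖ + ε :=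
    fun x ε hε => QuotientAddGroup.exists_norm_mk_lt x hε
  have nle : ∀ r : E, ‖Ideal.Quotient.mk I r‖ ≤ ‖r‖ := fun r => QuotientAddGroup.norm_mk_le_norm
  let _ : NormedRing (E ⧸ I) :=
    { Submodule.Quotient.normedAddCommGroup I, Ideal.Quotient.ring I with
      norm_mul_le := fun x y => le_of_forall_pos_le_add fun ε hε => by
        have := ((Metric.nhds_basis_ball.prod_nhds Metric.nhds_basis_ball).tendsto_iff
          Metric.nhds_basis_ball).mp (continuous_mul.tendsto (‖x‖, ‖y‖)) ε hε
        simp only [Set.mem_prod, Metric.mem_ball, and_imp, Prod.forall, Prod.exists] at this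
        rcases this with ⟨ε₁, ε₂, ⟨h₁, h₂⟩, h⟩
        obtain ⟨⟨a, rfl, ha⟩, ⟨b, rfl, hb⟩⟩ := nlt x h₁, nlt y h₂
        simp only [dist, abs_sub_lt_iff] at h
        specialize h ‖a‖ ‖b‖ ⟨by linarith, by linarith [nle a]⟩ ⟨by linarith, by linarith [nle b]⟩
        calc
          _ ≤ ‖a‖ * ‖b‖ := (nle (a * b)).trans (norm_mul_le a b)
          _ ≤ _ := (sub_lt_iff_lt_add'.mp h.1).le }
  have surj : Function.Surjective (Ideal.Quotient.mk I) := Ideal.Quotient.mk_surjective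
  have mk0 : ∀ a, Ideal.Quotient.mk I a = 0 ↔ a ∈ L := fun a =>
    Ideal.Quotient.eq_zero_iff_mem.trans (hIL a)
  obtain ⟨st, hst⟩ : ∃ st : E ⧸ I → E ⧸ I, ∀ a, st (Ideal.Quotient.mk I a)
      = Ideal.Quotient.mk I (star a) := by
    refine ⟨fun x => Ideal.Quotient.mk I (star (surj x).choose), fun a => ?_⟩
    have h1 := (surj (Ideal.Quotient.mk I a)).choose_spec
    rw [← sub_eq_zero, ← map_sub, mk0] at h1
    rw [← sub_eq_zero, ← map_sub, mk0, ← star_sub]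
    exact hstar _ h1
  let _ : StarRing (E ⧸ I) :=
    { star := st
      star_involutive := fun x => by
        obtain ⟨a, rfl⟩ := surj x
        rw [hst, hst, star_star]
      star_mul := fun x y => by
        obtain ⟨a, rfl⟩ := surj x
        obtain ⟨b, rfl⟩ := surj y
        change st _ = st _ * st _
        rw [← map_mul, hst, hst, hst, star_mul, map_mul]
      star_add := fun x y => by
        obtain ⟨a, rfl⟩ := surj x
        obtain ⟨b, rfl⟩ := surj y
        change st _ = st _ + st _
        rw [← map_add, hst, hst, hst, star_add, map_add] }
  have hstar_mk : ∀ a, star (Ideal.Quotient.mk I a) = Ideal.Quotient.mk I (star a) := hst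
  have : CStarRing (E ⧸ I) :=
    { norm_mul_self_le := fun x => by
        obtain ⟨a, rfl⟩ := surj x
        rw [hstar_mk, ← map_mul]
        refine le_of_forall_pos_le_add fun ε hε => ?_
        -- Take a nearly optimal representative `r` of the class of `star a * a`, and cut off their
        -- difference, which is in `L`. Then `a * w` has the class of `a`, and `w * (star a * a) *
        -- w` is within `ε / 2` of `w * r * w`, so `‖a * w‖ ^ 2 ≤ ‖r‖ + ε / 2`.
        obtain ⟨r, hr, hrn⟩ := nlt (Ideal.Quotient.mk I (star a * a)) (half_pos hε)
        have hl : r - star a * a ∈ L := by rw [← mk0, map_sub, hr, sub_self]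
        obtain ⟨w, g, hws, hwn, hlw, hwg⟩ := exists_cutoff (r - star a * a) (half_pos hε)
        have h1w : 1 - w ∈ L := by
          rw [hwg]; exact L.mul_mem_left _ _ (L.mul_mem_left _ _ hl)
        have hmk : Ideal.Quotient.mk I (a * w) = Ideal.Quotient.mk I a := by
          rw [← sub_eq_zero, ← map_sub, mk0]
          have : a * w - a = -(a * (1 - w)) := by rw [mul_sub, mul_one]; abel
          rw [this]
          exact L.neg_mem (L.mul_mem_left _ _ h1w)
        have h1 : ‖Ideal.Quotient.mk I a‖ ≤ ‖a * w‖ := by rw [← hmk]; exact nle _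
        have h2 : ‖a * w‖ * ‖a * w‖ = ‖star (a * w) * (a * w)‖ :=
          (CStarRing.norm_star_mul_self).symm
        have h3 : star (a * w) * (a * w) = w * r * w - w * ((r - star a * a) * w) := by
          rw [star_mul, hws]; noncomm_ring
        have h4 : ‖w * r * w‖ ≤ ‖r‖ := by
          calc ‖w * r * w‖ ≤ ‖w‖ * ‖r‖ * ‖w‖ :=
                (norm_mul_le _ _).trans (by gcongr; exact norm_mul_le _ _)
            _ ≤ 1 * ‖r‖ * 1 := by gcongr
            _ = ‖r‖ := by ring
        have h5 : ‖w * ((r - star a * a) * w)‖ ≤ ε / 2 := by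
          calc _ ≤ ‖w‖ * ‖(r - star a * a) * w‖ := norm_mul_le _ _
            _ ≤ 1 * (ε / 2) := by gcongr
            _ = ε / 2 := one_mul _
        calc _ ≤ ‖a * w‖ * ‖a * w‖ := by gcongr
          _ ≤ ‖w * r * w‖ + ‖w * ((r - star a * a) * w)‖ := by rw [h2, h3]; exact norm_sub_le _ _
          _ ≤ _ := by linarith }
  have : StarModule ℂ (E ⧸ I) := ⟨fun c x => by
    obtain ⟨a, rfl⟩ := surj x
    have h : ∀ (c : ℂ) (a : E), c • Ideal.Quotient.mk I a = Ideal.Quotient.mk I (c • a) :=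
      fun c a => rfl
    rw [h, hstar_mk, hstar_mk, h, star_smul]⟩
  let _ : NormedAlgebra ℂ (E ⧸ I) :=
    { Submodule.Quotient.normedSpace I ℂ, Ideal.Quotient.algebra ℂ with }
  have : CompleteSpace (E ⧸ I) := Submodule.Quotient.completeSpace I
  let C : CStarAlgebra (E ⧸ I) := CStarAlgebra.mk
  exact ⟨E ⧸ I, C, { Ideal.Quotient.mkₐ ℂ I with map_star' := fun a => (hstar_mk a).symm }, surj, mk0⟩

end Quotient

/-! ### Extension and factorization of star homomorphisms. -/

section Homomorphisms

/-- A star homomorphism which is bounded with respect to a dense star homomorphism `m` extends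
along `m`. -/
theorem exists_extension {T E F : Type*} [Ring T] [StarRing T] [Algebra ℂ T] [CStarAlgebra E]
    [NonUnitalCStarAlgebra F] (m : T →⋆ₐ[ℂ] E) (hm : DenseRange m) (f : T →⋆ₙₐ[ℂ] F) (C : ℝ)
    (h : ∀ t, ‖f t‖ ≤ C * ‖m t‖) : ∃ g : E →⋆ₙₐ[ℂ] F, ∀ t, g (m t) = f t := by
  let f' : T →ₗ[ℂ] F := { toFun := f, map_add' := map_add f, map_smul' := map_smul f }
  let m' : T →ₗ[ℂ] E := { toFun := m, map_add' := map_add m, map_smul' := map_smul m }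
  have hm' : DenseRange m' := hm
  let g := f'.extendOfNorm m'
  have hg : ∀ t, g (m t) = f t := LinearMap.extendOfNorm_eq hm' ⟨C, h⟩
  have hgc : Continuous g := g.continuous
  refine ⟨{ toFun := g, map_smul' := map_smul g, map_zero' := map_zero g, map_add' := map_add g,
            map_mul' := ?_, map_star' := ?_ }, hg⟩
  · intro x y
    refine hm.induction_on₂ (p := fun x y => g (x * y) = g x * g y) ?_ ?_ x y
    · exact isClosed_eq (hgc.comp continuous_mul)
        ((hgc.comp continuous_fst).mul (hgc.comp continuous_snd))
    · intro s t
      rw [← map_mul, hg, hg, hg, map_mul]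
  · intro x
    refine hm.induction_on (p := fun x => g (star x) = star (g x)) x ?_ ?_
    · exact isClosed_eq (hgc.comp continuous_star) (continuous_star.comp hgc)
    · intro s
      rw [← map_star, hg, hg, map_star]

/-- A star homomorphism factors through a surjective one with smaller kernel. -/
theorem exists_factor {A B C : Type*} [Ring A] [StarRing A] [Algebra ℂ A] [Ring B] [StarRing B]
    [Algebra ℂ B] [Ring C] [StarRing C] [Algebra ℂ C] (π : B →⋆ₐ[ℂ] A)
    (hπ : Function.Surjective π) (g : B →⋆ₐ[ℂ] C) (hg : ∀ b, π b = 0 → g b = 0) :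
    ∃ φ : A →⋆ₐ[ℂ] C, ∀ b, φ (π b) = g b := by
  have key : ∀ b, g (hπ (π b)).choose = g b := fun b => by
    rw [← sub_eq_zero, ← map_sub]
    apply hg
    rw [map_sub, (hπ (π b)).choose_spec, sub_self]
  refine ⟨{ toFun := fun a => g (hπ a).choose, map_one' := ?_, map_mul' := ?_, map_zero' := ?_,
            map_add' := ?_, commutes' := ?_, map_star' := ?_ }, key⟩
  · have := key 1
    rwa [map_one, map_one] at this
  · intro x y
    obtain ⟨a, rfl⟩ := hπ x
    obtain ⟨b, rfl⟩ := hπ y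
    rw [← map_mul, key, key, key, map_mul]
  · have := key 0
    rwa [map_zero, map_zero] at this
  · intro x y
    obtain ⟨a, rfl⟩ := hπ x
    obtain ⟨b, rfl⟩ := hπ y
    rw [← map_add, key, key, key, map_add]
  · intro r
    have := key (algebraMap ℂ B r)
    rwa [AlgHomClass.commutes, AlgHomClass.commutes] at this
  · intro x
    obtain ⟨a, rfl⟩ := hπ x
    rw [← map_star, key, key, map_star]

end Homomorphisms

/-! ### Ideals along increasing unions; commutators and simplicity. -/

section Ideals

variable {E : Type*} [CStarAlgebra E]

/-- The closure of an additive subgroup which is invariant under multiplication by a dense set is a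
two-sided ideal. -/
theorem exists_ideal_eq_closure {D S : Set E} (hD : Dense D) (h0 : (0 : E) ∈ S)
    (hadd : ∀ x ∈ S, ∀ y ∈ S, x + y ∈ S) (hneg : ∀ x ∈ S, -x ∈ S)
    (hl : ∀ d ∈ D, ∀ x ∈ S, d * x ∈ S) (hr : ∀ d ∈ D, ∀ x ∈ S, x * d ∈ S) :
    ∃ I : TwoSidedIdeal E, (I : Set E) = closure S := by
  refine ⟨TwoSidedIdeal.mk' (closure S) (subset_closure h0) ?_ ?_ ?_ ?_,
    TwoSidedIdeal.coe_mk' ..⟩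
  · intro x y hx hy
    exact map_mem_closure₂ continuous_add hx hy hadd
  · intro x hx
    exact map_mem_closure continuous_neg hx hneg
  · intro x y hy
    exact map_mem_closure₂ continuous_mul (hD x) hy hl
  · intro x y hx
    exact map_mem_closure₂ continuous_mul hx (hD y) fun x hx d hd => hr d hd x hx

theorem TwoSidedIdeal.eq_top_of_one_mem {R : Type*} [Ring R] {I : TwoSidedIdeal R}
    (h : (1 : R) ∈ I) : I = ⊤ :=
  eq_top_iff.2 fun x _ => by simpa using I.mul_mem_left x 1 h

theorem TwoSidedIdeal.eq_top_of_norm_lt {I : TwoSidedIdeal E} {x : E} (hx : x ∈ I)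
    (h : ‖1 - x‖ < 1) : I = ⊤ := by
  obtain ⟨u, hu⟩ := isUnit_one_sub_of_norm_lt_one h
  rw [sub_sub_cancel] at hu
  refine TwoSidedIdeal.eq_top_of_one_mem ?_
  have := I.mul_mem_left (↑u⁻¹) x hx
  rwa [← hu, Units.inv_mul] at this

/-- Ideals of an increasing sequence of closed subalgebras with dense union give a closed ideal,
which is proper if all the given ideals are. -/
theorem exists_ideal_of_directed (S : ℕ → StarSubalgebra ℂ E) [hcl : ∀ i, IsClosed (S i : Set E)]
    (hS : Monotone S) (hd : Dense (⋃ i, (S i : Set E))) (I : ∀ i, TwoSidedIdeal (S i))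
    (hI : ∀ i j (hij : i ≤ j) (x : S i), x ∈ I i → (⟨x, hS hij x.2⟩ : S j) ∈ I j) :
    ∃ J : TwoSidedIdeal E, IsClosed (J : Set E) ∧ (∀ i (x : S i), x ∈ I i → (x : E) ∈ J) ∧
      (J = ⊤ → ∃ i, I i = ⊤) := by
  obtain ⟨J, hJ⟩ := exists_ideal_eq_closure (S := {x | ∃ i, ∃ y ∈ I i, (y : E) = x}) hd
    ⟨0, 0, (I 0).zero_mem, rfl⟩ (by
      rintro _ ⟨i, y, hy, rfl⟩ _ ⟨j, z, hz, rfl⟩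
      exact ⟨max i j, _, (I _).add_mem (hI i _ (le_max_left i j) y hy)
        (hI j _ (le_max_right i j) z hz), rfl⟩) (by
      rintro _ ⟨i, y, hy, rfl⟩
      exact ⟨i, _, (I _).neg_mem hy, rfl⟩) (by
      rintro d hd _ ⟨i, y, hy, rfl⟩
      obtain ⟨j, hj⟩ := Set.mem_iUnion.1 hd
      exact ⟨max i j, _, (I _).mul_mem_left ⟨d, hS (le_max_right i j) hj⟩ _
        (hI i _ (le_max_left i j) y hy), rfl⟩) (by
      rintro d hd _ ⟨i, y, hy, rfl⟩
      obtain ⟨j, hj⟩ := Set.mem_iUnion.1 hd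
      exact ⟨max i j, _, (I _).mul_mem_right _ ⟨d, hS (le_max_right i j) hj⟩
        (hI i _ (le_max_left i j) y hy), rfl⟩)
  refine ⟨J, by rw [hJ]; exact isClosed_closure, fun i x hx => ?_, fun htop => ?_⟩
  · have : (x : E) ∈ (J : Set E) := by rw [hJ]; exact subset_closure ⟨i, x, hx, rfl⟩
    exact this
  · have h1 : (1 : E) ∈ (J : Set E) := by rw [htop]; trivial
    rw [hJ, Metric.mem_closure_iff] at h1
    -- An element at distance less than `1` from the unit is invertible, and it is so inside the
    -- complete algebra `S i`.
    obtain ⟨_, ⟨i, y, hy, rfl⟩, h2⟩ := h1 1 one_pos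
    rw [dist_eq_norm] at h2
    exact ⟨i, TwoSidedIdeal.eq_top_of_norm_lt hy h2⟩

/-- The two-sided ideal generated by the commutators. -/
def commutatorIdeal (R : Type*) [Ring R] : TwoSidedIdeal R :=
  TwoSidedIdeal.span {z | ∃ a b : R, z = a * b - b * a}

theorem commutator_mem {R : Type*} [Ring R] (a b : R) : a * b - b * a ∈ commutatorIdeal R :=
  TwoSidedIdeal.subset_span ⟨a, b, rfl⟩

/-- In a C*-algebra without characters, a closed two-sided ideal containing all the commutators is
everything. -/
theorem TwoSidedIdeal.eq_top_of_commutators {E : Type u} [CStarAlgebra E]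
    (hE : IsEmpty (E →⋆ₐ[ℂ] ℂ)) {J : TwoSidedIdeal E} (hJ : IsClosed (J : Set E))
    (h : ∀ a b, a * b - b * a ∈ J) : J = ⊤ := by
  by_contra hne
  -- For a proper `J` this quotient is nonzero and commutative, so it has a character, which pulls
  -- back to `E`.
  obtain ⟨Q, _, π, hπ, hker⟩ := exists_quotient J hJ
  have hcomm : ∀ x y : Q, x * y = y * x := fun x y => by
    obtain ⟨a, rfl⟩ := hπ x
    obtain ⟨b, rfl⟩ := hπ y
    rw [← sub_eq_zero, ← map_mul, ← map_mul, ← map_sub, hker]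
    exact h a b
  let _ : CommCStarAlgebra Q := { ‹CStarAlgebra Q› with mul_comm := hcomm }
  have : Nontrivial Q := ⟨⟨1, 0, fun h1 => hne (TwoSidedIdeal.eq_top_of_one_mem
    ((hker 1).1 (by rw [map_one, h1])))⟩⟩
  obtain ⟨χ⟩ : Nonempty (WeakDual.characterSpace ℂ Q) := inferInstance
  let χ' : Q →⋆ₐ[ℂ] ℂ :=
    { WeakDual.CharacterSpace.toAlgHom χ with map_star' := fun a => map_star χ a }
  exact hE.false (χ'.comp π)

/-- If the union of an increasing sequence of closed subalgebras is dense in a C*-algebra without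
characters, then one of them is generated by its commutators, as a two-sided ideal. -/
theorem exists_commutatorIdeal_eq_top {E : Type u} [CStarAlgebra E] (hE : IsEmpty (E →⋆ₐ[ℂ] ℂ))
    (S : ℕ → StarSubalgebra ℂ E) [hcl : ∀ i, IsClosed (S i : Set E)]
    (hS : Monotone S) (hd : Dense (⋃ i, (S i : Set E))) : ∃ i, commutatorIdeal (S i) = ⊤ := by
  have hmono : ∀ i j (hij : i ≤ j) (x : S i), x ∈ commutatorIdeal (S i) →
      (⟨x, hS hij x.2⟩ : S j) ∈ commutatorIdeal (S j) := by
    intro i j hij x hx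
    let f : S i →+* S j :=
      { toFun := fun x => ⟨x, hS hij x.2⟩, map_one' := rfl, map_mul' := fun _ _ => rfl,
        map_zero' := rfl, map_add' := fun _ _ => rfl }
    change f x ∈ commutatorIdeal (S j)
    refine TwoSidedIdeal.span_induction (p := fun x _ => f x ∈ commutatorIdeal (S j))
      ?_ ?_ ?_ ?_ ?_ ?_ hx
    · rintro _ ⟨a, b, rfl⟩
      rw [map_sub, map_mul, map_mul]
      exact commutator_mem _ _
    · rw [map_zero]; exact TwoSidedIdeal.zero_mem _
    · intro x y _ _ h1 h2
      rw [map_add]; exact TwoSidedIdeal.add_mem _ h1 h2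
    · intro x _ h1
      rw [map_neg]; exact TwoSidedIdeal.neg_mem _ h1
    · intro a x _ h1
      rw [map_mul]; exact TwoSidedIdeal.mul_mem_left _ _ _ h1
    · intro a x _ h1
      rw [map_mul]; exact TwoSidedIdeal.mul_mem_right _ _ _ h1
  obtain ⟨J, hJc, hJ, htop⟩ := exists_ideal_of_directed S hS hd (fun i => commutatorIdeal (S i)) hmono
  refine htop (TwoSidedIdeal.eq_top_of_commutators hE hJc fun a b => ?_)
  have hab : a * b - b * a ∈ closure (J : Set E) := by
    refine map_mem_closure₂ (f := fun a b : E => a * b - b * a) (by fun_prop) (hd a) (hd b) ?_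
    intro a ha b hb
    obtain ⟨i, hi⟩ := Set.mem_iUnion.1 ha
    obtain ⟨j, hj⟩ := Set.mem_iUnion.1 hb
    exact hJ (max i j) _ (commutator_mem (⟨a, hS (le_max_left i j) hi⟩ : S (max i j))
      ⟨b, hS (le_max_right i j) hj⟩)
  rwa [hJc.closure_eq] at hab

/-- In a simple C*-algebra a nonzero element of a member of a sequence of subalgebras with dense
union generates the unit ideal of a later member. -/
theorem IsSimpleCStar.exists_span_eq_top (hE : IsSimpleCStar E)
    (S : ℕ → StarSubalgebra ℂ E) [hcl : ∀ i, IsClosed (S i : Set E)]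
    (hS : Monotone S) (hd : Dense (⋃ i, (S i : Set E))) {i : ℕ} (x : S i) (hx : x ≠ 0) :
    ∃ j, ∃ hij : i ≤ j, TwoSidedIdeal.span {(⟨x, hS hij x.2⟩ : S j)} = ⊤ := by
  have hmono : ∀ j k (hjk : j ≤ k) (y : S (i + j)),
      y ∈ TwoSidedIdeal.span {(⟨x, hS (Nat.le_add_right i j) x.2⟩ : S (i + j))} →
      (⟨y, hS (Nat.add_le_add_left hjk i) y.2⟩ : S (i + k)) ∈
        TwoSidedIdeal.span {(⟨x, hS (Nat.le_add_right i k) x.2⟩ : S (i + k))} := by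
    intro j k hjk y hy
    let f : S (i + j) →+* S (i + k) :=
      { toFun := fun x => ⟨x, hS (Nat.add_le_add_left hjk i) x.2⟩, map_one' := rfl,
        map_mul' := fun _ _ => rfl, map_zero' := rfl, map_add' := fun _ _ => rfl }
    change f y ∈ _
    refine TwoSidedIdeal.span_induction (p := fun x _ => f x ∈ _) ?_ ?_ ?_ ?_ ?_ ?_ hy
    · rintro _ rfl
      exact TwoSidedIdeal.subset_span rfl
    · rw [map_zero]; exact TwoSidedIdeal.zero_mem _
    · intro x y _ _ h1 h2
      rw [map_add]; exact TwoSidedIdeal.add_mem _ h1 h2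
    · intro x _ h1
      rw [map_neg]; exact TwoSidedIdeal.neg_mem _ h1
    · intro a x _ h1
      rw [map_mul]; exact TwoSidedIdeal.mul_mem_left _ _ _ h1
    · intro a x _ h1
      rw [map_mul]; exact TwoSidedIdeal.mul_mem_right _ _ _ h1
  have hd' : Dense (⋃ j, (S (i + j) : Set E)) := hd.mono <| by
    refine Set.iUnion_subset fun j => ?_
    exact Set.subset_iUnion_of_subset j (hS (Nat.le_add_left j i))
  obtain ⟨J, hJc, hJ, htop⟩ := exists_ideal_of_directed (fun j => S (i + j))
    (fun j k hjk => hS (Nat.add_le_add_left hjk i)) hd'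
    (fun j => TwoSidedIdeal.span {(⟨x, hS (Nat.le_add_right i j) x.2⟩ : S (i + j))}) hmono
  -- By simplicity the limit ideal is zero or everything; it is not zero, since it contains `x`.
  rcases hE.2 J hJc with h | h
  · refine absurd ?_ hx
    have := hJ 0 ⟨x, hS (Nat.le_add_right i 0) x.2⟩ (TwoSidedIdeal.subset_span rfl)
    rw [h] at this
    exact Subtype.ext this
  · obtain ⟨j, hj⟩ := htop h
    exact ⟨i + j, Nat.le_add_right i j, hj⟩

end Ideals

/-! ### Multiplicative bilinear functionals on pairs of function algebras. -/

section BilinearCharacters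

/-- Characters of `C(X)` are point evaluations. -/
theorem exists_eq_eval {X : Type*} [TopologicalSpace X] [CompactSpace X] [T2Space X]
    (Λ : C(X, ℂ) →ₐ[ℂ] ℂ) : ∃ x, ∀ f, Λ f = f x := by
  obtain ⟨x, hx⟩ := (WeakDual.CharacterSpace.continuousMapEval_bijective (𝕜 := ℂ) (X := X)).2
    (WeakDual.CharacterSpace.equivAlgHom.symm Λ)
  refine ⟨x, fun f => ?_⟩
  exact (congrArg (fun χ : WeakDual.characterSpace ℂ C(X, ℂ) => χ f) hx).symm

/-- Bilinear functionals on `C₀(X ∖ X₀) × C₀(Y ∖ Y₀)` that are multiplicative up to the weights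
`ρ` and `σ` are weighted point evaluations. -/
theorem exists_eq_eval_mul_eval {X Y : Type*} [TopologicalSpace X] [CompactSpace X] [T2Space X]
    [TopologicalSpace Y] [CompactSpace Y] [T2Space Y] (I : Ideal C(X, ℂ)) (J : Ideal C(Y, ℂ))
    (ρ : C(X, ℂ)) (σ : C(Y, ℂ)) (ψ : C(X, ℂ) → C(Y, ℂ) → ℂ)
    (add_left : ∀ f ∈ I, ∀ f' ∈ I, ∀ g ∈ J, ψ (f + f') g = ψ f g + ψ f' g)
    (smul_left : ∀ (c : ℂ), ∀ f ∈ I, ∀ g ∈ J, ψ (c • f) g = c * ψ f g)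
    (add_right : ∀ f ∈ I, ∀ g ∈ J, ∀ g' ∈ J, ψ f (g + g') = ψ f g + ψ f g')
    (smul_right : ∀ (c : ℂ), ∀ f ∈ I, ∀ g ∈ J, ψ f (c • g) = c * ψ f g)
    (mul : ∀ f ∈ I, ∀ f' ∈ I, ∀ g ∈ J, ∀ g' ∈ J,
      ψ f g * ψ f' g' = ψ (f * f' * ρ) (g * g' * σ))
    {f₀ : C(X, ℂ)} {g₀ : C(Y, ℂ)} (hf₀ : f₀ ∈ I) (hg₀ : g₀ ∈ J) (h₀ : ψ f₀ g₀ ≠ 0) :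
    ∃ x y, ∀ f ∈ I, ∀ g ∈ J, ψ f g = f x * g y * (ρ x * σ y) := by
  have hfI : ∀ f, f * f₀ ∈ I := fun f => I.mul_mem_left f hf₀
  have hgJ : ∀ g, g * g₀ ∈ J := fun g => J.mul_mem_left g hg₀
  obtain ⟨x, hx⟩ : ∃ x, ∀ f, ψ (f * f₀) g₀ = f x * ψ f₀ g₀ := by
    -- `ψ` lives on ideals without unit. Normalizing by the nonzero value `ψ f₀ g₀` yields a unital
    -- functional on all of `C(X)`, in which the weights cancel.
    let Λ : C(X, ℂ) →ₗ[ℂ] ℂ :=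
      { toFun := fun f => ψ (f * f₀) g₀ / ψ f₀ g₀
        map_add' := fun f f' => by
          rw [add_mul, add_left _ (hfI f) _ (hfI f') _ hg₀, add_div]
        map_smul' := fun c f => by
          rw [smul_mul_assoc, smul_left c _ (hfI f) _ hg₀, mul_div_assoc]; rfl }
    have h1 : Λ 1 = 1 := by
      change ψ (1 * f₀) g₀ / ψ f₀ g₀ = 1
      rw [one_mul, div_self h₀]
    have hm : ∀ f f', Λ (f * f') = Λ f * Λ f' := by
      intro f f'
      change ψ (f * f' * f₀) g₀ / ψ f₀ g₀ = ψ (f * f₀) g₀ / ψ f₀ g₀ * (ψ (f' * f₀) g₀ / ψ f₀ g₀)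
      have e1 := mul _ (hfI f) _ (hfI f') _ hg₀ _ hg₀
      have e2 := mul _ (hfI (f * f')) _ hf₀ _ hg₀ _ hg₀
      have e3 : f * f₀ * (f' * f₀) * ρ = f * f' * f₀ * f₀ * ρ := by ring
      rw [e3, ← e2] at e1
      field_simp
      rw [e1]
    obtain ⟨x, hx⟩ := exists_eq_eval (AlgHom.ofLinearMap Λ h1 hm)
    refine ⟨x, fun f => ?_⟩
    rw [← hx f]
    change _ = ψ (f * f₀) g₀ / ψ f₀ g₀ * ψ f₀ g₀
    rw [div_mul_cancel₀ _ h₀]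
  obtain ⟨y, hy⟩ : ∃ y, ∀ g, ψ f₀ (g * g₀) = g y * ψ f₀ g₀ := by
    let Λ : C(Y, ℂ) →ₗ[ℂ] ℂ :=
      { toFun := fun g => ψ f₀ (g * g₀) / ψ f₀ g₀
        map_add' := fun f f' => by
          rw [add_mul, add_right _ hf₀ _ (hgJ f) _ (hgJ f'), add_div]
        map_smul' := fun c f => by
          rw [smul_mul_assoc, smul_right c _ hf₀ _ (hgJ f), mul_div_assoc]; rfl }
    have h1 : Λ 1 = 1 := by
      change ψ f₀ (1 * g₀) / ψ f₀ g₀ = 1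
      rw [one_mul, div_self h₀]
    have hm : ∀ f f', Λ (f * f') = Λ f * Λ f' := by
      intro f f'
      change ψ f₀ (f * f' * g₀) / ψ f₀ g₀ = ψ f₀ (f * g₀) / ψ f₀ g₀ * (ψ f₀ (f' * g₀) / ψ f₀ g₀)
      have e1 := mul _ hf₀ _ hf₀ _ (hgJ f) _ (hgJ f')
      have e2 := mul _ hf₀ _ hf₀ _ (hgJ (f * f')) _ hg₀
      have e3 : f * g₀ * (f' * g₀) * σ = f * f' * g₀ * g₀ * σ := by ring
      rw [e3, ← e2] at e1
      field_simp
      rw [e1]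
    obtain ⟨y, hy⟩ := exists_eq_eval (AlgHom.ofLinearMap Λ h1 hm)
    refine ⟨y, fun f => ?_⟩
    rw [← hy f]
    change _ = ψ f₀ (f * g₀) / ψ f₀ g₀ * ψ f₀ g₀
    rw [div_mul_cancel₀ _ h₀]
  have hxy : ∀ f g, ψ (f * f₀) (g * g₀) = f x * g y * ψ f₀ g₀ := by
    intro f g
    have e1 := mul _ (hfI f) _ hf₀ _ hg₀ _ (hgJ g)
    have e2 := mul _ (hfI f) _ hf₀ _ (hgJ g) _ hg₀
    rw [show g₀ * (g * g₀) * σ = g * g₀ * g₀ * σ by ring, ← e2, hx, hy] at e1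
    refine mul_right_cancel₀ h₀ ?_
    rw [← e1]; ring
  -- Multiply `ψ f g` by `ψ f₀ g₀`: the product is a value of `ψ` on multiples of `f₀` and `g₀`,
  -- where `hxy` applies with the coefficients `f * ρ` and `g * σ`.
  refine ⟨x, y, fun f hf g hg => ?_⟩
  have e1 := mul _ hf _ hf₀ _ hg _ hg₀
  rw [show f * f₀ * ρ = (f * ρ) * f₀ by ring, show g * g₀ * σ = (g * σ) * g₀ by ring, hxy] at e1
  refine mul_right_cancel₀ h₀ ?_
  rw [e1]
  simp only [ContinuousMap.mul_apply]
  ring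

end BilinearCharacters

/-! ### Homomorphisms on the algebraic tensor product. -/

section TensorMaps

set_option linter.unusedSectionVars false

variable {A B E : Type*} [CStarAlgebra A] [CStarAlgebra B] [CStarAlgebra E]

/-- The star homomorphism `a ⊗ b ↦ α a * β b` on the algebraic tensor product. -/
noncomputable def mulMap (α : A →⋆ₐ[ℂ] E) (β : B →⋆ₐ[ℂ] E) (h : ∀ a b, Commute (α a) (β b)) :
    A ⊗[ℂ] B →⋆ₐ[ℂ] E :=
  { Algebra.TensorProduct.lift (α : A →ₐ[ℂ] E) (β : B →ₐ[ℂ] E) h with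
    map_star' := fun t => by
      change Algebra.TensorProduct.lift (α : A →ₐ[ℂ] E) (β : B →ₐ[ℂ] E) h (star t)
        = star (Algebra.TensorProduct.lift (α : A →ₐ[ℂ] E) (β : B →ₐ[ℂ] E) h t)
      induction t with
      | zero => simp
      | tmul a b =>
        rw [TensorProduct.star_tmul, Algebra.TensorProduct.lift_tmul, Algebra.TensorProduct.lift_tmul]
        simp only [StarAlgHom.coe_toAlgHom, map_star, star_mul]
        rw [← map_star, ← map_star]
        exact (h (star a) (star b)).eq
      | add x y hx hy => rw [star_add, map_add, map_add, star_add, hx, hy] }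

theorem mulMap_tmul (α : A →⋆ₐ[ℂ] E) (β : B →⋆ₐ[ℂ] E) (h : ∀ a b, Commute (α a) (β b)) (a : A)
    (b : B) : mulMap α β h (a ⊗ₜ b) = α a * β b :=
  Algebra.TensorProduct.lift_tmul (α : A →ₐ[ℂ] E) (β : B →ₐ[ℂ] E) h a b

variable {n m X Y : Type*} [Fintype n] [DecidableEq n] [Fintype m] [DecidableEq m]
  [TopologicalSpace X] [TopologicalSpace Y]

open scoped Kronecker

/-- The function `(x, y) ↦ f x ⊗ g y`. -/
noncomputable def kroneckerFun (f : C(X, Matrix n n ℂ)) (g : C(Y, Matrix m m ℂ)) :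
    C(X × Y, Matrix (n × m) (n × m) ℂ) where
  toFun p := f p.1 ⊗ₖ g p.2
  continuous_toFun := by
    refine continuous_matrix fun i j => ?_
    have h1 : Continuous fun p : X × Y => f p.1 i.1 j.1 :=
      (f.continuous.comp continuous_fst).matrix_elem _ _
    have h2 : Continuous fun p : X × Y => g p.2 i.2 j.2 :=
      (g.continuous.comp continuous_snd).matrix_elem _ _
    exact h1.mul h2

@[simp]
theorem kroneckerFun_apply (f : C(X, Matrix n n ℂ)) (g : C(Y, Matrix m m ℂ)) (p : X × Y) :
    kroneckerFun f g p = f p.1 ⊗ₖ g p.2 := rfl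

theorem kroneckerFun_mul (f f' : C(X, Matrix n n ℂ)) (g g' : C(Y, Matrix m m ℂ)) :
    kroneckerFun (f * f') (g * g') = kroneckerFun f g * kroneckerFun f' g' :=
  ContinuousMap.ext fun _ => Matrix.mul_kronecker_mul _ _ _ _

theorem kroneckerFun_star (f : C(X, Matrix n n ℂ)) (g : C(Y, Matrix m m ℂ)) :
    kroneckerFun (star f) (star g) = star (kroneckerFun f g) :=
  ContinuousMap.ext fun _ => (Matrix.conjTranspose_kronecker _ _).symm

/-- The star homomorphism `a ⊗ b ↦ f a ⊗ g b` into the matrix-valued functions on the product. -/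
noncomputable def kroneckerHom (f : A →⋆ₙₐ[ℂ] C(X, Matrix n n ℂ))
    (g : B →⋆ₙₐ[ℂ] C(Y, Matrix m m ℂ)) : A ⊗[ℂ] B →⋆ₙₐ[ℂ] C(X × Y, Matrix (n × m) (n × m) ℂ) :=
  let L : A ⊗[ℂ] B →ₗ[ℂ] C(X × Y, Matrix (n × m) (n × m) ℂ) :=
    TensorProduct.lift (LinearMap.mk₂ ℂ (fun a b => kroneckerFun (f a) (g b))
      (fun a a' b => ContinuousMap.ext fun p => by simp [Matrix.add_kronecker])
      (fun c a b => ContinuousMap.ext fun p => by simp [Matrix.smul_kronecker])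
      (fun a b b' => ContinuousMap.ext fun p => by simp [Matrix.kronecker_add])
      (fun c a b => ContinuousMap.ext fun p => by simp [Matrix.kronecker_smul]))
  have hL : ∀ a b, L (a ⊗ₜ b) = kroneckerFun (f a) (g b) := fun a b => rfl
  { toFun := L
    map_smul' := map_smul L
    map_zero' := map_zero L
    map_add' := map_add L
    map_mul' := fun s t => by
      induction s with
      | zero => simp
      | add x y hx hy => rw [add_mul, map_add, map_add, add_mul, hx, hy]
      | tmul a b =>
        induction t with
        | zero => simp
        | add x y hx hy => rw [mul_add, map_add, map_add, mul_add, hx, hy]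
        | tmul a' b' =>
          rw [Algebra.TensorProduct.tmul_mul_tmul, hL, hL, hL, map_mul, map_mul, kroneckerFun_mul]
    map_star' := fun t => by
      change L (star t) = star (L t)
      induction t with
      | zero => simp
      | add x y hx hy => rw [star_add, map_add, map_add, star_add, hx, hy]
      | tmul a b => rw [TensorProduct.star_tmul, hL, hL, map_star, map_star, kroneckerFun_star] }

end TensorMaps

/-! ### Matrix layers and compressed matrix units. -/

section

open scoped Matrix.Norms.L2Operator Kronecker

section Layers

/-- A homomorphism `q` of `A` into `C(X, M_n)` that maps an ideal `J` of `A` onto the functions `h`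
which vanish on `X₀` and live under the projection `q 1`. -/
structure MatrixLayer (A : Type u) [CStarAlgebra A] : Type (u + 1) where
  X : Type u
  [top : TopologicalSpace X]
  [compact : CompactSpace X]
  [t2 : T2Space X]
  n : Type
  [fintype : Fintype n]
  [decEq : DecidableEq n]
  q : A →⋆ₙₐ[ℂ] C(X, Matrix n n ℂ)
  X₀ : Set X
  isClosed_X₀ : IsClosed X₀
  J : TwoSidedIdeal A
  star_mem : ∀ j ∈ J, star j ∈ J
  exact : ∀ h, (∃ j ∈ J, q j = h) ↔ (q 1 * h * q 1 = h ∧ ∀ x ∈ X₀, h x = 0)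

attribute [instance] MatrixLayer.top MatrixLayer.compact MatrixLayer.t2 MatrixLayer.fintype
  MatrixLayer.decEq

/-- The matrix entries of a matrix-valued function. -/
noncomputable def entry {X n : Type*} [TopologicalSpace X] (h : C(X, Matrix n n ℂ)) (i j : n) : C(X, ℂ) :=
  ⟨fun x => h x i j, h.continuous.matrix_elem i j⟩

@[simp]
theorem entry_apply {X n : Type*} [TopologicalSpace X] (h : C(X, Matrix n n ℂ)) (i j : n) (x : X) :
    entry h i j x = h x i j := rfl

namespace MatrixLayer

variable {A : Type u} [CStarAlgebra A] (Λ : MatrixLayer A)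

/-- The functions in the image of the ideal. -/
noncomputable def Adapted (h : C(Λ.X, Matrix Λ.n Λ.n ℂ)) : Prop :=
  Λ.q 1 * h * Λ.q 1 = h ∧ ∀ x ∈ Λ.X₀, h x = 0

/-- The scalar functions vanishing on `X₀`. -/
noncomputable def I : Ideal C(Λ.X, ℂ) := ContinuousMap.idealOfSet ℂ Λ.X₀ᶜ

theorem mem_I {f : C(Λ.X, ℂ)} : f ∈ Λ.I ↔ ∀ x ∈ Λ.X₀, f x = 0 := by
  rw [I, ContinuousMap.mem_idealOfSet]
  simp

variable {Λ}

theorem q_one_mul (a : A) : Λ.q 1 * Λ.q a = Λ.q a := by rw [← map_mul, one_mul]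

theorem mul_q_one (a : A) : Λ.q a * Λ.q 1 = Λ.q a := by rw [← map_mul, mul_one]

theorem Adapted.exists_lift {h : C(Λ.X, Matrix Λ.n Λ.n ℂ)} (hh : Λ.Adapted h) :
    ∃ j ∈ Λ.J, Λ.q j = h := (Λ.exact h).2 hh

theorem adapted_of_mem {j : A} (hj : j ∈ Λ.J) : Λ.Adapted (Λ.q j) := (Λ.exact _).1 ⟨j, hj, rfl⟩

theorem Adapted.add {h h' : C(Λ.X, Matrix Λ.n Λ.n ℂ)} (hh : Λ.Adapted h) (hh' : Λ.Adapted h') :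
    Λ.Adapted (h + h') := by
  refine ⟨by rw [mul_add, add_mul, hh.1, hh'.1], fun x hx => ?_⟩
  rw [ContinuousMap.add_apply, hh.2 x hx, hh'.2 x hx, add_zero]

theorem adapted_zero : Λ.Adapted 0 := ⟨by simp, fun x _ => rfl⟩

theorem Adapted.sum {ι : Type*} {s : Finset ι} {h : ι → C(Λ.X, Matrix Λ.n Λ.n ℂ)}
    (hh : ∀ i ∈ s, Λ.Adapted (h i)) : Λ.Adapted (∑ i ∈ s, h i) :=
  Finset.sum_induction h Λ.Adapted (fun _ _ => Adapted.add) adapted_zero hh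

theorem Adapted.q_mul {h : C(Λ.X, Matrix Λ.n Λ.n ℂ)} (hh : Λ.Adapted h) (a : A) :
    Λ.Adapted (Λ.q a * h) := by
  obtain ⟨j, hj, rfl⟩ := hh.exists_lift
  rw [← map_mul]
  exact adapted_of_mem (Λ.J.mul_mem_left _ _ hj)

theorem Adapted.smul {h : C(Λ.X, Matrix Λ.n Λ.n ℂ)} (hh : Λ.Adapted h) (f : C(Λ.X, ℂ)) :
    Λ.Adapted (f • h) := by
  refine ⟨?_, fun x hx => by rw [ContinuousMap.smul_apply', hh.2 x hx, smul_zero]⟩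
  conv_rhs => rw [← hh.1]
  ext x : 1
  simp

theorem adapted_smul_of_mem_I {f : C(Λ.X, ℂ)} (hf : f ∈ Λ.I) {h : C(Λ.X, Matrix Λ.n Λ.n ℂ)}
    (hh : Λ.q 1 * h * Λ.q 1 = h) : Λ.Adapted (f • h) := by
  refine ⟨?_, fun x hx => by rw [ContinuousMap.smul_apply', Λ.mem_I.1 hf x hx, zero_smul]⟩
  conv_rhs => rw [← hh]
  ext x : 1
  simp

variable (Λ)

/-- The compressions of the matrix units by the projection `q 1`. -/
noncomputable def θ (i j : Λ.n) : C(Λ.X, Matrix Λ.n Λ.n ℂ) :=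
  Λ.q 1 * ContinuousMap.const _ (Matrix.single i j 1) * Λ.q 1

theorem θ_spec (i j : Λ.n) : Λ.q 1 * Λ.θ i j * Λ.q 1 = Λ.θ i j := by
  have h : Λ.q 1 * Λ.q 1 = Λ.q 1 := q_one_mul 1
  calc _ = Λ.q 1 * Λ.q 1 * ContinuousMap.const _ (Matrix.single i j 1) * (Λ.q 1 * Λ.q 1) := by
        simp only [θ, mul_assoc]
    _ = _ := by rw [h]; rfl

theorem adapted_smul_θ {f : C(Λ.X, ℂ)} (hf : f ∈ Λ.I) (i j : Λ.n) : Λ.Adapted (f • Λ.θ i j) :=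
  adapted_smul_of_mem_I hf (Λ.θ_spec i j)

theorem star_θ (i j : Λ.n) : star (Λ.θ i j) = Λ.θ j i := by
  have h : star (ContinuousMap.const Λ.X (Matrix.single i j (1 : ℂ)))
      = ContinuousMap.const Λ.X (Matrix.single j i 1) := by
    ext x : 1
    simp [Matrix.star_eq_conjTranspose]
  rw [θ, star_mul, star_mul, h, ← map_star, star_one, ← mul_assoc, θ]

/-- For matrix units `e_ri * h * e_js = h_ij • e_rs`. The compressed units obey the same rule,
because `h` absorbs the projections `q 1` next to it. In this way any entry of `h` can be moved to a
prescribed position. -/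
theorem θ_mul_mul_θ (r i j s : Λ.n) {h : C(Λ.X, Matrix Λ.n Λ.n ℂ)}
    (hh : Λ.q 1 * h * Λ.q 1 = h) :
    Λ.θ r i * h * Λ.θ j s = entry h i j • Λ.θ r s := by
  have h1 : Λ.θ r i * h * Λ.θ j s = Λ.q 1 * (ContinuousMap.const _ (Matrix.single r i 1) * h *
      ContinuousMap.const _ (Matrix.single j s 1)) * Λ.q 1 := by
    conv_rhs => rw [← hh]
    simp only [θ, mul_assoc]
  rw [h1]
  ext x : 1
  simp only [ContinuousMap.mul_apply, ContinuousMap.const_apply, ContinuousMap.smul_apply', θ,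
    Matrix.single_mul_mul_single, entry_apply, one_mul, mul_one]
  have h2 : Matrix.single r s (h x i j) = h x i j • Matrix.single r s (1 : ℂ) := by
    rw [Matrix.smul_single, smul_eq_mul, mul_one]
  rw [h2, mul_smul_comm, smul_mul_assoc]

/-- Where `q 1` is not the identity matrix the compressed units fail to be matrix units, and an
entry of `q 1` appears. These entries are the weights in `exists_eq_eval_mul_eval`. -/
theorem θ_mul_θ (r i j s : Λ.n) : Λ.θ r i * Λ.θ j s = entry (Λ.q 1) i j • Λ.θ r s := by
  have h1 : Λ.q 1 * Λ.q 1 = Λ.q 1 := q_one_mul 1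
  rw [← Λ.θ_mul_mul_θ r i j s (by rw [h1, h1])]
  have : Λ.θ r i * Λ.q 1 = Λ.θ r i := by simp only [θ, mul_assoc, h1]
  rw [this]

theorem smul_θ_mul_q_mul_smul_θ (f f' : C(Λ.X, ℂ)) (r i j s : Λ.n) (a : A) :
    f • Λ.θ r i * (Λ.q a * f' • Λ.θ j s) = (f * f' * entry (Λ.q a) i j) • Λ.θ r s := by
  rw [← smul_smul, ← Λ.θ_mul_mul_θ r i j s (by rw [q_one_mul, mul_q_one])]
  ext x : 1
  simp [smul_smul, mul_assoc, mul_comm (f x)]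

end MatrixLayer

end Layers

end

/-! ### Products of two layers inside a generated algebra. -/

section

open scoped Matrix.Norms.L2Operator Kronecker

section LayerPairs

/-- Commuting homomorphisms `α`, `β` of `A` and `B` into an algebra `E` that they generate, with
layers of `A` and `B` such that the product `α j * β k` of elements of the two ideals depends on
the matrix values of `j` and `k` only. -/
structure LayerPair (A B E : Type u) [CStarAlgebra A] [CStarAlgebra B] [CStarAlgebra E] :
    Type (u + 1) where
  α : A →⋆ₐ[ℂ] E
  β : B →⋆ₐ[ℂ] E
  comm : ∀ a b, Commute (α a) (β b)
  dense : DenseRange (mulMap α β comm)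
  Λ : MatrixLayer A
  M : MatrixLayer B
  kill_left : ∀ j ∈ Λ.J, Λ.q j = 0 → ∀ k ∈ M.J, α j * β k = 0
  kill_right : ∀ j ∈ Λ.J, ∀ k ∈ M.J, M.q k = 0 → α j * β k = 0

namespace LayerPair

variable {A B E : Type u} [CStarAlgebra A] [CStarAlgebra B] [CStarAlgebra E] (S : LayerPair A B E)

/-- The product map on the algebraic tensor product. -/
noncomputable def mm : A ⊗[ℂ] B →⋆ₐ[ℂ] E := mulMap S.α S.β S.comm

theorem mm_tmul (a : A) (b : B) : S.mm (a ⊗ₜ b) = S.α a * S.β b := mulMap_tmul _ _ _ a b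

/-- The matrix values of the elements of the algebraic tensor product. -/
noncomputable def ev : A ⊗[ℂ] B →⋆ₙₐ[ℂ]
    C(S.Λ.X × S.M.X, Matrix (S.Λ.n × S.M.n) (S.Λ.n × S.M.n) ℂ) := kroneckerHom S.Λ.q S.M.q

theorem ev_tmul (a : A) (b : B) : S.ev (a ⊗ₜ b) = kroneckerFun (S.Λ.q a) (S.M.q b) := rfl

theorem eq_of_dense {F : Type*} [TopologicalSpace F] [T2Space F] [AddCommMonoid F] [Module ℂ F]
    {φ ψ : E →ₗ[ℂ] F} (hφ : Continuous φ) (hψ : Continuous ψ)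
    (h : ∀ a b, φ (S.α a * S.β b) = ψ (S.α a * S.β b)) (e : E) : φ e = ψ e := by
  refine S.dense.induction_on (p := fun e => φ e = ψ e) e (isClosed_eq hφ hψ) fun t => ?_
  induction t with
  | zero => rw [map_zero, map_zero, map_zero]
  | add x y hx hy => rw [map_add, map_add, map_add, hx, hy]
  | tmul a b => rw [mulMap_tmul]; exact h a b

open scoped Classical in
/-- The element `α j * β k` of `E` for which `j` and `k` have the values `h` and `k`. -/
noncomputable def W (h : C(S.Λ.X, Matrix S.Λ.n S.Λ.n ℂ)) (k : C(S.M.X, Matrix S.M.n S.M.n ℂ)) : E :=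
  if H : S.Λ.Adapted h ∧ S.M.Adapted k then
    S.α H.1.exists_lift.choose * S.β H.2.exists_lift.choose else 0

/-- Two lifts of the same function differ by an element of the ideal without values, which
`kill_left` and `kill_right` annihilate; so the choice of lifts in `W` is immaterial. -/
theorem W_eq {j : A} (hj : j ∈ S.Λ.J) {k : B} (hk : k ∈ S.M.J) :
    S.W (S.Λ.q j) (S.M.q k) = S.α j * S.β k := by
  have H : S.Λ.Adapted (S.Λ.q j) ∧ S.M.Adapted (S.M.q k) :=
    ⟨MatrixLayer.adapted_of_mem hj, MatrixLayer.adapted_of_mem hk⟩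
  rw [W, dif_pos H]
  obtain ⟨h1, h2⟩ := H.1.exists_lift.choose_spec
  obtain ⟨h3, h4⟩ := H.2.exists_lift.choose_spec
  set j' := H.1.exists_lift.choose
  set k' := H.2.exists_lift.choose
  have e1 : S.α (j' - j) * S.β k' = 0 :=
    S.kill_left _ (S.Λ.J.sub_mem h1 hj) (by rw [map_sub, h2, sub_self]) _ h3
  have e2 : S.α j * S.β (k' - k) = 0 :=
    S.kill_right _ hj _ (S.M.J.sub_mem h3 hk) (by rw [map_sub, h4, sub_self])
  rw [map_sub, sub_mul, sub_eq_zero] at e1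
  rw [map_sub, mul_sub, sub_eq_zero] at e2
  rw [e1, e2]

variable {S}
variable {h h' : C(S.Λ.X, Matrix S.Λ.n S.Λ.n ℂ)} {k k' : C(S.M.X, Matrix S.M.n S.M.n ℂ)}

theorem W_add_left (hh : S.Λ.Adapted h) (hh' : S.Λ.Adapted h') (hk : S.M.Adapted k) :
    S.W (h + h') k = S.W h k + S.W h' k := by
  obtain ⟨j, hj, rfl⟩ := hh.exists_lift
  obtain ⟨j', hj', rfl⟩ := hh'.exists_lift
  obtain ⟨l, hl, rfl⟩ := hk.exists_lift
  rw [← map_add, S.W_eq (S.Λ.J.add_mem hj hj') hl, S.W_eq hj hl, S.W_eq hj' hl, map_add, add_mul]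

theorem W_add_right (hh : S.Λ.Adapted h) (hk : S.M.Adapted k) (hk' : S.M.Adapted k') :
    S.W h (k + k') = S.W h k + S.W h k' := by
  obtain ⟨j, hj, rfl⟩ := hh.exists_lift
  obtain ⟨l', hl', rfl⟩ := hk'.exists_lift
  obtain ⟨l, hl, rfl⟩ := hk.exists_lift
  rw [← map_add, S.W_eq hj (S.M.J.add_mem hl hl'), S.W_eq hj hl, S.W_eq hj hl', map_add, mul_add]

theorem smul_mem {A : Type*} [Ring A] [Algebra ℂ A] (J : TwoSidedIdeal A) (c : ℂ) {j : A}
    (hj : j ∈ J) : c • j ∈ J := by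
  rw [← one_mul j, ← smul_mul_assoc]
  exact J.mul_mem_left _ _ hj

theorem W_smul_left (c : ℂ) (hh : S.Λ.Adapted h) (hk : S.M.Adapted k) :
    S.W (c • h) k = c • S.W h k := by
  obtain ⟨j, hj, rfl⟩ := hh.exists_lift
  obtain ⟨l, hl, rfl⟩ := hk.exists_lift
  rw [← map_smul, S.W_eq (smul_mem _ c hj) hl, S.W_eq hj hl, map_smul, smul_mul_assoc]

theorem W_smul_right (c : ℂ) (hh : S.Λ.Adapted h) (hk : S.M.Adapted k) :
    S.W h (c • k) = c • S.W h k := by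
  obtain ⟨j, hj, rfl⟩ := hh.exists_lift
  obtain ⟨l, hl, rfl⟩ := hk.exists_lift
  rw [← map_smul, S.W_eq hj (smul_mem _ c hl), S.W_eq hj hl, map_smul, mul_smul_comm]

theorem W_zero_left (hk : S.M.Adapted k) : S.W 0 k = 0 := by
  have := W_add_left (S := S) MatrixLayer.adapted_zero MatrixLayer.adapted_zero hk
  rw [add_zero] at this
  exact left_eq_add.1 this

theorem W_zero_right (hh : S.Λ.Adapted h) : S.W h 0 = 0 := by
  have := W_add_right (S := S) hh MatrixLayer.adapted_zero MatrixLayer.adapted_zero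
  rw [add_zero] at this
  exact left_eq_add.1 this

theorem W_sum_left {ι : Type*} (s : Finset ι) {f : ι → C(S.Λ.X, Matrix S.Λ.n S.Λ.n ℂ)}
    (hf : ∀ i, S.Λ.Adapted (f i)) (hk : S.M.Adapted k) :
    S.W (∑ i ∈ s, f i) k = ∑ i ∈ s, S.W (f i) k := by
  classical
  induction s using Finset.induction_on with
  | empty => rw [Finset.sum_empty, Finset.sum_empty, W_zero_left hk]
  | insert a s ha ih =>
    rw [Finset.sum_insert ha, Finset.sum_insert ha,
      W_add_left (hf a) (MatrixLayer.Adapted.sum fun i _ => hf i) hk, ih]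

theorem W_sum_right {ι : Type*} (s : Finset ι) {f : ι → C(S.M.X, Matrix S.M.n S.M.n ℂ)}
    (hf : ∀ i, S.M.Adapted (f i)) (hh : S.Λ.Adapted h) :
    S.W h (∑ i ∈ s, f i) = ∑ i ∈ s, S.W h (f i) := by
  classical
  induction s using Finset.induction_on with
  | empty => rw [Finset.sum_empty, Finset.sum_empty, W_zero_right hh]
  | insert a s ha ih =>
    rw [Finset.sum_insert ha, Finset.sum_insert ha,
      W_add_right hh (hf a) (MatrixLayer.Adapted.sum fun i _ => hf i), ih]

theorem W_mul_W (hh : S.Λ.Adapted h) (hk : S.M.Adapted k) (hh' : S.Λ.Adapted h')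
    (hk' : S.M.Adapted k') : S.W h k * S.W h' k' = S.W (h * h') (k * k') := by
  obtain ⟨j, hj, rfl⟩ := hh.exists_lift
  obtain ⟨j', hj', rfl⟩ := hh'.exists_lift
  obtain ⟨l', hl', rfl⟩ := hk'.exists_lift
  obtain ⟨l, hl, rfl⟩ := hk.exists_lift
  rw [← map_mul, ← map_mul, S.W_eq (S.Λ.J.mul_mem_left _ _ hj') (S.M.J.mul_mem_left _ _ hl'),
    S.W_eq hj hl, S.W_eq hj' hl', map_mul, map_mul]
  have := (S.comm j' l).eq
  simp only [mul_assoc]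
  rw [← mul_assoc (S.β l), ← this]
  simp only [mul_assoc]

theorem gen_mul_W (hh : S.Λ.Adapted h) (hk : S.M.Adapted k) (a : A) (b : B) :
    S.α a * S.β b * S.W h k = S.W (S.Λ.q a * h) (S.M.q b * k) := by
  obtain ⟨j, hj, rfl⟩ := hh.exists_lift
  obtain ⟨l, hl, rfl⟩ := hk.exists_lift
  rw [← map_mul, ← map_mul, S.W_eq (S.Λ.J.mul_mem_left _ _ hj) (S.M.J.mul_mem_left _ _ hl),
    S.W_eq hj hl, map_mul, map_mul]
  have := (S.comm j b).eq
  simp only [mul_assoc]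
  rw [← mul_assoc (S.β b), ← this]
  simp only [mul_assoc]

theorem star_W (hh : S.Λ.Adapted h) (hk : S.M.Adapted k) :
    star (S.W h k) = S.W (star h) (star k) := by
  obtain ⟨j, hj, rfl⟩ := hh.exists_lift
  obtain ⟨l, hl, rfl⟩ := hk.exists_lift
  rw [← map_star, ← map_star, S.W_eq hj hl, S.W_eq (S.Λ.star_mem j hj) (S.M.star_mem l hl), star_mul,
    map_star, map_star, ← map_star, ← map_star, (S.comm (star j) (star l)).eq]

variable (S)

/-- The elements `f θᵣᵣ ⊗ g θₛₛ`. -/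
noncomputable def z (r : S.Λ.n) (s : S.M.n) (f : C(S.Λ.X, ℂ)) (g : C(S.M.X, ℂ)) : E :=
  S.W (f • S.Λ.θ r r) (g • S.M.θ s s)

/-- The compression of `e` to the corner of `θᵣᵣ ⊗ θₛₛ` that picks a matrix entry of `e`. -/
noncomputable def comp (r i j : S.Λ.n) (s k l : S.M.n) (f f' : C(S.Λ.X, ℂ)) (g g' : C(S.M.X, ℂ)) :
    E →L[ℂ] E :=
  (ContinuousLinearMap.mul ℂ E (S.W (f • S.Λ.θ r i) (g • S.M.θ s k))).comp
    ((ContinuousLinearMap.mul ℂ E).flip (S.W (f' • S.Λ.θ j r) (g' • S.M.θ l s)))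

theorem comp_apply (r i j : S.Λ.n) (s k l : S.M.n) (f f' : C(S.Λ.X, ℂ)) (g g' : C(S.M.X, ℂ)) (e : E) :
    S.comp r i j s k l f f' g g' e
      = S.W (f • S.Λ.θ r i) (g • S.M.θ s k) * (e * S.W (f' • S.Λ.θ j r) (g' • S.M.θ l s)) := rfl

theorem smul_mul_smul_fun {X n : Type*} [TopologicalSpace X] [Fintype n] [DecidableEq n]
    (f g : C(X, ℂ)) (h k : C(X, Matrix n n ℂ)) : f • h * g • k = (f * g) • (h * k) := by
  ext x : 1
  simp [smul_smul, mul_comm]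

variable {f f' : C(S.Λ.X, ℂ)} {g g' : C(S.M.X, ℂ)}

/-- On generators a compression leaves only scalar coefficient functions, among them the chosen
entries of the two values, all at the position `(r, s)`. Hence compressions land in a commutative
algebra. -/
theorem comp_gen (r i j : S.Λ.n) (s k l : S.M.n) (hf : f ∈ S.Λ.I) (hf' : f' ∈ S.Λ.I)
    (hg : g ∈ S.M.I) (hg' : g' ∈ S.M.I) (a : A) (b : B) :
    S.comp r i j s k l f f' g g' (S.α a * S.β b)
      = S.z r s (f * f' * entry (S.Λ.q a) i j) (g * g' * entry (S.M.q b) k l) := by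
  rw [comp_apply, gen_mul_W (S.Λ.adapted_smul_θ hf' _ _) (S.M.adapted_smul_θ hg' _ _),
    W_mul_W (S.Λ.adapted_smul_θ hf _ _) (S.M.adapted_smul_θ hg _ _)
      ((S.Λ.adapted_smul_θ hf' _ _).q_mul _) ((S.M.adapted_smul_θ hg' _ _).q_mul _),
    S.Λ.smul_θ_mul_q_mul_smul_θ, S.M.smul_θ_mul_q_mul_smul_θ, z]

theorem z_mul_z (r : S.Λ.n) (s : S.M.n) (hf : f ∈ S.Λ.I) (hf' : f' ∈ S.Λ.I) (hg : g ∈ S.M.I)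
    (hg' : g' ∈ S.M.I) : S.z r s f g * S.z r s f' g'
      = S.z r s (f * f' * entry (S.Λ.q 1) r r) (g * g' * entry (S.M.q 1) s s) := by
  rw [z, z, W_mul_W (S.Λ.adapted_smul_θ hf _ _) (S.M.adapted_smul_θ hg _ _)
    (S.Λ.adapted_smul_θ hf' _ _) (S.M.adapted_smul_θ hg' _ _), smul_mul_smul_fun, smul_mul_smul_fun,
    S.Λ.θ_mul_θ, S.M.θ_mul_θ, smul_smul, smul_smul, z]

theorem star_z (r : S.Λ.n) (s : S.M.n) (hf : f ∈ S.Λ.I) (hg : g ∈ S.M.I) :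
    star (S.z r s f g) = S.z r s (star f) (star g) := by
  have h1 : ∀ {X n : Type _} [TopologicalSpace X] [Fintype n] [DecidableEq n] (f : C(X, ℂ))
      (h : C(X, Matrix n n ℂ)), star (f • h) = star f • star h := by
    intro X n _ _ _ f h
    ext x : 1
    simp
  rw [z, star_W (S.Λ.adapted_smul_θ hf _ _) (S.M.adapted_smul_θ hg _ _), h1, h1, S.Λ.star_θ,
    S.M.star_θ, z]

/-- A commutative algebra containing the `f θᵣᵣ ⊗ g θₛₛ`. -/
noncomputable def corner (r : S.Λ.n) (s : S.M.n) : StarSubalgebra ℂ E :=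
  StarSubalgebra.centralizer ℂ (StarSubalgebra.centralizer ℂ
    {x | ∃ f ∈ S.Λ.I, ∃ g ∈ S.M.I, S.z r s f g = x} : Set E)

theorem z_mem_corner (r : S.Λ.n) (s : S.M.n) (hf : f ∈ S.Λ.I) (hg : g ∈ S.M.I) :
    S.z r s f g ∈ S.corner r s :=
  StarAlgebra.adjoin_le_centralizer_centralizer ℂ _
    (StarAlgebra.subset_adjoin ℂ _ ⟨f, hf, g, hg, rfl⟩)

/-- The generators commute, since the product formula `z_mul_z` is symmetric, and they form a
self-adjoint set. They therefore lie in their own centralizer, and so does their double centralizer.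
-/
theorem corner_comm (r : S.Λ.n) (s : S.M.n) {x y : E} (hx : x ∈ S.corner r s)
    (hy : y ∈ S.corner r s) : x * y = y * x := by
  have hz : ∀ x ∈ {x | ∃ f ∈ S.Λ.I, ∃ g ∈ S.M.I, S.z r s f g = x},
      ∀ y ∈ {x | ∃ f ∈ S.Λ.I, ∃ g ∈ S.M.I, S.z r s f g = x}, x * y = y * x := by
    rintro _ ⟨f, hf, g, hg, rfl⟩ _ ⟨f', hf', g', hg', rfl⟩
    rw [S.z_mul_z r s hf hf' hg hg', S.z_mul_z r s hf' hf hg' hg, mul_comm f, mul_comm g]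
  have hst : ∀ x ∈ {x | ∃ f ∈ S.Λ.I, ∃ g ∈ S.M.I, S.z r s f g = x},
      star x ∈ {x | ∃ f ∈ S.Λ.I, ∃ g ∈ S.M.I, S.z r s f g = x} := by
    rintro _ ⟨f, hf, g, hg, rfl⟩
    refine ⟨star f, ?_, star g, ?_, (S.star_z r s hf hg).symm⟩
    · rw [MatrixLayer.mem_I] at hf ⊢
      intro x hx
      rw [ContinuousMap.star_apply, hf x hx, star_zero]
    · rw [MatrixLayer.mem_I] at hg ⊢
      intro x hx
      rw [ContinuousMap.star_apply, hg x hx, star_zero]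
  have hsub : {x | ∃ f ∈ S.Λ.I, ∃ g ∈ S.M.I, S.z r s f g = x} ⊆
      (StarSubalgebra.centralizer ℂ {x | ∃ f ∈ S.Λ.I, ∃ g ∈ S.M.I, S.z r s f g = x} : Set E) := by
    intro x hx
    rw [SetLike.mem_coe, StarSubalgebra.mem_centralizer_iff]
    exact fun y hy => ⟨hz y hy x hx, hz _ (hst y hy) x hx⟩
  have hle : S.corner r s ≤
      StarSubalgebra.centralizer ℂ {x | ∃ f ∈ S.Λ.I, ∃ g ∈ S.M.I, S.z r s f g = x} :=
    StarSubalgebra.centralizer_le ℂ _ _ hsub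
  exact ((StarSubalgebra.mem_centralizer_iff ℂ).1 hy x (hle hx)).1

instance isClosed_corner (r : S.Λ.n) (s : S.M.n) : IsClosed (S.corner r s : Set E) := by
  rw [corner, StarSubalgebra.coe_centralizer]
  exact Set.isClosed_centralizer _

theorem comp_mem_corner (r i j : S.Λ.n) (s k l : S.M.n) (hf : f ∈ S.Λ.I) (hf' : f' ∈ S.Λ.I)
    (hg : g ∈ S.M.I) (hg' : g' ∈ S.M.I) (e : E) :
    S.comp r i j s k l f f' g g' e ∈ S.corner r s := by
  refine S.dense.induction_on (p := fun e => S.comp r i j s k l f f' g g' e ∈ S.corner r s) e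
    ((S.isClosed_corner r s).preimage (ContinuousLinearMap.continuous _)) fun t => ?_
  induction t with
  | zero => rw [map_zero, map_zero]; exact zero_mem _
  | add x y hx hy => rw [map_add, map_add]; exact add_mem hx hy
  | tmul a b =>
    rw [mulMap_tmul, S.comp_gen r i j s k l hf hf' hg hg']
    exact S.z_mem_corner r s (Ideal.mul_mem_right _ _ (Ideal.mul_mem_right _ _ hf))
      (Ideal.mul_mem_right _ _ (Ideal.mul_mem_right _ _ hg))

/-- The points at which the matrix values of the elements of the tensor product are bounded by
their norms in `E`. -/
def adm : Set (S.Λ.X × S.M.X) :=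
  {p | (‖S.Λ.q 1 p.1‖ = 1 ∧ ‖S.M.q 1 p.2‖ = 1) ∧ ∀ t, ‖S.ev t p‖ ≤ ‖S.mm t‖}

/-- A projection has norm `0` or `1`; asking for norm `1` says that `q 1` does not vanish at the
point and is visibly a closed condition. -/
theorem isClosed_adm : IsClosed S.adm := by
  have h1 : IsClosed {p : S.Λ.X × S.M.X | ‖S.Λ.q 1 p.1‖ = 1} :=
    isClosed_eq (((S.Λ.q 1).continuous.comp continuous_fst).norm) continuous_const
  have h2 : IsClosed {p : S.Λ.X × S.M.X | ‖S.M.q 1 p.2‖ = 1} :=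
    isClosed_eq (((S.M.q 1).continuous.comp continuous_snd).norm) continuous_const
  have h3 : IsClosed {p : S.Λ.X × S.M.X | ∀ t, ‖S.ev t p‖ ≤ ‖S.mm t‖} := by
    have : {p : S.Λ.X × S.M.X | ∀ t, ‖S.ev t p‖ ≤ ‖S.mm t‖}
        = ⋂ t, {p | ‖S.ev t p‖ ≤ ‖S.mm t‖} := by ext; simp
    rw [this]
    exact isClosed_iInter fun t => isClosed_le (S.ev t).continuous.norm continuous_const
  exact (h1.inter h2).inter h3

instance : CompactSpace S.adm := isCompact_iff_compactSpace.1 S.isClosed_adm.isCompact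

/-- At admissible points the values of a tensor are bounded by its norm in `E`, so they extend by
continuity from the dense image of the algebraic tensor product. -/
theorem exists_values : ∃ Q : E →⋆ₙₐ[ℂ] C(S.adm, Matrix (S.Λ.n × S.M.n) (S.Λ.n × S.M.n) ℂ),
    ∀ t, Q (S.mm t) = (S.ev t).restrict S.adm := by
  let R : C(S.Λ.X × S.M.X, Matrix (S.Λ.n × S.M.n) (S.Λ.n × S.M.n) ℂ) →⋆ₙₐ[ℂ]
      C(S.adm, Matrix (S.Λ.n × S.M.n) (S.Λ.n × S.M.n) ℂ) :=
    { toFun := fun f => f.restrict S.adm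
      map_smul' := fun _ _ => rfl
      map_zero' := rfl
      map_add' := fun _ _ => rfl
      map_mul' := fun _ _ => rfl
      map_star' := fun _ => rfl }
  refine exists_extension S.mm S.dense (R.comp S.ev) 1 fun t => ?_
  rw [one_mul]
  exact (ContinuousMap.norm_le _ (norm_nonneg _)).2 fun p => p.2.2 t

/-- The matrix values of the elements of `E` at the admissible points. -/
noncomputable def values : E →⋆ₙₐ[ℂ] C(S.adm, Matrix (S.Λ.n × S.M.n) (S.Λ.n × S.M.n) ℂ) :=
  S.exists_values.choose

theorem values_gen (a : A) (b : B) :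
    S.values (S.α a * S.β b) = (kroneckerFun (S.Λ.q a) (S.M.q b)).restrict S.adm := by
  rw [← mm_tmul, values, S.exists_values.choose_spec, ev_tmul]

end LayerPair

end LayerPairs

end

/-! ### Injectivity: elements without values are annihilated by the layers. -/

section

open scoped Matrix.Norms.L2Operator Kronecker

section LayerPairValues

/-- Nonzero elements of a commutative closed subalgebra are detected by a character. -/
theorem exists_character_ne_zero {E : Type*} [CStarAlgebra E] (C : StarSubalgebra ℂ E)
    (hcl : IsClosed (C : Set E)) (hcomm : ∀ x ∈ C, ∀ y ∈ C, x * y = y * x) {c : C} (hc : c ≠ 0) :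
    ∃ χ : C →ₐ[ℂ] ℂ, Continuous χ ∧ χ c ≠ 0 := by
  let _ : CommCStarAlgebra C :=
    { StarSubalgebra.cstarAlgebra C with
      mul_comm := fun x y => Subtype.ext (hcomm x x.2 y y.2) }
  by_contra! H
  refine hc ((gelfandTransform_isometry (A := C)).injective ?_)
  rw [map_zero]
  ext χ
  exact H (WeakDual.CharacterSpace.toAlgHom χ) (WeakDual.CharacterSpace.toCLM χ).continuous

/-- A bound for the norm of a matrix by those of its entries. -/
theorem norm_matrix_le {n : Type*} [Fintype n] [DecidableEq n] (M : Matrix n n ℂ) :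
    ‖M‖ ≤ ∑ i, ∑ j, ‖M i j‖ * ‖Matrix.single i j (1 : ℂ)‖ := by
  conv_lhs => rw [Matrix.matrix_eq_sum_single M]
  refine (norm_sum_le _ _).trans (Finset.sum_le_sum fun i _ => (norm_sum_le _ _).trans
    (Finset.sum_le_sum fun j _ => ?_))
  have : Matrix.single i j (M i j) = M i j • Matrix.single i j (1 : ℂ) := by
    rw [Matrix.smul_single, smul_eq_mul, mul_one]
  rw [this]
  exact norm_smul_le _ _

theorem norm_eq_one_of_isStarProjection {F : Type*} [CStarAlgebra F] {p : F}
    (hp : IsStarProjection p) (h0 : p ≠ 0) : ‖p‖ = 1 := by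
  have h1 : ‖p‖ * ‖p‖ = ‖p‖ := by
    rw [← CStarRing.norm_star_mul_self, hp.isSelfAdjoint.star_eq, hp.isIdempotentElem.eq]
  have h2 : ‖p‖ ≠ 0 := norm_ne_zero_iff.2 h0
  exact mul_right_cancel₀ h2 (by rw [h1, one_mul])

theorem MatrixLayer.isStarProjection_q_one {A : Type u} [CStarAlgebra A] (Λ : MatrixLayer A) (x : Λ.X) :
    IsStarProjection (Λ.q 1 x) := by
  refine ⟨?_, ?_⟩
  · change Λ.q 1 x * Λ.q 1 x = Λ.q 1 x
    rw [← ContinuousMap.mul_apply, ← map_mul, one_mul]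
  · change star (Λ.q 1 x) = Λ.q 1 x
    rw [← ContinuousMap.star_apply, ← map_star, star_one]

theorem add_smul_fun {X n : Type*} [TopologicalSpace X] [Fintype n] [DecidableEq n]
    (f g : C(X, ℂ)) (h : C(X, Matrix n n ℂ)) : (f + g) • h = f • h + g • h :=
  ContinuousMap.ext fun _ => add_smul _ _ _

theorem smul_smul_fun {X n : Type*} [TopologicalSpace X] [Fintype n] [DecidableEq n]
    (c : ℂ) (f : C(X, ℂ)) (h : C(X, Matrix n n ℂ)) : (c • f) • h = c • f • h :=
  ContinuousMap.ext fun x => smul_assoc c (f x) (h x)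

theorem continuous_starHom {F G : Type*} [NonUnitalCStarAlgebra F] [NonUnitalCStarAlgebra G]
    (φ : F →⋆ₙₐ[ℂ] G) : Continuous φ :=
  AddMonoidHomClass.continuous_of_bound φ 1 fun a => by
    rw [one_mul]
    exact NonUnitalStarAlgHom.norm_apply_le φ a

namespace LayerPair

variable {A B E : Type u} [CStarAlgebra A] [CStarAlgebra B] [CStarAlgebra E] (S : LayerPair A B E)

variable {f f' : C(S.Λ.X, ℂ)} {g g' : C(S.M.X, ℂ)}

/-- The compressions of an element without values vanish. -/
theorem comp_eq_zero {e : E} (he : S.values e = 0) (r i j : S.Λ.n) (s k l : S.M.n)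
    (hf : f ∈ S.Λ.I) (hf' : f' ∈ S.Λ.I) (hg : g ∈ S.M.I) (hg' : g' ∈ S.M.I) :
    S.comp r i j s k l f f' g g' e = 0 := by
  by_contra hne
  -- A nonzero compression is seen by a character of the corner. This character turns out to be a
  -- point evaluation at an admissible point, where `e` has value zero.
  obtain ⟨χ, hχc, hχ⟩ := exists_character_ne_zero (S.corner r s) (S.isClosed_corner r s)
    (fun x hx y hy => S.corner_comm r s hx hy)
    (c := ⟨_, S.comp_mem_corner r i j s k l hf hf' hg hg' e⟩) (fun h => hne (Subtype.ext_iff.1 h))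
  classical
  -- The default value `0` outside the corner is never used; it spares membership proofs in the
  -- terms.
  let χ' : E → ℂ := fun x => if H : x ∈ S.corner r s then χ ⟨x, H⟩ else 0
  have hχ' : ∀ x (H : x ∈ S.corner r s), χ' x = χ ⟨x, H⟩ := fun x H => dif_pos H
  have hadd : ∀ x ∈ S.corner r s, ∀ y ∈ S.corner r s, χ' (x + y) = χ' x + χ' y := by
    intro x hx y hy
    rw [hχ' x hx, hχ' y hy, hχ' _ (add_mem hx hy), ← map_add]; rfl
  have hmul : ∀ x ∈ S.corner r s, ∀ y ∈ S.corner r s, χ' (x * y) = χ' x * χ' y := by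
    intro x hx y hy
    rw [hχ' x hx, hχ' y hy, hχ' _ (mul_mem hx hy), ← map_mul]; rfl
  have hsmul : ∀ (c : ℂ), ∀ x ∈ S.corner r s, χ' (c • x) = c * χ' x := by
    intro c x hx
    rw [hχ' x hx, hχ' _ (SMulMemClass.smul_mem c hx), ← smul_eq_mul, ← map_smul]; rfl
  have hmem : ∀ f ∈ S.Λ.I, ∀ g ∈ S.M.I, S.z r s f g ∈ S.corner r s := fun f hf g hg =>
    S.z_mem_corner r s hf hg
  -- the functional that takes an entry
  have hL : ∀ (i j : S.Λ.n) (k l : S.M.n), ∀ f ∈ S.Λ.I, ∀ f' ∈ S.Λ.I, ∀ g ∈ S.M.I, ∀ g' ∈ S.M.I,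
      ∃ L : E →ₗ[ℂ] ℂ, Continuous L ∧ ∀ e, L e = χ' (S.comp r i j s k l f f' g g' e) := by
    intro i j k l f hf f' hf' g hg g' hg'
    let T : E →ₗ[ℂ] S.corner r s :=
      { toFun := fun e => ⟨_, S.comp_mem_corner r i j s k l hf hf' hg hg' e⟩
        map_add' := fun _ _ => Subtype.ext (map_add _ _ _)
        map_smul' := fun _ _ => Subtype.ext (map_smul _ _ _) }
    refine ⟨χ.toLinearMap.comp T, hχc.comp (Continuous.subtype_mk (ContinuousLinearMap.continuous _) _),
      fun e => (hχ' _ (S.comp_mem_corner r i j s k l hf hf' hg hg' e)).symm⟩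
  -- Otherwise `χ'` after compression is a continuous functional vanishing on all generators, hence
  -- at `e`.
  obtain ⟨f₀, hf₀, g₀, hg₀, h₀⟩ : ∃ f ∈ S.Λ.I, ∃ g ∈ S.M.I, χ' (S.z r s f g) ≠ 0 := by
    by_contra! H
    obtain ⟨L, hLc, hL⟩ := hL i j k l f hf f' hf' g hg g' hg'
    refine hχ ?_
    rw [← hχ', ← hL]
    refine S.eq_of_dense (ψ := 0) hLc continuous_zero (fun a b => ?_) e
    rw [hL, S.comp_gen r i j s k l hf hf' hg hg']
    exact H _ (Ideal.mul_mem_right _ _ (Ideal.mul_mem_right _ _ hf)) _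
      (Ideal.mul_mem_right _ _ (Ideal.mul_mem_right _ _ hg))
  have hθ : ∀ f ∈ S.Λ.I, S.Λ.Adapted (f • S.Λ.θ r r) := fun f hf => S.Λ.adapted_smul_θ hf r r
  have hθ' : ∀ g ∈ S.M.I, S.M.Adapted (g • S.M.θ s s) := fun f hf => S.M.adapted_smul_θ hf s s
  -- On the `f θᵣᵣ ⊗ g θₛₛ` the character is bilinear and multiplicative up to weights, so it is
  -- given by a point `(x, y)`.
  obtain ⟨x, y, hxy⟩ := exists_eq_eval_mul_eval S.Λ.I S.M.I (entry (S.Λ.q 1) r r)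
    (entry (S.M.q 1) s s) (fun f g => χ' (S.z r s f g))
    (fun f hf f' hf' g hg => by
      rw [← hadd _ (hmem f hf g hg) _ (hmem f' hf' g hg), z, add_smul_fun,
        W_add_left (hθ f hf) (hθ f' hf') (hθ' g hg), z, z])
    (fun c f hf g hg => by
      rw [← hsmul c _ (hmem f hf g hg), z, smul_smul_fun, W_smul_left c (hθ f hf) (hθ' g hg), z])
    (fun f hf g hg g' hg' => by
      rw [← hadd _ (hmem f hf g hg) _ (hmem f hf g' hg'), z, add_smul_fun,
        W_add_right (hθ f hf) (hθ' g hg) (hθ' g' hg'), z, z])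
    (fun c f hf g hg => by
      rw [← hsmul c _ (hmem f hf g hg), z, smul_smul_fun, W_smul_right c (hθ f hf) (hθ' g hg), z])
    (fun f hf f' hf' g hg g' hg' => by
      rw [← hmul _ (hmem f hf g hg) _ (hmem f' hf' g' hg'), S.z_mul_z r s hf hf' hg hg'])
    hf₀ hg₀ h₀
  have hne : f₀ x * g₀ y * (entry (S.Λ.q 1) r r x * entry (S.M.q 1) s s y) ≠ 0 := by
    rw [← hxy f₀ hf₀ g₀ hg₀]; exact h₀
  have hf₀x : f₀ x ≠ 0 := fun h => hne (by rw [h]; ring)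
  have hg₀y : g₀ y ≠ 0 := fun h => hne (by rw [h]; ring)
  have hρ : entry (S.Λ.q 1) r r x ≠ 0 := fun h => hne (by rw [h]; ring)
  have hσ : entry (S.M.q 1) s s y ≠ 0 := fun h => hne (by rw [h]; ring)
  have hgen : ∀ (i j : S.Λ.n) (k l : S.M.n), ∀ f ∈ S.Λ.I, ∀ f' ∈ S.Λ.I, ∀ g ∈ S.M.I, ∀ g' ∈ S.M.I,
      ∀ a b, χ' (S.comp r i j s k l f f' g g' (S.α a * S.β b)) =
        f x * f' x * (g y * g' y) * (entry (S.Λ.q 1) r r x * entry (S.M.q 1) s s y) *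
          kroneckerFun (S.Λ.q a) (S.M.q b) (x, y) (i, k) (j, l) := by
    intro i j k l f hf f' hf' g hg g' hg' a b
    rw [S.comp_gen r i j s k l hf hf' hg hg', hxy _ (Ideal.mul_mem_right _ _
      (Ideal.mul_mem_right _ _ hf)) _ (Ideal.mul_mem_right _ _ (Ideal.mul_mem_right _ _ hg))]
    simp only [ContinuousMap.mul_apply, entry_apply, kroneckerFun_apply, Matrix.kroneckerMap_apply]
    ring
  have hev : ∀ (i j : S.Λ.n) (k l : S.M.n), ∀ f ∈ S.Λ.I, ∀ f' ∈ S.Λ.I, ∀ g ∈ S.M.I, ∀ g' ∈ S.M.I,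
      ∀ t, χ' (S.comp r i j s k l f f' g g' (S.mm t)) =
        f x * f' x * (g y * g' y) * (entry (S.Λ.q 1) r r x * entry (S.M.q 1) s s y) *
          S.ev t (x, y) (i, k) (j, l) := by
    intro i j k l f hf f' hf' g hg g' hg' t
    obtain ⟨L, -, hL⟩ := hL i j k l f hf f' hf' g hg g' hg'
    rw [← hL]
    induction t with
    | zero => simp
    | add t t' h h' => rw [map_add, map_add, h, h', map_add, ContinuousMap.add_apply,
        Matrix.add_apply]; ring
    | tmul a b => rw [mm_tmul, hL, hgen i j k l f hf f' hf' g hg g' hg', ev_tmul]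
  -- the values at this point are bounded
  obtain ⟨C, hC⟩ : ∃ C, ∀ t, ‖S.ev t (x, y)‖ ≤ C * ‖S.mm t‖ := by
    have hij : ∀ p q : S.Λ.n × S.M.n, ∃ C, ∀ t, ‖S.ev t (x, y) p q‖ ≤ C * ‖S.mm t‖ := by
      intro p q
      obtain ⟨L, hLc, hL⟩ := hL p.1 q.1 p.2 q.2 f₀ hf₀ f₀ hf₀ g₀ hg₀ g₀ hg₀
      set c := f₀ x * f₀ x * (g₀ y * g₀ y) * (entry (S.Λ.q 1) r r x * entry (S.M.q 1) s s y) with hc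
      have hc0 : c ≠ 0 := by simp only [hc, mul_ne_zero_iff]; tauto
      let L' : E →L[ℂ] ℂ := ⟨L, hLc⟩
      refine ⟨‖L'‖ / ‖c‖, fun t => ?_⟩
      have h1 : L' (S.mm t) = c * S.ev t (x, y) p q := by
        rw [← hev p.1 q.1 p.2 q.2 f₀ hf₀ f₀ hf₀ g₀ hg₀ g₀ hg₀ t, ← hL]; rfl
      have h2 := L'.le_opNorm (S.mm t)
      rw [h1, norm_mul] at h2
      rw [div_mul_eq_mul_div, le_div_iff₀ (norm_pos_iff.2 hc0), mul_comm]
      exact h2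
    choose C hC using hij
    refine ⟨∑ p, ∑ q, C p q * ‖Matrix.single p q (1 : ℂ)‖, fun t => (norm_matrix_le _).trans ?_⟩
    rw [Finset.sum_mul]
    refine Finset.sum_le_sum fun p _ => ?_
    rw [Finset.sum_mul]
    refine Finset.sum_le_sum fun q _ => ?_
    rw [mul_right_comm]
    exact mul_le_mul_of_nonneg_right (hC p q t) (norm_nonneg _)
  have hadm : (x, y) ∈ S.adm := by
    refine ⟨⟨norm_eq_one_of_isStarProjection (S.Λ.isStarProjection_q_one x) fun h => hρ ?_,
      norm_eq_one_of_isStarProjection (S.M.isStarProjection_q_one y) fun h => hσ ?_⟩, ?_⟩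
    · rw [entry_apply, h]; rfl
    · rw [entry_apply, h]; rfl
    let evp : C(S.Λ.X × S.M.X, Matrix (S.Λ.n × S.M.n) (S.Λ.n × S.M.n) ℂ) →⋆ₙₐ[ℂ]
        Matrix (S.Λ.n × S.M.n) (S.Λ.n × S.M.n) ℂ :=
      { toFun := fun f => f (x, y)
        map_smul' := fun _ _ => rfl
        map_zero' := rfl
        map_add' := fun _ _ => rfl
        map_mul' := fun _ _ => rfl
        map_star' := fun _ => rfl }
    -- A bound with some constant `C` suffices for an extension to `E`, and a star homomorphism
    -- between C*-algebras is contractive; so the constant may be taken to be `1`, as admissibility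
    -- requires.
    obtain ⟨τ, hτ⟩ := exists_extension S.mm S.dense (evp.comp S.ev) C hC
    intro t
    have := NonUnitalStarAlgHom.norm_apply_le τ (S.mm t)
    rwa [hτ] at this
  obtain ⟨L, hLc, hL⟩ := hL i j k l f hf f' hf' g hg g' hg'
  set c := f x * f' x * (g y * g' y) * (entry (S.Λ.q 1) r r x * entry (S.M.q 1) s s y) with hc
  have hvc : Continuous fun e => S.values e ⟨(x, y), hadm⟩ :=
    (continuous_eval_const _).comp (continuous_starHom S.values)
  let V : E →ₗ[ℂ] ℂ :=
    { toFun := fun e => c * S.values e ⟨(x, y), hadm⟩ (i, k) (j, l)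
      map_add' := fun e e' => by
        rw [map_add, ContinuousMap.add_apply, Matrix.add_apply, mul_add]
      map_smul' := fun d e => by
        rw [map_smul, ContinuousMap.smul_apply, Matrix.smul_apply, RingHom.id_apply, mul_smul_comm] }
  -- The functional given by the character and the entry of the value at `(x, y)` agree on
  -- generators, hence on `E`.
  have hLV : L e = V e := by
    refine S.eq_of_dense hLc (continuous_const.mul (hvc.matrix_elem _ _)) (fun a b => ?_) e
    rw [hL, hgen i j k l f hf f' hf' g hg g' hg']
    change _ = c * S.values (S.α a * S.β b) ⟨(x, y), hadm⟩ (i, k) (j, l)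
    rw [values_gen]
    rfl
  refine hχ ?_
  rw [← hχ', ← hL, hLV]
  change c * S.values e ⟨(x, y), hadm⟩ (i, k) (j, l) = 0
  rw [he]
  exact mul_zero _

theorem MatrixLayer.sum_entry_smul_θ {A : Type u} [CStarAlgebra A] (Λ : MatrixLayer A) {h : C(Λ.X, Matrix Λ.n Λ.n ℂ)}
    (hh : Λ.q 1 * h * Λ.q 1 = h) : ∑ i, ∑ j, entry h i j • Λ.θ i j = h := by
  conv_rhs => rw [← hh]
  ext x : 1
  have : h x = ∑ i, ∑ j, h x i j • Matrix.single i j (1 : ℂ) := by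
    conv_lhs => rw [Matrix.matrix_eq_sum_single (h x)]
    simp [Matrix.smul_single]
  rw [ContinuousMap.mul_apply, ContinuousMap.mul_apply, this]
  simp only [ContinuousMap.sum_apply, ContinuousMap.smul_apply', entry_apply, MatrixLayer.θ,
    ContinuousMap.mul_apply, ContinuousMap.const_apply, Finset.mul_sum, Finset.sum_mul,
    mul_smul_comm, smul_mul_assoc]

/-- An element without values is annihilated by the products of elements of the two ideals. -/
theorem gen_mul_eq_zero {e : E} (he : S.values e = 0) {j : A} (hj : j ∈ S.Λ.J) {k : B}
    (hk : k ∈ S.M.J) : S.α j * S.β k * e = 0 := by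
  have h1 : ∀ (r i : S.Λ.n) (s k : S.M.n), ∀ f ∈ S.Λ.I, ∀ g ∈ S.M.I,
      S.W (f • S.Λ.θ r i) (g • S.M.θ s k) * e = 0 := by
    intro r i s k f hf g hg
    -- With `w` the first factor, `w * e * star e * star w` is a compression of `e * star e`, which
    -- has no values either.
    rw [← CStarRing.mul_star_self_eq_zero_iff, star_mul,
      star_W (S.Λ.adapted_smul_θ hf _ _) (S.M.adapted_smul_θ hg _ _)]
    have hs : ∀ {X n : Type _} [TopologicalSpace X] [Fintype n] [DecidableEq n] (f : C(X, ℂ))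
        (h : C(X, Matrix n n ℂ)), star (f • h) = star f • star h := by
      intro X n _ _ _ f h
      ext x : 1
      simp
    rw [hs, hs, S.Λ.star_θ, S.M.star_θ]
    have hf' : star f ∈ S.Λ.I := by
      rw [MatrixLayer.mem_I] at hf ⊢
      intro x hx
      rw [ContinuousMap.star_apply, hf x hx, star_zero]
    have hg' : star g ∈ S.M.I := by
      rw [MatrixLayer.mem_I] at hg ⊢
      intro x hx
      rw [ContinuousMap.star_apply, hg x hx, star_zero]
    have := S.comp_eq_zero (e := e * star e) (by rw [map_mul, he, zero_mul]) r i i s k k hf hf' hg hg'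
    rw [comp_apply] at this
    simpa only [mul_assoc] using this
  have hI : ∀ i i', entry (S.Λ.q j) i i' ∈ S.Λ.I := fun i i' => by
    rw [MatrixLayer.mem_I]
    intro x hx
    rw [entry_apply, (MatrixLayer.adapted_of_mem hj).2 x hx]; rfl
  have hI' : ∀ i i', entry (S.M.q k) i i' ∈ S.M.I := fun i i' => by
    rw [MatrixLayer.mem_I]
    intro x hx
    rw [entry_apply, (MatrixLayer.adapted_of_mem hk).2 x hx]; rfl
  have hA : ∀ i i', S.Λ.Adapted (entry (S.Λ.q j) i i' • S.Λ.θ i i') := fun i i' =>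
    S.Λ.adapted_smul_θ (hI i i') i i'
  have hA' : ∀ i i', S.M.Adapted (entry (S.M.q k) i i' • S.M.θ i i') := fun i i' =>
    S.M.adapted_smul_θ (hI' i i') i i'
  -- Both values are expanded in compressed matrix units, with entries vanishing on `X₀` as
  -- coefficients; every summand is then covered by `h1`.
  rw [← S.W_eq hj hk, ← MatrixLayer.sum_entry_smul_θ S.Λ (MatrixLayer.adapted_of_mem hj).1,
    ← MatrixLayer.sum_entry_smul_θ S.M (MatrixLayer.adapted_of_mem hk).1,
    W_sum_left _ (fun i => MatrixLayer.Adapted.sum fun i' _ => hA i i')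
      (MatrixLayer.Adapted.sum fun l _ => MatrixLayer.Adapted.sum fun l' _ => hA' l l'),
    Finset.sum_mul]
  refine Finset.sum_eq_zero fun i _ => ?_
  rw [W_sum_left _ (fun i' => hA i i')
    (MatrixLayer.Adapted.sum fun l _ => MatrixLayer.Adapted.sum fun l' _ => hA' l l'), Finset.sum_mul]
  refine Finset.sum_eq_zero fun i' _ => ?_
  rw [W_sum_right _ (fun l => MatrixLayer.Adapted.sum fun l' _ => hA' l l') (hA i i'), Finset.sum_mul]
  refine Finset.sum_eq_zero fun l _ => ?_
  rw [W_sum_right _ (fun l' => hA' l l') (hA i i'), Finset.sum_mul]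
  exact Finset.sum_eq_zero fun l' _ => h1 _ _ _ _ _ (hI i i') _ (hI' l l')

end LayerPair

end LayerPairValues

end

/-! ### Surjectivity: the image of the ideal generated by two layers. -/

section

open scoped Matrix.Norms.L2Operator Kronecker

section LayerPairIdeal

theorem exists_eq_one_of_ne {X : Type*} [TopologicalSpace X] [CompactSpace X] [T2Space X]
    {x : X} {s : Set X} (hs : IsClosed s) (hx : x ∉ s) : ∃ f : C(X, ℂ), f x ≠ 0 ∧ ∀ y ∈ s, f y = 0 := by
  obtain ⟨f, h0, h1, -⟩ := exists_continuous_zero_one_of_isClosed hs (isClosed_singleton (x := x))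
    (Set.disjoint_singleton_right.2 hx)
  refine ⟨⟨fun y => (f y : ℂ), by fun_prop⟩, ?_, fun y hy => ?_⟩
  · change (f x : ℂ) ≠ 0
    rw [h1 (Set.mem_singleton x)]
    simp
  · change (f y : ℂ) = 0
    rw [h0 hy]
    simp

namespace LayerPair

variable {A B E : Type u} [CStarAlgebra A] [CStarAlgebra B] [CStarAlgebra E] (S : LayerPair A B E)

/-- The linear span of the products of elements of the two ideals. -/
noncomputable def spanGen : Submodule ℂ E := Submodule.span ℂ {z | ∃ j ∈ S.Λ.J, ∃ k ∈ S.M.J, S.α j * S.β k = z}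

theorem exists_ideal : ∃ L : TwoSidedIdeal E, (L : Set E) = closure (S.spanGen : Set E) := by
  have hl : ∀ (t : A ⊗[ℂ] B), ∀ x ∈ S.spanGen, S.mm t * x ∈ S.spanGen := by
    intro t x hx
    induction hx using Submodule.span_induction with
    | zero => rw [mul_zero]; exact zero_mem _
    | add x y _ _ hx hy => rw [mul_add]; exact add_mem hx hy
    | smul c x _ hx => rw [mul_smul_comm]; exact S.spanGen.smul_mem _ hx
    | mem x hx =>
      obtain ⟨j, hj, k, hk, rfl⟩ := hx
      induction t with
      | zero => rw [map_zero, zero_mul]; exact zero_mem _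
      | add x y hx hy => rw [map_add, add_mul]; exact add_mem hx hy
      | tmul a b =>
        refine Submodule.subset_span ⟨a * j, S.Λ.J.mul_mem_left _ _ hj, b * k,
          S.M.J.mul_mem_left _ _ hk, ?_⟩
        rw [mm_tmul, map_mul, map_mul]
        simp only [mul_assoc]
        rw [← mul_assoc (S.β b), ← (S.comm j b).eq]
        simp only [mul_assoc]
  have hr : ∀ (t : A ⊗[ℂ] B), ∀ x ∈ S.spanGen, x * S.mm t ∈ S.spanGen := by
    intro t x hx
    induction hx using Submodule.span_induction with
    | zero => rw [zero_mul]; exact zero_mem _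
    | add x y _ _ hx hy => rw [add_mul]; exact add_mem hx hy
    | smul c x _ hx => rw [smul_mul_assoc]; exact S.spanGen.smul_mem _ hx
    | mem x hx =>
      obtain ⟨j, hj, k, hk, rfl⟩ := hx
      induction t with
      | zero => rw [map_zero, mul_zero]; exact zero_mem _
      | add x y hx hy => rw [map_add, mul_add]; exact add_mem hx hy
      | tmul a b =>
        refine Submodule.subset_span ⟨j * a, S.Λ.J.mul_mem_right _ _ hj, k * b,
          S.M.J.mul_mem_right _ _ hk, ?_⟩
        rw [mm_tmul, map_mul, map_mul]
        simp only [mul_assoc]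
        rw [← mul_assoc (S.β k), ← (S.comm a k).eq]
        simp only [mul_assoc]
  refine exists_ideal_eq_closure S.dense (zero_mem _) (fun x hx y hy => add_mem hx hy)
    (fun x hx => neg_mem hx) ?_ ?_
  · rintro _ ⟨t, rfl⟩ x hx
    exact hl t x hx
  · rintro _ ⟨t, rfl⟩ x hx
    exact hr t x hx

/-- The closed ideal generated by the products of elements of the two ideals. -/
noncomputable def ideal : TwoSidedIdeal E := S.exists_ideal.choose

theorem coe_ideal : (S.ideal : Set E) = closure (S.spanGen : Set E) := S.exists_ideal.choose_spec

theorem isClosed_ideal : IsClosed (S.ideal : Set E) := by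
  rw [coe_ideal]
  exact isClosed_closure

theorem mem_ideal {j : A} (hj : j ∈ S.Λ.J) {k : B} (hk : k ∈ S.M.J) : S.α j * S.β k ∈ S.ideal := by
  have : S.α j * S.β k ∈ (S.ideal : Set E) := by
    rw [coe_ideal]
    exact subset_closure (Submodule.subset_span ⟨j, hj, k, hk, rfl⟩)
  exact this

/-- A closed condition that holds for the generators holds on the ideal. -/
theorem ideal_induction {p : E → Prop} (hp : IsClosed {x | p x}) (zero : p 0)
    (add : ∀ x y, p x → p y → p (x + y)) (smul : ∀ (c : ℂ) x, p x → p (c • x))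
    (gen : ∀ j ∈ S.Λ.J, ∀ k ∈ S.M.J, p (S.α j * S.β k)) {x : E} (hx : x ∈ S.ideal) : p x := by
  have h1 : (S.spanGen : Set E) ⊆ {x | p x} := by
    intro x hx
    induction hx using Submodule.span_induction with
    | zero => exact zero
    | add x y _ _ hx hy => exact add x y hx hy
    | smul c x _ hx => exact smul c x hx
    | mem x hx =>
      obtain ⟨j, hj, k, hk, rfl⟩ := hx
      exact gen j hj k hk
  have h2 : x ∈ (S.ideal : Set E) := hx
  rw [coe_ideal] at h2
  exact closure_minimal h1 hp h2

/-- The values determine the elements of the ideal. -/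
theorem eq_zero_of_values {e : E} (he : e ∈ S.ideal) (h : S.values e = 0) : e = 0 := by
  -- `e` is annihilated on the left by the generators of the ideal, hence by the whole ideal, which
  -- contains `star e`.
  have h1 : star e * e = 0 := by
    refine S.ideal_induction (p := fun x => x * e = 0) (isClosed_eq (by fun_prop) continuous_const)
      (zero_mul _) (fun x y hx hy => by rw [add_mul, hx, hy, add_zero])
      (fun c x hx => by rw [smul_mul_assoc, hx, smul_zero])
      (fun j hj k hk => S.gen_mul_eq_zero h hj hk)
      (TwoSidedIdeal.star_mem_of_isClosed S.isClosed_ideal he)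
  exact CStarRing.star_mul_self_eq_zero_iff _ |>.1 h1

/-- The ideal as a subalgebra. -/
noncomputable def idealSubalgebra : NonUnitalStarSubalgebra ℂ E where
  carrier := S.ideal
  add_mem' := S.ideal.add_mem
  zero_mem' := S.ideal.zero_mem
  mul_mem' := fun _ hb => S.ideal.mul_mem_left _ _ hb
  smul_mem' := fun c _ hx => smul_mem _ c hx
  star_mem' := fun hx => TwoSidedIdeal.star_mem_of_isClosed S.isClosed_ideal hx

/-- On the ideal the values are injective, and an injective star homomorphism is isometric, so the
image of the closed ideal is complete. -/
theorem isClosed_image : IsClosed (S.values '' (S.ideal : Set E)) := by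
  have hcl : IsClosed (S.idealSubalgebra : Set E) := S.isClosed_ideal
  let ψ : S.idealSubalgebra →⋆ₙₐ[ℂ] C(S.adm, Matrix (S.Λ.n × S.M.n) (S.Λ.n × S.M.n) ℂ) :=
    S.values.comp (NonUnitalStarSubalgebraClass.subtype S.idealSubalgebra)
  have hinj : Function.Injective ψ := by
    rw [injective_iff_map_eq_zero]
    intro x hx
    exact Subtype.ext (S.eq_zero_of_values x.2 hx)
  have hrange : S.values '' (S.ideal : Set E) = Set.range ψ := by
    ext h
    constructor
    · rintro ⟨x, hx, rfl⟩
      exact ⟨⟨x, hx⟩, rfl⟩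
    · rintro ⟨x, rfl⟩
      exact ⟨x, x.2, rfl⟩
  rw [hrange]
  exact (NonUnitalStarAlgHom.isometry ψ hinj).isClosedEmbedding.isClosed_range

/-- The points where the values of the elements of the ideal vanish. -/
def adm₀ : Set S.adm := {p | p.1.1 ∈ S.Λ.X₀ ∨ p.1.2 ∈ S.M.X₀}

theorem isClosed_adm₀ : IsClosed S.adm₀ :=
  (S.Λ.isClosed_X₀.preimage (continuous_fst.comp continuous_subtype_val)).union
    (S.M.isClosed_X₀.preimage (continuous_snd.comp continuous_subtype_val))

theorem values_one : S.values 1 = (kroneckerFun (S.Λ.q 1) (S.M.q 1)).restrict S.adm := by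
  rw [← S.values_gen, map_one S.α, map_one S.β, one_mul]

/-- The function `(x, y) ↦ f x * g y` on the admissible points. -/
noncomputable def prodFun (f : C(S.Λ.X, ℂ)) (g : C(S.M.X, ℂ)) : C(S.adm, ℂ) where
  toFun p := f p.1.1 * g p.1.2
  continuous_toFun := by fun_prop

theorem prodFun_smul (f : C(S.Λ.X, ℂ)) (g : C(S.M.X, ℂ)) (h : C(S.Λ.X, Matrix S.Λ.n S.Λ.n ℂ))
    (k : C(S.M.X, Matrix S.M.n S.M.n ℂ)) :
    S.prodFun f g • (kroneckerFun h k).restrict S.adm = (kroneckerFun (f • h) (g • k)).restrict S.adm := by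
  ext p : 1
  change (f p.1.1 * g p.1.2) • (h p.1.1 ⊗ₖ k p.1.2) = (f p.1.1 • h p.1.1) ⊗ₖ (g p.1.2 • k p.1.2)
  rw [Matrix.smul_kronecker, Matrix.kronecker_smul, smul_smul]

theorem kroneckerFun_mem_image {h : C(S.Λ.X, Matrix S.Λ.n S.Λ.n ℂ)}
    {k : C(S.M.X, Matrix S.M.n S.M.n ℂ)} (hh : S.Λ.Adapted h) (hk : S.M.Adapted k) :
    (kroneckerFun h k).restrict S.adm ∈ S.values '' (S.ideal : Set E) := by
  obtain ⟨j, hj, rfl⟩ := hh.exists_lift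
  obtain ⟨l, hl, rfl⟩ := hk.exists_lift
  exact ⟨_, S.mem_ideal hj hl, S.values_gen j l⟩

/-- The image of the ideal, as a linear subspace. -/
noncomputable def image : Submodule ℂ C(S.adm, Matrix (S.Λ.n × S.M.n) (S.Λ.n × S.M.n) ℂ) where
  carrier := S.values '' (S.ideal : Set E)
  add_mem' := by
    rintro _ _ ⟨x, hx, rfl⟩ ⟨y, hy, rfl⟩
    exact ⟨x + y, S.ideal.add_mem hx hy, map_add _ _ _⟩
  zero_mem' := ⟨0, S.ideal.zero_mem, map_zero _⟩
  smul_mem' := by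
    rintro c _ ⟨x, hx, rfl⟩
    exact ⟨c • x, smul_mem _ c hx, map_smul _ _ _⟩

theorem star_mem_image {m : C(S.adm, Matrix (S.Λ.n × S.M.n) (S.Λ.n × S.M.n) ℂ)} (hm : m ∈ S.image) :
    star m ∈ S.image := by
  obtain ⟨x, hx, rfl⟩ := hm
  exact ⟨star x, TwoSidedIdeal.star_mem_of_isClosed S.isClosed_ideal hx, map_star _ _⟩

theorem continuous_smul_fun : Continuous fun p : C(S.adm, ℂ) × C(S.adm,
    Matrix (S.Λ.n × S.M.n) (S.Λ.n × S.M.n) ℂ) => p.1 • p.2 := by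
  refine ContinuousMap.continuous_of_continuous_uncurry _ ?_
  have h1 : Continuous fun q : (C(S.adm, ℂ) × C(S.adm,
      Matrix (S.Λ.n × S.M.n) (S.Λ.n × S.M.n) ℂ)) × S.adm => q.1.1 q.2 := by fun_prop
  have h2 : Continuous fun q : (C(S.adm, ℂ) × C(S.adm,
      Matrix (S.Λ.n × S.M.n) (S.Λ.n × S.M.n) ℂ)) × S.adm => q.1.2 q.2 := by fun_prop
  exact h1.smul h2

/-- The image of the ideal is a module over the scalar functions. -/
theorem smul_mem_image (f : C(S.adm, ℂ)) {m : C(S.adm, Matrix (S.Λ.n × S.M.n) (S.Λ.n × S.M.n) ℂ)}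
    (hm : m ∈ S.image) : f • m ∈ S.image := by
  have hcl : IsClosed (S.image : Set C(S.adm, Matrix (S.Λ.n × S.M.n) (S.Λ.n × S.M.n) ℂ)) :=
    S.isClosed_image
  -- The scalar functions multiplying the image into itself form a closed star subalgebra. It
  -- contains the products `f x * g y`, which separate points, so Stone–Weierstrass applies.
  let T : StarSubalgebra ℂ C(S.adm, ℂ) :=
    { carrier := {f | ∀ m ∈ S.image, f • m ∈ S.image}
      mul_mem' := fun {f g} hf hg m hm => by
        rw [mul_smul]
        exact hf _ (hg m hm)
      add_mem' := fun {f g} hf hg m hm => by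
        rw [add_smul_fun]
        exact add_mem (hf m hm) (hg m hm)
      algebraMap_mem' := fun c m hm => by
        have : algebraMap ℂ C(S.adm, ℂ) c • m = c • m := rfl
        rw [this]
        exact S.image.smul_mem c hm
      star_mem' := fun {f} hf m hm => by
        have : star f • m = star (f • star m) := by
          ext p : 1
          simp
        rw [this]
        exact S.star_mem_image (hf _ (S.star_mem_image hm)) }
  have hT : IsClosed (T : Set C(S.adm, ℂ)) := by
    have : (T : Set C(S.adm, ℂ)) = ⋂ m ∈ S.image, {f | f • m ∈ S.image} := by
      ext; simp [T]
    rw [this]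
    refine isClosed_biInter fun m _ => hcl.preimage ?_
    exact S.continuous_smul_fun.comp (continuous_id.prodMk continuous_const)
  have hprod : ∀ f g, S.prodFun f g ∈ T := by
    rintro f g _ ⟨x, hx, rfl⟩
    refine S.ideal_induction (p := fun x => S.prodFun f g • S.values x ∈ S.image) ?_ ?_ ?_ ?_ ?_ hx
    · exact hcl.preimage (S.continuous_smul_fun.comp
        (continuous_const.prodMk (continuous_starHom S.values)))
    · have : S.prodFun f g • S.values 0 = 0 := by
        rw [map_zero]
        ext p : 1
        exact smul_zero (S.prodFun f g p)
      rw [this]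
      exact zero_mem _
    · intro x y hx hy
      have : S.prodFun f g • S.values (x + y) = S.prodFun f g • S.values x + S.prodFun f g • S.values y := by
        rw [map_add]
        ext p : 1
        exact smul_add (S.prodFun f g p) (S.values x p) (S.values y p)
      rw [this]
      exact add_mem hx hy
    · intro c x hx
      rw [map_smul]
      have : S.prodFun f g • c • S.values x = c • S.prodFun f g • S.values x := by
        ext p : 1
        exact smul_comm (S.prodFun f g p) c (S.values x p)
      rw [this]
      exact S.image.smul_mem c hx
    · intro j hj k hk
      rw [values_gen, prodFun_smul]
      exact S.kroneckerFun_mem_image ((MatrixLayer.adapted_of_mem hj).smul f)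
        ((MatrixLayer.adapted_of_mem hk).smul g)
  have hsep : T.SeparatesPoints := by
    intro p p' hpp'
    by_cases h1 : p.1.1 = p'.1.1
    · have h2 : p.1.2 ≠ p'.1.2 := fun h2 => hpp' (Subtype.ext (Prod.ext h1 h2))
      obtain ⟨g, hg, hg'⟩ := exists_eq_one_of_ne (isClosed_singleton (x := p'.1.2)) h2
      refine ⟨_, ⟨_, hprod 1 g, rfl⟩, ?_⟩
      change 1 * g p.1.2 ≠ 1 * g p'.1.2
      rw [hg' _ rfl, one_mul, one_mul]
      exact hg
    · obtain ⟨g, hg, hg'⟩ := exists_eq_one_of_ne (isClosed_singleton (x := p'.1.1)) h1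
      refine ⟨_, ⟨_, hprod g 1, rfl⟩, ?_⟩
      change g p.1.1 * 1 ≠ g p'.1.1 * 1
      rw [hg' _ rfl, mul_one, mul_one]
      exact hg
  have htop := ContinuousMap.starSubalgebra_topologicalClosure_eq_top_of_separatesPoints T hsep
  have hf : f ∈ T.topologicalClosure := by rw [htop]; trivial
  have hf' : f ∈ (T : Set C(S.adm, ℂ)) := by
    rw [← hT.closure_eq]
    exact hf
  exact hf' m hm

/-- The admissible coefficients `f` form a closed ideal of scalar functions, and such an ideal
consists of all functions vanishing on its zero set. Off `adm₀` a product `u x * v y` of functions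
vanishing on the two sets `X₀` shows that a point is not in the zero set. -/
theorem smul_θ_mem_image (i j : S.Λ.n) (k l : S.M.n) {f : C(S.adm, ℂ)}
    (hf : ∀ p ∈ S.adm₀, f p = 0) :
    f • (kroneckerFun (S.Λ.θ i j) (S.M.θ k l)).restrict S.adm ∈ S.image := by
  have hcl : IsClosed (S.image : Set C(S.adm, Matrix (S.Λ.n × S.M.n) (S.Λ.n × S.M.n) ℂ)) :=
    S.isClosed_image
  let I : Ideal C(S.adm, ℂ) :=
    { carrier := {f | f • (kroneckerFun (S.Λ.θ i j) (S.M.θ k l)).restrict S.adm ∈ S.image}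
      add_mem' := fun {f g} hf hg => by
        change (f + g) • (kroneckerFun (S.Λ.θ i j) (S.M.θ k l)).restrict S.adm ∈ S.image
        rw [add_smul_fun]
        exact add_mem hf hg
      zero_mem' := by
        change (0 : C(S.adm, ℂ)) • (kroneckerFun (S.Λ.θ i j) (S.M.θ k l)).restrict S.adm ∈ S.image
        have : (0 : C(S.adm, ℂ)) • (kroneckerFun (S.Λ.θ i j) (S.M.θ k l)).restrict S.adm = 0 := by
          ext p : 1
          exact zero_smul _ _
        rw [this]
        exact zero_mem _
      smul_mem' := fun f g hg => by
        change (f * g) • (kroneckerFun (S.Λ.θ i j) (S.M.θ k l)).restrict S.adm ∈ S.image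
        rw [mul_smul]
        exact S.smul_mem_image f hg }
  have hI : IsClosed (I : Set C(S.adm, ℂ)) := hcl.preimage
    (S.continuous_smul_fun.comp (continuous_id.prodMk continuous_const))
  have hIf : f ∈ ContinuousMap.idealOfSet ℂ (ContinuousMap.setOfIdeal I) := by
    rw [ContinuousMap.mem_idealOfSet]
    intro p hp
    refine hf p ?_
    by_contra hp0
    refine hp ?_
    rw [ContinuousMap.mem_setOfIdeal]
    have h1 : p.1.1 ∉ S.Λ.X₀ := fun h => hp0 (Or.inl h)
    have h2 : p.1.2 ∉ S.M.X₀ := fun h => hp0 (Or.inr h)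
    obtain ⟨u, hu, hu'⟩ := exists_eq_one_of_ne S.Λ.isClosed_X₀ h1
    obtain ⟨v, hv, hv'⟩ := exists_eq_one_of_ne S.M.isClosed_X₀ h2
    refine ⟨S.prodFun u v, ?_, mul_ne_zero hu hv⟩
    change S.prodFun u v • (kroneckerFun (S.Λ.θ i j) (S.M.θ k l)).restrict S.adm ∈ S.image
    rw [prodFun_smul]
    exact S.kroneckerFun_mem_image (S.Λ.adapted_smul_θ (S.Λ.mem_I.2 hu') i j)
      (S.M.adapted_smul_θ (S.M.mem_I.2 hv') k l)
  rw [ContinuousMap.idealOfSet_ofIdeal_isClosed hI] at hIf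
  exact hIf

theorem restrict_mul (f g : C(S.Λ.X × S.M.X, Matrix (S.Λ.n × S.M.n) (S.Λ.n × S.M.n) ℂ)) :
    (f * g).restrict S.adm = f.restrict S.adm * g.restrict S.adm := rfl

/-- This reduces surjectivity to `smul_θ_mem_image`: a function living under the projection `values
1` is a combination of the elementary tensors of compressed units, with its own entries as
coefficients. -/
theorem values_one_mul_mul (h : C(S.adm, Matrix (S.Λ.n × S.M.n) (S.Λ.n × S.M.n) ℂ)) :
    S.values 1 * h * S.values 1 = ∑ p, ∑ q, entry h p q •
      (kroneckerFun (S.Λ.θ p.1 q.1) (S.M.θ p.2 q.2)).restrict S.adm := by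
  have h1 : ∀ p q : S.Λ.n × S.M.n, (kroneckerFun (S.Λ.θ p.1 q.1) (S.M.θ p.2 q.2)).restrict S.adm
      = S.values 1 * ContinuousMap.const _ (Matrix.single p q 1) * S.values 1 := by
    intro p q
    rw [MatrixLayer.θ, MatrixLayer.θ, kroneckerFun_mul, kroneckerFun_mul, restrict_mul,
      restrict_mul, ← values_one]
    congr 2
    ext x : 1
    have h2 : Matrix.single p.1 q.1 (1 : ℂ) ⊗ₖ Matrix.single p.2 q.2 (1 : ℂ)
        = Matrix.single p q (1 : ℂ) := by
      rw [Matrix.single_kronecker_single, one_mul]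
    exact h2
  ext x : 1
  have : h x = ∑ i, ∑ j, h x i j • Matrix.single i j (1 : ℂ) := by
    conv_lhs => rw [Matrix.matrix_eq_sum_single (h x)]
    simp [Matrix.smul_single]
  simp only [h1]
  rw [ContinuousMap.mul_apply, ContinuousMap.mul_apply, this]
  simp only [ContinuousMap.sum_apply, ContinuousMap.smul_apply', entry_apply,
    ContinuousMap.mul_apply, ContinuousMap.const_apply, Finset.mul_sum, Finset.sum_mul,
    mul_smul_comm, smul_mul_assoc]

/-- The matrix values on the ideal generated by the two given ideals. -/
noncomputable def layer : MatrixLayer E where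
  X := S.adm
  n := S.Λ.n × S.M.n
  q := S.values
  X₀ := S.adm₀
  isClosed_X₀ := S.isClosed_adm₀
  J := S.ideal
  star_mem := fun _ hx => TwoSidedIdeal.star_mem_of_isClosed S.isClosed_ideal hx
  exact := fun h => by
    constructor
    · rintro ⟨x, hx, rfl⟩
      refine ⟨by rw [← map_mul, ← map_mul, one_mul, mul_one], ?_⟩
      have hc : ∀ p, Continuous fun x => S.values x p := fun p =>
        (continuous_eval_const _).comp (continuous_starHom S.values)
      refine S.ideal_induction (p := fun x => ∀ p ∈ S.adm₀, S.values x p = 0) ?_ ?_ ?_ ?_ ?_ hx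
      · simp only [Set.ofPred_forall]
        exact isClosed_biInter fun p _ => isClosed_eq (hc p) continuous_const
      · intro p _
        rw [map_zero]; rfl
      · intro x y hx hy p hp
        rw [map_add, ContinuousMap.add_apply, hx p hp, hy p hp, add_zero]
      · intro c x hx p hp
        rw [map_smul, ContinuousMap.smul_apply, hx p hp, smul_zero]
      · intro j hj k hk p hp
        rw [values_gen]
        change S.Λ.q j p.1.1 ⊗ₖ S.M.q k p.1.2 = 0
        rcases hp with hp | hp
        · rw [(MatrixLayer.adapted_of_mem hj).2 _ hp, Matrix.zero_kronecker]
        · rw [(MatrixLayer.adapted_of_mem hk).2 _ hp, Matrix.kronecker_zero]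
    · rintro ⟨h1, h2⟩
      have : h ∈ S.image := by
        rw [← h1, S.values_one_mul_mul]
        refine sum_mem fun p _ => sum_mem fun q _ => S.smul_θ_mem_image _ _ _ _ fun x hx => ?_
        rw [entry_apply, h2 x hx]; rfl
      exact this

end LayerPair

end LayerPairIdeal

end

/-! ### Recursive subhomogeneous algebras generated by two commuting ones. -/

section

open scoped Matrix.Norms.L2Operator Kronecker

section RSHTensor

/-- `A` has a recursive subhomogeneous decomposition of dimension at most `d`. -/
def RSHDimLE (A : Type u) [CStarAlgebra A] (d : ℕ) : Prop :=
  ∃ R : RSHDecomposition A, CoveringDimLE R.total.X d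

/-- The inductions end at the zero algebra, which is the algebra of functions on the empty space. -/
theorem RSHDimLE.of_subsingleton {A : Type u} [CStarAlgebra A] (h : (1 : A) = 0) (d : ℕ) :
    RSHDimLE A d := by
  have hA : ∀ a : A, a = 0 := fun a => by rw [← mul_one a, h, mul_zero]
  let e : A ≃⋆ₐ[ℂ] C(PEmpty.{u + 1}, Matrix (Fin 1) (Fin 1) ℂ) :=
    { toFun := fun _ => 0
      invFun := fun _ => 0
      left_inv := fun a => (hA a).symm
      right_inv := fun f => by ext x; exact x.elim
      map_mul' := fun _ _ => by ext x; exact x.elim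
      map_add' := fun _ _ => by ext x; exact x.elim
      map_star' := fun _ => by ext x; exact x.elim
      map_smul' := fun _ _ => by ext x; exact x.elim }
  exact ⟨.base PEmpty.{u + 1} 1 one_pos e, CoveringDimLE.of_isEmpty (X := PEmpty.{u + 1}) d⟩

/-- The star homomorphism that reindexes the values of matrix-valued functions. -/
noncomputable def reindexHom (X : Type*) [TopologicalSpace X] {n m : Type*} [Fintype n]
    [DecidableEq n] [Fintype m] [DecidableEq m] (e : n ≃ m) :
    C(X, Matrix n n ℂ) →⋆ₐ[ℂ] C(X, Matrix m m ℂ) where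
  toFun f := ⟨fun x => (f x).submatrix e.symm e.symm, f.continuous.matrix_submatrix _ _⟩
  map_one' := by ext x i j; simp
  map_mul' f g := by
    ext x : 1
    exact (Matrix.submatrix_mul_equiv _ _ _ _ _).symm
  map_zero' := rfl
  map_add' _ _ := rfl
  commutes' c := by
    ext x i j
    simp [Matrix.one_apply]
  map_star' _ := rfl

theorem reindexHom_apply (X : Type*) [TopologicalSpace X] {n m : Type*} [Fintype n]
    [DecidableEq n] [Fintype m] [DecidableEq m] (e : n ≃ m) (f : C(X, Matrix n n ℂ)) (x : X) :
    reindexHom X e f x = (f x).submatrix e.symm e.symm := rfl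

theorem reindexHom_symm (X : Type*) [TopologicalSpace X] {n m : Type*} [Fintype n]
    [DecidableEq n] [Fintype m] [DecidableEq m] (e : n ≃ m) (f : C(X, Matrix m m ℂ)) :
    reindexHom X e (reindexHom X e.symm f) = f := by
  ext x i j
  simp [reindexHom_apply]

theorem reindexHom_injective (X : Type*) [TopologicalSpace X] {n m : Type*} [Fintype n]
    [DecidableEq n] [Fintype m] [DecidableEq m] (e : n ≃ m) :
    Function.Injective (reindexHom X e) :=
  Function.LeftInverse.injective (g := reindexHom X e.symm) fun f => by
    ext x i j
    simp [reindexHom_apply]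

/-- Gluing matrix-valued functions to a recursive subhomogeneous quotient. -/
theorem RSHDimLE.step {A B : Type u} [CStarAlgebra A] [CStarAlgebra B] {d : ℕ} (hA : RSHDimLE A d)
    (X : Type u) [TopologicalSpace X] [CompactSpace X] [T2Space X] (hX : CoveringDimLE X d)
    (X₀ : Set X) (hX₀ : IsClosed X₀) {m : Type} [Fintype m] [DecidableEq m] [Nonempty m]
    (p : B →⋆ₐ[ℂ] A) (hp : Function.Surjective p) (q : B →⋆ₐ[ℂ] C(X, Matrix m m ℂ))
    (hinj : ∀ b, p b = 0 → q b = 0 → b = 0)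
    (hker : ∀ f, (∃ b, p b = 0 ∧ q b = f) ↔ ∀ x ∈ X₀, f x = 0) : RSHDimLE B d := by
  obtain ⟨R, hR⟩ := hA
  set n := Fintype.card m
  let e : m ≃ Fin n := Fintype.equivFin m
  let q' : B →⋆ₐ[ℂ] C(X, Matrix (Fin n) (Fin n) ℂ) := (reindexHom X e).comp q
  let r : C(X, Matrix (Fin n) (Fin n) ℂ) →⋆ₐ[ℂ] C(X₀, Matrix (Fin n) (Fin n) ℂ) :=
    { toFun := fun f => f.restrict X₀
      map_one' := rfl
      map_mul' := fun _ _ => rfl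
      map_zero' := rfl
      map_add' := fun _ _ => rfl
      commutes' := fun _ => rfl
      map_star' := fun _ => rfl }
  have hinj' : ∀ b, p b = 0 → q' b = 0 → b = 0 := fun b h1 h2 =>
    hinj b h1 (reindexHom_injective X e (by rw [map_zero]; exact h2))
  have hker' : ∀ f, (∃ b, p b = 0 ∧ q' b = f) ↔ ∀ x ∈ X₀, f x = 0 := by
    intro f
    constructor
    · rintro ⟨b, hb, rfl⟩ x hx
      change reindexHom X e (q b) x = 0
      rw [reindexHom_apply, (hker _).1 ⟨b, hb, rfl⟩ x hx]
      rfl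
    · intro hf
      obtain ⟨b, hb, hb'⟩ := (hker (reindexHom X e.symm f)).2 fun x hx => by
        rw [reindexHom_apply, hf x hx]; rfl
      refine ⟨b, hb, ?_⟩
      change reindexHom X e (q b) = f
      rw [hb', reindexHom_symm]
  -- The gluing map sends `p b` to the restriction of `q' b` to `X₀`; it is well defined because the
  -- kernel of `p` consists of functions vanishing there.
  obtain ⟨φ, hφ⟩ := exists_factor p hp (r.comp q') (fun b hb => by
    ext x : 1
    exact (hker' _).1 ⟨b, hb, rfl⟩ x x.2)
  refine ⟨RSHDecomposition.step R X X₀ hX₀ n Fintype.card_pos φ p q' ?_ ?_, ?_⟩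
  · intro b b' h
    rw [← sub_eq_zero]
    refine hinj' _ ?_ ?_
    · rw [map_sub, sub_eq_zero]; exact (Prod.ext_iff.1 h).1
    · rw [map_sub, sub_eq_zero]; exact (Prod.ext_iff.1 h).2
  · intro a f
    constructor
    · rintro ⟨b, rfl, rfl⟩
      exact hφ b
    · intro h
      obtain ⟨b, rfl⟩ := hp a
      rw [hφ] at h
      obtain ⟨b', hb', hq'⟩ := (hker' (f - q' b)).2 fun x hx => by
        rw [ContinuousMap.sub_apply, sub_eq_zero]
        exact (DFunLike.congr_fun h ⟨x, hx⟩).symm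
      exact ⟨b + b', by rw [map_add, hb', add_zero], by rw [map_add, hq', add_sub_cancel]⟩
  · exact CoveringDimLE.sum hR hX

/-- The kernel of a star homomorphism. -/
noncomputable def kerIdeal {A B : Type*} [CStarAlgebra A] [CStarAlgebra B] (p : A →⋆ₐ[ℂ] B) :
    TwoSidedIdeal A := TwoSidedIdeal.ker p

theorem mem_kerIdeal {A B : Type*} [CStarAlgebra A] [CStarAlgebra B] {p : A →⋆ₐ[ℂ] B} {a : A} :
    a ∈ kerIdeal p ↔ p a = 0 := TwoSidedIdeal.mem_ker p

/-- The layer of a unital homomorphism `q` that maps the kernel of `p` onto the functions vanishing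
on `X₀`. -/
noncomputable def MatrixLayer.ofKer {A A' : Type u} [CStarAlgebra A] [CStarAlgebra A'] (X : Type u)
    [TopologicalSpace X] [CompactSpace X] [T2Space X] (X₀ : Set X) (hX₀ : IsClosed X₀) (n : ℕ)
    (p : A →⋆ₐ[ℂ] A') (q : A →⋆ₐ[ℂ] C(X, Matrix (Fin n) (Fin n) ℂ))
    (hker : ∀ f, (∃ b, p b = 0 ∧ q b = f) ↔ ∀ x ∈ X₀, f x = 0) : MatrixLayer A where
  X := X
  n := Fin n
  q := (q : A →⋆ₙₐ[ℂ] C(X, Matrix (Fin n) (Fin n) ℂ))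
  X₀ := X₀
  isClosed_X₀ := hX₀
  J := kerIdeal p
  star_mem := fun j hj => by
    rw [mem_kerIdeal] at hj ⊢
    rw [map_star, hj, star_zero]
  exact := fun h => by
    have h1 : (q : A →⋆ₙₐ[ℂ] C(X, Matrix (Fin n) (Fin n) ℂ)) 1 = 1 := map_one q
    rw [h1, one_mul, mul_one, eq_self_iff_true, true_and, ← hker]
    exact ⟨fun ⟨j, hj, hj'⟩ => ⟨j, mem_kerIdeal.1 hj, hj'⟩,
      fun ⟨j, hj, hj'⟩ => ⟨j, mem_kerIdeal.2 hj, hj'⟩⟩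

/-- An algebra with a pair of layers is recursive subhomogeneous if its quotient by the ideal they
generate is. -/
theorem LayerPair.rshDimLE {A B E Q : Type u} [CStarAlgebra A] [CStarAlgebra B] [CStarAlgebra E]
    [CStarAlgebra Q] (S : LayerPair A B E) [Nonempty S.Λ.n] [Nonempty S.M.n] (hΛ : S.Λ.q 1 = 1)
    (hM : S.M.q 1 = 1) {a b : ℕ} (ha : CoveringDimLE S.Λ.X a) (hb : CoveringDimLE S.M.X b)
    (π : E →⋆ₐ[ℂ] Q) (hπ : Function.Surjective π) (hker : ∀ x, π x = 0 ↔ x ∈ S.ideal)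
    (hQ : RSHDimLE Q (a + b)) : RSHDimLE E (a + b) := by
  have h1 : S.values 1 = 1 := by
    rw [S.values_one, hΛ, hM]
    ext p : 1
    change (1 : Matrix S.Λ.n S.Λ.n ℂ) ⊗ₖ (1 : Matrix S.M.n S.M.n ℂ) = 1
    exact Matrix.one_kronecker_one
  let q : E →⋆ₐ[ℂ] C(S.adm, Matrix (S.Λ.n × S.M.n) (S.Λ.n × S.M.n) ℂ) :=
    { S.values with
      map_one' := h1
      commutes' := fun c => by
        change S.values (algebraMap ℂ E c) = algebraMap ℂ _ c
        rw [Algebra.algebraMap_eq_smul_one, map_smul, h1, ← Algebra.algebraMap_eq_smul_one] }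
  refine RSHDimLE.step hQ S.adm ((ha.prod hb).subtype_of_isClosed S.isClosed_adm) S.adm₀ S.isClosed_adm₀
    π hπ q (fun e he hq => S.eq_zero_of_values ((hker e).1 he) hq) fun f => ?_
  have := S.layer.exact f
  change (∃ j ∈ S.ideal, S.values j = f) ↔ (S.values 1 * f * S.values 1 = f ∧ _) at this
  rw [h1, one_mul, mul_one, eq_self_iff_true, true_and] at this
  rw [← show _ ↔ ∀ x ∈ S.adm₀, f x = 0 from this]
  exact ⟨fun ⟨j, hj, hj'⟩ => ⟨j, (hker j).1 hj, hj'⟩, fun ⟨j, hj, hj'⟩ => ⟨j, (hker j).2 hj, hj'⟩⟩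

/-- In a decomposition step, the projection to the first component of the pullback is
surjective. -/
theorem surjective_of_pullback {A B : Type u} [CStarAlgebra A] [CStarAlgebra B]
    (X : Type u) [TopologicalSpace X] [CompactSpace X] [T2Space X]
    (X₀ : Set X) (hX₀ : IsClosed X₀) (n : ℕ)
    (φ : A →⋆ₐ[ℂ] C(X₀, Matrix (Fin n) (Fin n) ℂ))
    (p : B →⋆ₐ[ℂ] A) (q : B →⋆ₐ[ℂ] C(X, Matrix (Fin n) (Fin n) ℂ))
    (hrange : ∀ (a : A) (f : C(X, Matrix (Fin n) (Fin n) ℂ)),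
      (∃ b : B, p b = a ∧ q b = f) ↔ φ a = f.restrict X₀) : Function.Surjective p := by
  intro a
  -- Tietze extension, entry by entry.
  have hext : ∀ i j, ∃ g : C(X, ℂ), ∀ x : X₀, g x = φ a x i j := by
    intro i j
    obtain ⟨g, hg⟩ := ContinuousMap.exists_restrict_eq hX₀ (entry (φ a) i j)
    exact ⟨g, fun x => DFunLike.congr_fun hg x⟩
  choose g hg using hext
  obtain ⟨b, hb, -⟩ := (hrange a ⟨fun x => Matrix.of fun i j => g i j x,
    continuous_matrix fun i j => (g i j).continuous⟩).2 (by
      ext x i j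
      exact (hg i j x).symm)
  exact ⟨b, hb⟩

theorem exists_ker_iff {A B : Type u} [CStarAlgebra A] [CStarAlgebra B]
    (X : Type u) [TopologicalSpace X] (X₀ : Set X) (n : ℕ)
    (φ : A →⋆ₐ[ℂ] C(X₀, Matrix (Fin n) (Fin n) ℂ))
    (p : B →⋆ₐ[ℂ] A) (q : B →⋆ₐ[ℂ] C(X, Matrix (Fin n) (Fin n) ℂ))
    (hrange : ∀ (a : A) (f : C(X, Matrix (Fin n) (Fin n) ℂ)),
      (∃ b : B, p b = a ∧ q b = f) ↔ φ a = f.restrict X₀) (f : C(X, Matrix (Fin n) (Fin n) ℂ)) :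
    (∃ b, p b = 0 ∧ q b = f) ↔ ∀ x ∈ X₀, f x = 0 := by
  rw [hrange, map_zero]
  constructor
  · intro h x hx
    exact (DFunLike.congr_fun h ⟨x, hx⟩).symm
  · intro h
    ext x : 1
    exact (h x x.2).symm

/-- The zero homomorphism, as a unital homomorphism to the zero algebra. -/
noncomputable def toZero (A : Type u) [CStarAlgebra A] :
    A →⋆ₐ[ℂ] C(PEmpty.{u + 1}, ℂ) where
  toFun _ := 0
  map_one' := by ext x; exact x.elim
  map_mul' _ _ := by ext x; exact x.elim
  map_zero' := rfl
  map_add' _ _ := by ext x; exact x.elim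
  commutes' _ := by ext x; exact x.elim
  map_star' _ := by ext x; exact x.elim

theorem dense_of_surjective {A A' B B' E E' : Type u} [CStarAlgebra A] [CStarAlgebra B]
    [CStarAlgebra A'] [CStarAlgebra B'] [CStarAlgebra E] [CStarAlgebra E']
    {α : A →⋆ₐ[ℂ] E} {β : B →⋆ₐ[ℂ] E} {comm : ∀ a b, Commute (α a) (β b)}
    (hd : DenseRange (mulMap α β comm)) (π : E →⋆ₐ[ℂ] E') (hπ : Function.Surjective π)
    {α' : A' →⋆ₐ[ℂ] E'} {β' : B' →⋆ₐ[ℂ] E'} (comm' : ∀ a b, Commute (α' a) (β' b))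
    (hα : ∀ a, ∃ a', α' a' = π (α a)) (hβ : ∀ b, ∃ b', β' b' = π (β b)) :
    DenseRange (mulMap α' β' comm') := by
  have h1 : DenseRange (π ∘ mulMap α β comm) := hπ.denseRange.comp hd
    (continuous_starHom (π : E →⋆ₙₐ[ℂ] E'))
  refine h1.mono ?_
  rintro _ ⟨t, rfl⟩
  rw [Function.comp_apply]
  induction t with
  | zero => exact ⟨0, by rw [map_zero, map_zero, map_zero]⟩
  | add x y hx hy =>
    obtain ⟨x', hx'⟩ := hx
    obtain ⟨y', hy'⟩ := hy
    exact ⟨x' + y', by rw [map_add, map_add, map_add, hx', hy']⟩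
  | tmul a b =>
    obtain ⟨a', ha⟩ := hα a
    obtain ⟨b', hb⟩ := hβ b
    exact ⟨a' ⊗ₜ b', by rw [mulMap_tmul, mulMap_tmul, map_mul, ha, hb]⟩

/-- The induction on the decomposition of the second factor. -/
theorem rshDimLE_of_layer {A B B' : Type u} [CStarAlgebra A] [CStarAlgebra B] [CStarAlgebra B']
    {a b : ℕ} (Λ : MatrixLayer A) [Nonempty Λ.n] (hΛ : Λ.q 1 = 1) (ha : CoveringDimLE Λ.X a)
    (hinj : ∀ j ∈ Λ.J, Λ.q j = 0 → j = 0)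
    (H : ∀ (E : Type u) [CStarAlgebra E] (α : A →⋆ₐ[ℂ] E) (β : B →⋆ₐ[ℂ] E)
      (comm : ∀ a b, Commute (α a) (β b)), DenseRange (mulMap α β comm) → (∀ j ∈ Λ.J, α j = 0) →
      RSHDimLE E (a + b))
    (R : RSHDecomposition B') (hR : CoveringDimLE R.total.X b) (σ : B →⋆ₐ[ℂ] B')
    (hσ : Function.Surjective σ) (E : Type u) [CStarAlgebra E] (α : A →⋆ₐ[ℂ] E) (β : B →⋆ₐ[ℂ] E)
    (comm : ∀ a b, Commute (α a) (β b)) (hd : DenseRange (mulMap α β comm))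
    (hkill : ∀ j ∈ Λ.J, ∀ k, σ k = 0 → α j * β k = 0) : RSHDimLE E (a + b) := by
  -- The invariant is that `Λ.J` annihilates the kernel of `σ`. It makes the values of the top layer
  -- of `B'` decide the products with `Λ.J`; dividing `E` by these products restores the invariant
  -- for the shorter decomposition and `p.comp σ`.
  induction R generalizing E with
  | @base B' _ Y _ _ _ n hn e =>
    have : Nonempty (Fin n) := ⟨⟨0, hn⟩⟩
    let M : MatrixLayer B := .ofKer Y ∅ isClosed_empty n (toZero B)
      ((e : B' →⋆ₐ[ℂ] C(Y, Matrix (Fin n) (Fin n) ℂ)).comp σ) fun f => by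
        refine ⟨fun _ x hx => hx.elim, fun _ => ?_⟩
        obtain ⟨k, hk⟩ := hσ (e.symm f)
        refine ⟨k, rfl, ?_⟩
        change e (σ k) = f
        rw [hk, e.apply_symm_apply]
    let S : LayerPair A B E :=
      { α := α, β := β, comm := comm, dense := hd, Λ := Λ, M := M
        kill_left := fun j hj h k _ => by rw [hinj j hj h, map_zero, zero_mul]
        kill_right := fun j hj k _ h => hkill j hj k (by
          have h' : e (σ k) = 0 := h
          exact (map_eq_zero_iff e e.injective).1 h') }
    obtain ⟨Q, _, π, hπ, hker⟩ := exists_quotient S.ideal S.isClosed_ideal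
    have : Nonempty S.Λ.n := ‹Nonempty Λ.n›
    have : Nonempty S.M.n := ‹Nonempty (Fin n)›
    have hM : S.M.q 1 = 1 := map_one ((e : B' →⋆ₐ[ℂ] C(Y, Matrix (Fin n) (Fin n) ℂ)).comp σ)
    refine S.rshDimLE hΛ hM ha hR π hπ hker ?_
    have comm' : ∀ a b, Commute ((π.comp α) a) ((π.comp β) b) := fun a b => (comm a b).map π
    -- The last layer of the second factor has all of `B` as its ideal, so its unit shows that `Λ.J`
    -- itself dies in the quotient.
    refine H Q (π.comp α) (π.comp β) comm'
      (dense_of_surjective hd π hπ comm' (fun a => ⟨a, rfl⟩) fun b => ⟨b, rfl⟩) fun j hj => ?_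
    change π (α j) = 0
    rw [hker, ← mul_one (α j), ← map_one β]
    exact S.mem_ideal (k := 1) hj (mem_kerIdeal.2 rfl)
  | @step A₁ B₁ _ _ R Y _ _ _ Y₀ hY₀ n hn φ p q hinj' hrange ih =>
    have : Nonempty (Fin n) := ⟨⟨0, hn⟩⟩
    have hp : Function.Surjective p := surjective_of_pullback Y Y₀ hY₀ n φ p q hrange
    let M : MatrixLayer B := .ofKer Y Y₀ hY₀ n (p.comp σ) (q.comp σ) fun f => by
        rw [← exists_ker_iff Y Y₀ n φ p q hrange f]
        constructor
        · rintro ⟨k, hk, hk'⟩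
          exact ⟨σ k, hk, hk'⟩
        · rintro ⟨k, hk, hk'⟩
          obtain ⟨k, rfl⟩ := hσ k
          exact ⟨k, hk, hk'⟩
    let S : LayerPair A B E :=
      { α := α, β := β, comm := comm, dense := hd, Λ := Λ, M := M
        kill_left := fun j hj h k _ => by rw [hinj j hj h, map_zero, zero_mul]
        kill_right := fun j hj k hk h => hkill j hj k (by
          have h1 : p (σ k) = 0 := (mem_kerIdeal (p := p.comp σ)).1 hk
          have h2 : q (σ k) = 0 := h
          exact hinj' (show (p (σ k), q (σ k)) = (p 0, q 0) by rw [h1, h2, map_zero, map_zero])) }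
    obtain ⟨Q, _, π, hπ, hker⟩ := exists_quotient S.ideal S.isClosed_ideal
    have : Nonempty S.Λ.n := ‹Nonempty Λ.n›
    have : Nonempty S.M.n := ‹Nonempty (Fin n)›
    have hM : S.M.q 1 = 1 := map_one (q.comp σ)
    have hR1 : CoveringDimLE R.total.X b := hR.of_isClosedEmbedding .inl
    have hR2 : CoveringDimLE Y b := hR.of_isClosedEmbedding .inr
    refine S.rshDimLE hΛ hM ha hR2 π hπ hker ?_
    have comm' : ∀ a b, Commute ((π.comp α) a) ((π.comp β) b) := fun a b => (comm a b).map π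
    refine ih hR1 (p.comp σ) (hp.comp hσ) Q (π.comp α) (π.comp β) comm'
      (dense_of_surjective hd π hπ comm' (fun a => ⟨a, rfl⟩) fun b => ⟨b, rfl⟩) fun j hj k hk => ?_
    change π (α j) * π (β k) = 0
    rw [← map_mul, hker]
    exact S.mem_ideal hj (mem_kerIdeal.2 hk)

/-- The C*-algebra generated by commuting images of recursive subhomogeneous algebras is recursive
subhomogeneous. -/
theorem RSHDimLE.tensor {A B E : Type u} [CStarAlgebra A] [CStarAlgebra B] [CStarAlgebra E] {a b : ℕ}
    (hA : RSHDimLE A a) (hB : RSHDimLE B b) (α : A →⋆ₐ[ℂ] E) (β : B →⋆ₐ[ℂ] E)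
    (comm : ∀ a b, Commute (α a) (β b)) (hd : DenseRange (mulMap α β comm)) :
    RSHDimLE E (a + b) := by
  obtain ⟨R, hR⟩ := hA
  obtain ⟨R', hR'⟩ := hB
  -- For the top layer of the first factor, all layers of the second are processed by
  -- `rshDimLE_of_layer`. In the final quotient the layer has died, so the first map factors through
  -- the algebra with the shorter decomposition.
  induction R generalizing E with
  | @base A _ X _ _ _ n hn e =>
    have : Nonempty (Fin n) := ⟨⟨0, hn⟩⟩
    let Λ : MatrixLayer A := .ofKer X ∅ isClosed_empty n (toZero A)
      (e : A →⋆ₐ[ℂ] C(X, Matrix (Fin n) (Fin n) ℂ)) fun f =>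
        ⟨fun _ x hx => hx.elim, fun _ => ⟨e.symm f, rfl, e.apply_symm_apply f⟩⟩
    have : Nonempty Λ.n := ‹Nonempty (Fin n)›
    refine rshDimLE_of_layer Λ (map_one e) hR (fun j _ h => ?_) ?_ R' hR' (.id ℂ B)
      Function.surjective_id E α β comm hd ?_
    · exact (map_eq_zero_iff e e.injective).1 h
    · intro E₂ _ α₂ β₂ _ _ h
      refine RSHDimLE.of_subsingleton ?_ _
      rw [← map_one α₂]
      exact h 1 (mem_kerIdeal.2 rfl)
    · intro j _ k hk
      have hk : k = 0 := hk
      rw [hk, map_zero, mul_zero]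
  | @step A₁ B₁ _ _ R X _ _ _ X₀ hX₀ n hn φ p q hinj hrange ih =>
    have : Nonempty (Fin n) := ⟨⟨0, hn⟩⟩
    have hp : Function.Surjective p := surjective_of_pullback X X₀ hX₀ n φ p q hrange
    let Λ : MatrixLayer B₁ := .ofKer X X₀ hX₀ n p q (exists_ker_iff X X₀ n φ p q hrange)
    have : Nonempty Λ.n := ‹Nonempty (Fin n)›
    have hR1 : CoveringDimLE R.total.X a := hR.of_isClosedEmbedding .inl
    have hR2 : CoveringDimLE X a := hR.of_isClosedEmbedding .inr
    refine rshDimLE_of_layer Λ (map_one q) hR2 (fun j hj h => ?_) ?_ R' hR' (.id ℂ B)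
      Function.surjective_id E α β comm hd ?_
    · have h1 : p j = 0 := mem_kerIdeal.1 hj
      have h2 : q j = 0 := h
      exact hinj (show (p j, q j) = (p 0, q 0) by rw [h1, h2, map_zero, map_zero])
    · intro E₂ _ α₂ β₂ comm₂ hd₂ h
      obtain ⟨α₃, hα₃⟩ := exists_factor p hp α₂ fun b hb => h b (mem_kerIdeal.2 hb)
      have comm₃ : ∀ a b, Commute (α₃ a) (β₂ b) := fun a b => by
        obtain ⟨a, rfl⟩ := hp a
        rw [hα₃]
        exact comm₂ a b
      exact ih α₃ β₂ comm₃ (dense_of_surjective hd₂ (.id ℂ E₂) Function.surjective_id comm₃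
        (fun a => ⟨p a, hα₃ a⟩) fun b => ⟨b, rfl⟩) hR1
    · intro j _ k hk
      have hk : k = 0 := hk
      rw [hk, map_zero, mul_zero]

end RSHTensor

end

/-! ### Homogeneous algebras generated by two commuting ones. -/

section

open scoped Matrix.Norms.L2Operator Kronecker

section HomogeneousTensor

/-- `A` has a homogeneous decomposition over spaces of dimension at most `d`, with projections that
vanish nowhere. -/
def HomogeneousDimLE (A : Type u) [CStarAlgebra A] (d : ℕ) : Prop :=
  ∃ H : HomogeneousDecomposition A, ∀ t, CoveringDimLE (H.X t) d ∧ ∀ x, H.P t x ≠ 0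

theorem HomogeneousDecomposition.coord_one {A : Type u} [CStarAlgebra A]
    (H : HomogeneousDecomposition A) (t : Fin H.r) : H.coord t 1 = H.P t := by
  have hP : ∀ t, H.P t * H.P t = H.P t := fun t => (H.isStarProjection_P t).isIdempotentElem
  obtain ⟨a, ha⟩ := (H.range_eq H.P).2 fun t => by rw [hP, hP]
  have h1 : a = 1 := by
    rw [← mul_one a]
    refine H.injective (funext fun t => ?_)
    change H.coord t (a * 1) = H.coord t 1
    rw [map_mul, ha]
    have := (H.range_eq fun t => H.coord t 1).1 ⟨1, fun _ => rfl⟩ t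
    rw [← this, ← mul_assoc, ← mul_assoc, hP]
  rw [← h1, ha]

/-- Homogeneous decompositions from finite families of homomorphisms. -/
theorem HomogeneousDecomposition.exists_of_family {A : Type u} [CStarAlgebra A]
    {Q : (X : Type u) → [TopologicalSpace X] → Prop} {ι : Type} [Fintype ι]
    (X : ι → Type u) [∀ i, TopologicalSpace (X i)] [∀ i, CompactSpace (X i)]
    [∀ i, TopologicalSpace.MetrizableSpace (X i)] (n : ι → Type) [∀ i, Fintype (n i)]
    [∀ i, DecidableEq (n i)] (q : ∀ i, A →⋆ₙₐ[ℂ] C(X i, Matrix (n i) (n i) ℂ))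
    (hinj : ∀ a, (∀ i, q i a = 0) → a = 0)
    (hrange : ∀ f : (∀ i, C(X i, Matrix (n i) (n i) ℂ)), (∀ i, q i 1 * f i * q i 1 = f i) →
      ∃ a, ∀ i, q i a = f i)
    (hQ : ∀ i, Q (X i)) (hne : ∀ i x, q i 1 x ≠ 0) :
    ∃ H : HomogeneousDecomposition A, ∀ t, Q (H.X t) ∧ ∀ x, H.P t x ≠ 0 := by
  let e := Fintype.equivFin ι
  let ν : ∀ i, n i ≃ Fin (Fintype.card (n i)) := fun i => Fintype.equivFin (n i)
  let ρ : ∀ i, C(X i, Matrix (n i) (n i) ℂ) →⋆ₐ[ℂ]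
    C(X i, Matrix (Fin (Fintype.card (n i))) (Fin (Fintype.card (n i))) ℂ) :=
    fun i => reindexHom (X i) (ν i)
  let ρ' : ∀ i, C(X i, Matrix (Fin (Fintype.card (n i))) (Fin (Fintype.card (n i))) ℂ) →⋆ₐ[ℂ]
    C(X i, Matrix (n i) (n i) ℂ) := fun i => reindexHom (X i) (ν i).symm
  have hρ : ∀ i f, ρ i (ρ' i f) = f := fun i f => reindexHom_symm (X i) (ν i) f
  have hρinj : ∀ i, Function.Injective (ρ i) := fun i => reindexHom_injective (X i) (ν i)
  have hP : ∀ i, IsStarProjection (ρ i (q i 1)) := fun i => by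
    refine ⟨?_, ?_⟩
    · change ρ i (q i 1) * ρ i (q i 1) = ρ i (q i 1)
      rw [← map_mul, ← map_mul, one_mul]
    · change star (ρ i (q i 1)) = ρ i (q i 1)
      rw [← map_star, ← map_star, star_one]
  refine ⟨{ r := Fintype.card ι
            X := fun t => X (e.symm t)
            m := fun t => Fintype.card (n (e.symm t))
            P := fun t => ρ _ (q (e.symm t) 1)
            isStarProjection_P := fun t => hP _
            coord := fun t => (ρ (e.symm t) : _ →⋆ₙₐ[ℂ] _).comp (q (e.symm t))
            injective := ?_
            range_eq := ?_ }, fun t => ⟨hQ _, fun x hx => hne (e.symm t) x ?_⟩⟩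
  · intro a b hab
    rw [← sub_eq_zero]
    refine hinj _ fun i => ?_
    obtain ⟨t, rfl⟩ := e.symm.surjective i
    have h1 : ρ (e.symm t) (q (e.symm t) a) = ρ (e.symm t) (q (e.symm t) b) := congrFun hab t
    rw [map_sub, hρinj _ h1, sub_self]
  · intro f
    constructor
    · rintro ⟨a, ha⟩ t
      rw [← ha t]
      change ρ _ (q _ 1) * ρ _ (q _ a) * ρ _ (q _ 1) = ρ _ (q _ a)
      rw [← map_mul, ← map_mul, ← map_mul, ← map_mul, one_mul, mul_one]
    · intro hf
      let g : ∀ i, C(X i, Matrix (Fin (Fintype.card (n i))) (Fin (Fintype.card (n i))) ℂ) :=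
        fun i => e.symm_apply_apply i ▸ f (e i)
      have hg : ∀ t, g (e.symm t) = f t := by
        intro t
        have : ∀ (u : Fin (Fintype.card ι)) (h : e.symm u = e.symm t),
          (h ▸ f u : C(X (e.symm t), Matrix (Fin (Fintype.card (n (e.symm t))))
            (Fin (Fintype.card (n (e.symm t)))) ℂ)) = f t := by
          intro u h
          obtain rfl := e.symm.injective h
          rfl
        exact this _ _
      obtain ⟨a, ha⟩ := hrange (fun i => ρ' i (g i)) fun i => by
        obtain ⟨t, rfl⟩ := e.symm.surjective i
        refine hρinj _ ?_
        rw [map_mul, map_mul, hρ, hg]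
        exact hf t
      refine ⟨a, fun t => ?_⟩
      change ρ _ (q (e.symm t) a) = f t
      rw [ha, hρ, hg]
  · have h1 : (q (e.symm t) 1 x).submatrix (ν _).symm (ν _).symm = 0 := hx
    ext i j
    have := congrFun (congrFun h1 (ν _ i)) (ν _ j)
    simpa using this

namespace HomogeneousDecomposition

variable {A : Type u} [CStarAlgebra A] (H : HomogeneousDecomposition A)

/-- A direct summand of a homogeneous decomposition, as an ideal. -/
noncomputable def summand (t : Fin H.r) : TwoSidedIdeal A :=
  TwoSidedIdeal.mk' {a | ∀ t', t' ≠ t → H.coord t' a = 0} (fun _ _ => map_zero _)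
    (fun hx hy t' ht => by rw [map_add, hx t' ht, hy t' ht, add_zero])
    (fun hx t' ht => by rw [map_neg, hx t' ht, neg_zero])
    (fun hy t' ht => by rw [map_mul, hy t' ht, mul_zero])
    (fun hx t' ht => by rw [map_mul, hx t' ht, zero_mul])

theorem mem_summand {t : Fin H.r} {a : A} : a ∈ H.summand t ↔ ∀ t', t' ≠ t → H.coord t' a = 0 :=
  TwoSidedIdeal.mem_mk' _ _ _ _ _ _ _

theorem exists_mem_summand (t : Fin H.r) (f : C(H.X t, Matrix (Fin (H.m t)) (Fin (H.m t)) ℂ))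
    (hf : H.P t * f * H.P t = f) : ∃ a ∈ H.summand t, H.coord t a = f := by
  obtain ⟨a, ha⟩ := (H.range_eq (Pi.single t f)).2 fun t' => by
    by_cases h : t' = t
    · subst h
      rw [Pi.single_eq_same, hf]
    · rw [Pi.single_eq_of_ne h, mul_zero, zero_mul]
  refine ⟨a, H.mem_summand.2 fun t' h => ?_, ?_⟩
  · rw [ha, Pi.single_eq_of_ne h]
  · rw [ha, Pi.single_eq_same]

/-- The layer of a direct summand. -/
noncomputable def layer (t : Fin H.r) : MatrixLayer A where
  X := H.X t
  n := Fin (H.m t)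
  q := H.coord t
  X₀ := ∅
  isClosed_X₀ := isClosed_empty
  J := H.summand t
  star_mem := fun j hj => by
    rw [mem_summand] at hj ⊢
    intro t' ht
    rw [map_star, hj t' ht, star_zero]
  exact := fun h => by
    rw [H.coord_one]
    constructor
    · rintro ⟨j, -, rfl⟩
      refine ⟨(H.range_eq fun t => H.coord t j).1 ⟨j, fun _ => rfl⟩ t, fun x hx => hx.elim⟩
    · rintro ⟨hh, -⟩
      exact H.exists_mem_summand t h hh

/-- The unit of a direct summand. -/
theorem exists_unit : ∃ e : Fin H.r → A, (∀ t, e t ∈ H.summand t) ∧ (∀ t, H.coord t (e t) = H.P t) ∧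
    ∑ t, e t = 1 := by
  have hP : ∀ t, H.P t * H.P t = H.P t := fun t => (H.isStarProjection_P t).isIdempotentElem
  choose e he he' using fun t => H.exists_mem_summand t (H.P t) (by rw [hP, hP])
  refine ⟨e, he, he', H.injective (funext fun t => ?_)⟩
  change H.coord t _ = H.coord t 1
  rw [map_sum, H.coord_one, Finset.sum_eq_single t, he']
  · intro t' _ h
    exact H.mem_summand.1 (he t') t (Ne.symm h)
  · intro h
    exact absurd (Finset.mem_univ t) h

theorem eq_zero_of_mem_summand {t : Fin H.r} {a : A} (ha : a ∈ H.summand t) (h : H.coord t a = 0) :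
    a = 0 := by
  refine H.injective (funext fun t' => ?_)
  change H.coord t' a = H.coord t' 0
  rw [map_zero]
  by_cases ht : t' = t
  · subst ht
    exact h
  · exact H.mem_summand.1 ha t' ht

end HomogeneousDecomposition

/-- The C*-algebra generated by commuting images of homogeneous algebras is homogeneous. -/
theorem HomogeneousDimLE.tensor {A B E : Type u} [CStarAlgebra A] [CStarAlgebra B] [CStarAlgebra E]
    {a b : ℕ} (hA : HomogeneousDimLE A a) (hB : HomogeneousDimLE B b) (α : A →⋆ₐ[ℂ] E)
    (β : B →⋆ₐ[ℂ] E) (comm : ∀ a b, Commute (α a) (β b)) (hd : DenseRange (mulMap α β comm)) :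
    HomogeneousDimLE E (a + b) := by
  obtain ⟨H, hH⟩ := hA
  obtain ⟨K, hK⟩ := hB
  -- One pair of layers for each pair of summands. No gluing is needed: these layers have `X₀ = ∅`,
  -- and a coordinate map is injective on its own summand.
  let S : Fin H.r × Fin K.r → LayerPair A B E := fun p =>
    { α := α, β := β, comm := comm, dense := hd, Λ := H.layer p.1, M := K.layer p.2
      kill_left := fun j hj h k _ => by
        rw [H.eq_zero_of_mem_summand hj h, map_zero, zero_mul]
      kill_right := fun j _ k hk h => by
        rw [K.eq_zero_of_mem_summand hk h, map_zero, mul_zero] }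
  have hm1 : ∀ p, TopologicalSpace.MetrizableSpace (S p).Λ.X := fun p => H.metrizable p.1
  have hm2 : ∀ p, TopologicalSpace.MetrizableSpace (S p).M.X := fun p => K.metrizable p.2
  have hc : ∀ p, CompactSpace (S p).adm := fun p =>
    isCompact_iff_compactSpace.1 (S p).isClosed_adm.isCompact
  have hm : ∀ p, TopologicalSpace.MetrizableSpace (S p).adm := fun p => inferInstance
  refine HomogeneousDecomposition.exists_of_family (Q := fun X _ => CoveringDimLE X (a + b))
    (fun p => (S p).adm) (fun p => (S p).Λ.n × (S p).M.n)
    (fun p => (S p).values) ?_ ?_ ?_ ?_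
  · intro x hx
    obtain ⟨e, he, -, he1⟩ := H.exists_unit
    obtain ⟨f, hf, -, hf1⟩ := K.exists_unit
    have h1 : α 1 * β 1 = 1 := by rw [map_one, map_one, one_mul]
    -- The unit of `E` is the sum of the products of the units of the summands, and an element
    -- without values is annihilated by each of these.
    rw [← one_mul x, ← h1, ← he1, ← hf1, map_sum, map_sum, Finset.sum_mul_sum, Finset.sum_mul]
    refine Finset.sum_eq_zero fun t _ => ?_
    rw [Finset.sum_mul]
    exact Finset.sum_eq_zero fun s _ => (S (t, s)).gen_mul_eq_zero (hx (t, s)) (he t) (hf s)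
  · intro f hf
    have h1 : ∀ p, ∃ x ∈ (S p).ideal, (S p).values x = f p := fun p =>
      ((S p).layer.exact (f p)).2 ⟨hf p, fun x hx => by
        rcases hx with hx | hx
        · exact hx.elim
        · exact hx.elim⟩
    choose x hx hxf using h1
    refine ⟨∑ p, x p, fun p => ?_⟩
    rw [map_sum, Finset.sum_eq_single p, hxf]
    -- Different pairs of summands do not interact: on the ideal of `p'` the values over `p` vanish,
    -- because one of the two Kronecker factors of each generator does.
    · intro p' _ hne
      refine (S p').ideal_induction (p := fun x => (S p).values x = 0)
        (isClosed_eq (continuous_starHom _) continuous_const) (map_zero _)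
        (fun x y hx hy => by rw [map_add, hx, hy, add_zero])
        (fun c x hx => by
          rw [map_smul, hx]
          ext y i j
          simp) (fun j hj k hk => ?_) (hx p')
      have h2 : (S p).values (α j * β k) = _ := (S p).values_gen j k
      change (S p).values (α j * β k) = 0
      rw [h2]
      ext y : 1
      change H.coord p.1 j y.1.1 ⊗ₖ K.coord p.2 k y.1.2 = 0
      by_cases h : p.1 = p'.1
      · have h' : p.2 ≠ p'.2 := fun h' => hne (Prod.ext h h').symm
        rw [K.mem_summand.1 hk _ h']
        exact Matrix.kronecker_zero _
      · rw [H.mem_summand.1 hj _ h]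
        exact Matrix.zero_kronecker _
    · intro h
      exact absurd (Finset.mem_univ p) h
  · intro p
    exact ((hH p.1).1.prod (hK p.2).1).subtype_of_isClosed (S p).isClosed_adm
  · intro p y h
    rw [(S p).values_one] at h
    have h : (S p).Λ.q 1 y.1.1 ⊗ₖ (S p).M.q 1 y.1.2 = 0 := h
    have h1 : (S p).Λ.q 1 y.1.1 ≠ 0 := fun h0 => by
      have := y.2.1.1
      rw [h0, norm_zero] at this
      exact zero_ne_one this
    have h2 : (S p).M.q 1 y.1.2 ≠ 0 := fun h0 => by
      have := y.2.1.2
      rw [h0, norm_zero] at this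
      exact zero_ne_one this
    obtain ⟨i, j, hij⟩ : ∃ i j, (S p).Λ.q 1 y.1.1 i j ≠ 0 := by
      by_contra! h0
      exact h1 (Matrix.ext h0)
    obtain ⟨k, l, hkl⟩ : ∃ i j, (S p).M.q 1 y.1.2 i j ≠ 0 := by
      by_contra! h0
      exact h2 (Matrix.ext h0)
    exact mul_ne_zero hij hkl (congrFun (congrFun h (i, k)) (j, l))

end HomogeneousTensor

end

/-! ### Slice maps of characters on minimal tensor products. -/

section MinTensor

theorem IsMinTensorProduct.commute {A B E : Type u} [CStarAlgebra A] [CStarAlgebra B] [CStarAlgebra E]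
    {ιA : A →⋆ₐ[ℂ] E} {ιB : B →⋆ₐ[ℂ] E} (h : IsMinTensorProduct A B E ιA ιB) (a : A) (b : B) :
    Commute (ιA a) (ιB b) := by
  obtain ⟨-, H, K, _, _, _, _, _, _, π, ρ, Θ, -, -, hΘ, hA, hB⟩ := h
  refine hΘ ?_
  have key : ∀ z : H ⊗[ℂ] K, Θ (ιA a * ιB b) (z : HilbertTensor H K)
      = Θ (ιB b * ιA a) (z : HilbertTensor H K) := by
    intro z
    induction z with
    | zero => rw [UniformSpace.Completion.coe_zero, map_zero, map_zero]
    | add x y hx hy => rw [UniformSpace.Completion.coe_add, map_add, map_add, hx, hy]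
    | tmul x y =>
      rw [map_mul, map_mul, mul_apply_eq_comp, mul_apply_eq_comp, hA, hB, hA,
        hB]
  ext z
  exact UniformSpace.Completion.induction_on z
    (isClosed_eq (ContinuousLinearMap.continuous _) (ContinuousLinearMap.continuous _)) key

theorem IsMinTensorProduct.denseRange {A B E : Type u} [CStarAlgebra A] [CStarAlgebra B]
    [CStarAlgebra E] {ιA : A →⋆ₐ[ℂ] E} {ιB : B →⋆ₐ[ℂ] E} (h : IsMinTensorProduct A B E ιA ιB) :
    DenseRange (mulMap ιA ιB h.commute) := by
  refine h.1.mono fun x hx => ?_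
  induction hx using Submodule.span_induction with
  | zero => exact ⟨0, map_zero _⟩
  | add x y _ _ hx hy =>
    obtain ⟨s, rfl⟩ := hx
    obtain ⟨t, rfl⟩ := hy
    exact ⟨s + t, map_add _ _ _⟩
  | smul c x _ hx =>
    obtain ⟨s, rfl⟩ := hx
    exact ⟨c • s, map_smul _ _ _⟩
  | mem x hx =>
    obtain ⟨a, b, rfl⟩ := hx
    exact ⟨a ⊗ₜ b, mulMap_tmul _ _ _ a b⟩

/-- Approximate eigenvectors for finitely many elements on which a character vanishes. -/
theorem exists_approx_kernel {D H : Type*} [CStarAlgebra D] [NormedAddCommGroup H]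
    [InnerProductSpace ℂ H] [CompleteSpace H] (π : D →⋆ₐ[ℂ] (H →L[ℂ] H)) (hπ : Function.Injective π)
    (χ : D →⋆ₐ[ℂ] ℂ) {ι : Type*} (s : Finset ι) (c : ι → D) (hc : ∀ i ∈ s, χ (c i) = 0) {ε : ℝ}
    (hε : 0 < ε) : ∃ h : H, ‖h‖ ≠ 0 ∧ ∀ i ∈ s, ‖π (c i) h‖ ≤ ε * ‖h‖ := by
  -- `χ y = 0`, while `1 - w` is a multiple of `star y * y`; hence `χ w = 1` and `w` has norm at
  -- least `1`. Vectors in the range of `π w` are nearly killed by `π y`, so by each `π (c i)`,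
  -- since `⟪h, π y h⟫` is the sum of the `‖π (c i) h‖ ^ 2`.
  set y : D := ∑ i ∈ s, star (c i) * c i with hy
  have hχy : χ y = 0 := by
    rw [hy, map_sum]
    refine Finset.sum_eq_zero fun i hi => ?_
    rw [map_mul, hc i hi, mul_zero]
  obtain ⟨w, g, -, hw, hyw, hg⟩ := exists_cutoff y (ε := ε ^ 2 / 2) (by positivity)
  have hχw : χ w = 1 := by
    have h1 : χ (1 - w) = 0 := by rw [hg, map_mul, map_mul, hχy, mul_zero, mul_zero]
    rw [map_sub, map_one, sub_eq_zero] at h1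
    exact h1.symm
  have hw1 : 1 ≤ ‖w‖ := by
    have := NonUnitalStarAlgHom.norm_apply_le χ w
    rwa [hχw, norm_one] at this
  have hπw : 1 / 2 < ‖π w‖ := by
    rw [NonUnitalStarAlgHom.norm_map π hπ]
    linarith
  obtain ⟨h₀, hh₀⟩ : ∃ x, 1 / 2 * ‖x‖ < ‖π w x‖ := by
    by_contra! hcon
    exact absurd (ContinuousLinearMap.opNorm_le_bound _ (by norm_num) hcon) (not_le.2 hπw)
  set h := π w h₀ with hh
  have hpos : 0 < ‖h‖ := lt_of_le_of_lt (by positivity) hh₀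
  refine ⟨h, hpos.ne', fun i hi => ?_⟩
  have h1 : ‖π y h‖ ≤ ε ^ 2 * ‖h‖ := by
    have e1 : π y h = π (y * w) h₀ := by rw [map_mul, mul_apply_eq_comp]
    calc ‖π y h‖ ≤ ‖π (y * w)‖ * ‖h₀‖ := by rw [e1]; exact ContinuousLinearMap.le_opNorm _ _
      _ ≤ ε ^ 2 / 2 * ‖h₀‖ := by
        gcongr
        exact (NonUnitalStarAlgHom.norm_apply_le π _).trans hyw
      _ ≤ ε ^ 2 * ‖h‖ := by nlinarith [sq_nonneg ε, mul_le_mul_of_nonneg_left hh₀.le (sq_nonneg ε)]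
  have h2 : ∀ j, (inner ℂ h (π (star (c j) * c j) h) : ℂ).re = ‖π (c j) h‖ ^ 2 := by
    intro j
    rw [map_mul, map_star, mul_apply_eq_comp, ContinuousLinearMap.star_eq_adjoint,
      ContinuousLinearMap.adjoint_inner_right, inner_self_eq_norm_sq_to_K]
    norm_cast
  have h3 : (inner ℂ h (π y h) : ℂ).re = ∑ j ∈ s, ‖π (c j) h‖ ^ 2 := by
    rw [hy, map_sum, sum_apply, inner_sum, Complex.re_sum]
    exact Finset.sum_congr rfl fun j _ => h2 j
  have h4 : (inner ℂ h (π y h) : ℂ).re ≤ ‖h‖ * ‖π y h‖ :=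
    (Complex.re_le_norm _).trans (norm_inner_le_norm _ _)
  have h5 : ‖π (c i) h‖ ^ 2 ≤ ∑ j ∈ s, ‖π (c j) h‖ ^ 2 :=
    Finset.single_le_sum (f := fun j => ‖π (c j) h‖ ^ 2) (fun _ _ => by positivity) hi
  refine le_of_sq_le_sq ?_ (by positivity)
  calc ‖π (c i) h‖ ^ 2 ≤ ‖h‖ * ‖π y h‖ := by linarith
    _ ≤ ‖h‖ * (ε ^ 2 * ‖h‖) := by gcongr
    _ = (ε * ‖h‖) ^ 2 := by ring

/-- The slice map of a character. -/
theorem IsMinTensorProduct.exists_slice {A B E : Type u} [CStarAlgebra A] [CStarAlgebra B]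
    [CStarAlgebra E] {ιA : A →⋆ₐ[ℂ] E} {ιB : B →⋆ₐ[ℂ] E} (h : IsMinTensorProduct A B E ιA ιB)
    (χ : A →⋆ₐ[ℂ] ℂ) : ∃ s : E →⋆ₙₐ[ℂ] B, ∀ a b, s (ιA a * ιB b) = χ a • b := by
  have hcomm := h.commute
  have hdense : DenseRange (mulMap ιA ιB hcomm) := h.denseRange
  obtain ⟨-, H, K, _, _, _, _, _, _, π, ρ, Θ, hπ, hρ, hΘ, hA, hB⟩ := h
  let χ' : A →⋆ₐ[ℂ] B :=
    { toFun := fun a => algebraMap ℂ B (χ a)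
      map_one' := by rw [map_one, map_one]
      map_mul' := fun a b => by rw [map_mul, map_mul]
      map_zero' := by rw [map_zero, map_zero]
      map_add' := fun a b => by rw [map_add, map_add]
      commutes' := fun c => by rw [AlgHomClass.commutes]; rfl
      map_star' := fun a => by rw [map_star, algebraMap_star_comm] }
  let s₀ := mulMap χ' (StarAlgHom.id ℂ B) fun a b => Algebra.commutes (χ a) b
  have hs₀ : ∀ a b, s₀ (a ⊗ₜ b) = χ a • b := fun a b => by
    rw [Algebra.smul_def]
    exact mulMap_tmul χ' (StarAlgHom.id ℂ B) _ a b
  obtain ⟨g, hg⟩ := exists_extension (mulMap ιA ιB hcomm) hdense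
    (s₀ : A ⊗[ℂ] B →⋆ₙₐ[ℂ] B) 1 fun t => by
      change ‖s₀ t‖ ≤ _
      rw [one_mul, ← NonUnitalStarAlgHom.norm_map ρ hρ]
      refine ContinuousLinearMap.opNorm_le_bound _ (norm_nonneg _) fun k => ?_
      obtain ⟨S, rfl⟩ := TensorProduct.exists_finset t
      set t := ∑ i ∈ S, i.1 ⊗ₜ[ℂ] i.2 with ht
      set C := (∑ i ∈ S, ‖ρ i.2 k‖) with hC
      have hC0 : 0 ≤ C := Finset.sum_nonneg fun _ _ => norm_nonneg _
      refine le_of_forall_pos_le_add fun δ hδ => ?_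
      -- On `x` the left legs of `t` act almost as the scalars given by `χ`. So the operator of `t`
      -- maps `x ⊗ k` close to `x ⊗ ρ (s₀ t) k`, and the norm of `t` bounds that of its slice.
      obtain ⟨x, hx0, hx⟩ := exists_approx_kernel π hπ χ S (fun i => i.1 - algebraMap ℂ A (χ i.1))
        (fun i _ => by rw [map_sub, AlgHomClass.commutes]; exact sub_self _)
        (ε := δ / (C + 1)) (by positivity)
      have hxp : 0 < ‖x‖ := lt_of_le_of_ne (norm_nonneg _) (Ne.symm hx0)
      have e1 : Θ (mulMap ιA ιB hcomm t) ((x ⊗ₜ[ℂ] k : H ⊗[ℂ] K) : HilbertTensor H K)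
          = ((∑ i ∈ S, π i.1 x ⊗ₜ[ℂ] ρ i.2 k : H ⊗[ℂ] K) : HilbertTensor H K) := by
        have hsum : ∀ f : A × B → H ⊗[ℂ] K, ((∑ i ∈ S, f i : H ⊗[ℂ] K) : HilbertTensor H K)
            = ∑ i ∈ S, (f i : HilbertTensor H K) := fun f =>
          map_sum (UniformSpace.Completion.toComplₗᵢ (𝕜 := ℂ) (E := H ⊗[ℂ] K)) f S
        rw [hsum, ht, map_sum, map_sum, sum_apply]
        refine Finset.sum_congr rfl fun i _ => ?_
        rw [mulMap_tmul, map_mul, mul_apply_eq_comp, hB, hA]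
      have e2 : ρ (s₀ t) k = ∑ i ∈ S, χ i.1 • ρ i.2 k := by
        rw [ht, map_sum, map_sum, sum_apply]
        refine Finset.sum_congr rfl fun i _ => ?_
        rw [hs₀, map_smul, smul_apply]
      have e3 : x ⊗ₜ[ℂ] ρ (s₀ t) k = ∑ i ∈ S, π i.1 x ⊗ₜ[ℂ] ρ i.2 k -
          ∑ i ∈ S, π (i.1 - algebraMap ℂ A (χ i.1)) x ⊗ₜ[ℂ] ρ i.2 k := by
        rw [e2, TensorProduct.tmul_sum, ← Finset.sum_sub_distrib]
        refine Finset.sum_congr rfl fun i _ => ?_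
        rw [← TensorProduct.sub_tmul, map_sub, sub_apply, sub_sub_cancel,
          AlgHomClass.commutes, ← TensorProduct.smul_tmul]
        rfl
      have e4 : ‖∑ i ∈ S, π i.1 x ⊗ₜ[ℂ] ρ i.2 k‖ ≤ ‖mulMap ιA ιB hcomm t‖ * (‖x‖ * ‖k‖) := by
        rw [← UniformSpace.Completion.norm_coe, ← e1]
        refine (ContinuousLinearMap.le_opNorm _ _).trans ?_
        rw [UniformSpace.Completion.norm_coe, TensorProduct.norm_tmul]
        gcongr
        exact NonUnitalStarAlgHom.norm_apply_le Θ _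
      have e5 : ‖∑ i ∈ S, π (i.1 - algebraMap ℂ A (χ i.1)) x ⊗ₜ[ℂ] ρ i.2 k‖ ≤ δ * ‖x‖ := by
        calc _ ≤ ∑ i ∈ S, δ / (C + 1) * ‖x‖ * ‖ρ i.2 k‖ := by
              refine norm_sum_le_of_le _ fun i hi => ?_
              rw [TensorProduct.norm_tmul]
              gcongr
              exact hx i hi
          _ = δ * ‖x‖ * (C / (C + 1)) := by rw [← Finset.mul_sum]; ring
          _ ≤ δ * ‖x‖ * 1 := by
              gcongr
              rw [div_le_one (by positivity)]
              linarith
          _ = δ * ‖x‖ := mul_one _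
      have e6 : ‖x‖ * ‖ρ (s₀ t) k‖ ≤ ‖x‖ * (‖mulMap ιA ιB hcomm t‖ * ‖k‖ + δ) := by
        rw [← TensorProduct.norm_tmul (𝕜 := ℂ) x (ρ (s₀ t) k), e3]
        refine (norm_sub_le _ _).trans ((add_le_add e4 e5).trans (le_of_eq (by ring)))
      exact le_of_mul_le_mul_left e6 hxp
  refine ⟨g, fun a b => ?_⟩
  have := hg (a ⊗ₜ b)
  rw [mulMap_tmul] at this
  rw [this]
  exact hs₀ a b

/-- Strongly self-absorbing algebras have no characters. -/
theorem IsStronglySelfAbsorbing.isEmpty_character {D : Type u} [CStarAlgebra D]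
    (h : IsStronglySelfAbsorbing D) : IsEmpty (D →⋆ₐ[ℂ] ℂ) := by
  refine ⟨fun χ => ?_⟩
  obtain ⟨-, hnt, hD, E, _, ι₁, ι₂, hE, φ, v, hv⟩ := h
  obtain ⟨s, hs⟩ := hE.exists_slice χ
  have hs2 : ∀ b, s (ι₂ b) = b := fun b => by
    have := hs 1 b
    rwa [map_one, one_mul, map_one, one_smul] at this
  have hs1 : ∀ a, s (ι₁ a) = χ a • 1 := fun a => by
    have := hs a 1
    rwa [map_one, mul_one] at this
  have hntE : Nontrivial E := φ.injective.nontrivial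
  have hs_one : s 1 = 1 := by rw [← map_one ι₂, hs2]
  -- The slice of `ι₁ d` is scalar, and conjugation by the unitaries `s (v n)` fixes scalars, so
  -- approximate unitary equivalence gives `φ d` the same slice.
  have hφ : ∀ d, s (φ d) = χ d • 1 := by
    intro d
    have h1 : ∀ n, ‖s (φ d) - χ d • 1‖ ≤ ‖star (v n : E) * φ d * v n - ι₁ d‖ := by
      intro n
      have hu1 : s (v n) * s (star (v n : E)) = 1 := by
        rw [← map_mul, Unitary.mul_star_self_of_mem (v n).2, hs_one]
      have hu2 : s (star (v n : E)) * s (v n) = 1 := by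
        rw [← map_mul, Unitary.star_mul_self_of_mem (v n).2, hs_one]
      have h2 : s (φ d) - χ d • 1
          = s (v n) * s (star (v n : E) * φ d * v n - ι₁ d) * s (star (v n : E)) := by
        rw [map_sub, hs1, map_mul, map_mul, mul_sub, sub_mul, mul_smul_comm, mul_one, smul_mul_assoc,
          hu1, ← mul_assoc, ← mul_assoc, hu1, one_mul, mul_assoc, hu1, mul_one]
      have h3 : ∀ x : E, ‖x‖ ≤ 1 → ‖s x‖ ≤ 1 := fun x hx =>
        (NonUnitalStarAlgHom.norm_apply_le s x).trans hx
      have h4 : ‖(v n : E)‖ ≤ 1 := (CStarRing.norm_of_mem_unitary (v n).2).le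
      have h5 : ‖star (v n : E)‖ ≤ 1 := by rw [norm_star]; exact h4
      rw [h2]
      calc _ ≤ ‖s (v n)‖ * ‖s (star (v n : E) * φ d * v n - ι₁ d)‖ * ‖s (star (v n : E))‖ :=
            norm_mul₃_le
        _ ≤ 1 * ‖star (v n : E) * φ d * v n - ι₁ d‖ * 1 := by
            gcongr
            · exact h3 _ h4
            · exact NonUnitalStarAlgHom.norm_apply_le s _
            · exact h3 _ h5
        _ = _ := by ring
    have h2 : ‖s (φ d) - χ d • 1‖ ≤ 0 := ge_of_tendsto' (hv d) h1
    exact sub_eq_zero.1 (norm_le_zero_iff.1 h2)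
  -- `b` is the slice of `1 ⊗ b`, which is some `φ d` by surjectivity of `φ`.
  have hscal : ∀ b : D, ∃ c : ℂ, algebraMap ℂ D c = b := fun b => by
    refine ⟨χ (φ.symm (ι₂ b)), ?_⟩
    rw [Algebra.algebraMap_eq_smul_one, ← hφ, φ.apply_symm_apply, hs2]
  have hχ : ∀ c : ℂ, χ (algebraMap ℂ D c) = c := fun c => by rw [AlgHomClass.commutes]; rfl
  have hinj : Function.Injective χ := fun x y hxy => by
    obtain ⟨c, rfl⟩ := hscal x
    obtain ⟨c', rfl⟩ := hscal y
    rw [hχ, hχ] at hxy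
    rw [hxy]
  exact hD.false (StarAlgEquiv.ofBijective χ ⟨hinj, fun c => ⟨_, hχ c⟩⟩)

end MinTensor

/-! ### Approximate intertwining and commuting copies of the algebra. -/

section Intertwining

/-- A sequence of homomorphisms that converges pointwise on a dense set has a limit. -/
theorem exists_limit_hom {D F : Type*} [CStarAlgebra D] [CStarAlgebra F] (g : ℕ → D →⋆ₐ[ℂ] F)
    {T : Set D} (hT : Dense T) (hg : ∀ x ∈ T, CauchySeq fun k => g k x) :
    ∃ μ : D →⋆ₐ[ℂ] F, ∀ x, Tendsto (fun k => g k x) atTop (𝓝 (μ x)) := by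
  have hle : ∀ k x, ‖g k x‖ ≤ ‖x‖ := fun k x => NonUnitalStarAlgHom.norm_apply_le (g k) x
  have hc : ∀ x, CauchySeq fun k => g k x := by
    intro x
    rw [Metric.cauchySeq_iff]
    intro ε hε
    obtain ⟨y, hy, hxy⟩ := hT.exists_dist_lt x (show 0 < ε / 3 by positivity)
    obtain ⟨N, hN⟩ := Metric.cauchySeq_iff.1 (hg y hy) (ε / 3) (by positivity)
    refine ⟨N, fun m hm n hn => ?_⟩
    have h1 : ∀ k, dist (g k x) (g k y) ≤ dist x y := fun k => by
      rw [dist_eq_norm, dist_eq_norm, ← map_sub]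
      exact hle k _
    calc dist (g m x) (g n x) ≤ dist (g m x) (g m y) + dist (g m y) (g n y) + dist (g n y) (g n x) :=
          dist_triangle4 _ _ _ _
      _ < ε := by
          have := h1 m
          have h2 := h1 n
          rw [dist_comm] at h2
          have := hN m hm n hn
          linarith
  choose μ hμ using fun x => cauchySeq_tendsto_of_complete (hc x)
  refine ⟨{ toFun := μ
            map_one' := tendsto_nhds_unique (hμ 1) (by simp only [map_one]; exact tendsto_const_nhds)
            map_mul' := fun x y => tendsto_nhds_unique (hμ (x * y))
              (by simp only [map_mul]; exact (hμ x).mul (hμ y))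
            map_zero' := tendsto_nhds_unique (hμ 0) (by simp only [map_zero]; exact tendsto_const_nhds)
            map_add' := fun x y => tendsto_nhds_unique (hμ (x + y))
              (by simp only [map_add]; exact (hμ x).add (hμ y))
            commutes' := fun c => tendsto_nhds_unique (hμ _)
              (by simp only [AlgHomClass.commutes]; exact tendsto_const_nhds)
            map_star' := fun x => tendsto_nhds_unique (hμ _)
              (by simp only [map_star]; exact (hμ x).star) }, hμ⟩

variable {D : Type u} [CStarAlgebra D]

/-- The sequence of unitaries of an approximate intertwining. -/
theorem exists_intertwining_sequence (η : D →⋆ₐ[ℂ] D) (u : ℕ → unitary D)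
    (hu : ∀ d, Tendsto (fun n => ‖star (u n : D) * d * u n - η d‖) atTop (𝓝 0)) (d : ℕ → D) :
    ∃ (w : ℕ → unitary D) (F : ℕ → Set D),
      (∀ k, ∀ y ∈ F k, ‖(w (k + 1) : D) * η y * star (w (k + 1) : D) - w k * y * star (w k : D)‖
        ≤ 1 / 2 / 2 ^ k) ∧
      (∀ k, ∀ y ∈ F k, η y ∈ F (k + 1)) ∧ (∀ k, ∀ i ≤ k, ∀ m ≤ k, (η ^ i) (d m) ∈ F k) ∧
      ∀ k, ∀ m ≤ k, star (w k : D) * d m * w k ∈ F k := by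
  -- Besides the forward orbits of `d 0, …, d k`, which give convergence, the finite sets contain
  -- the elements that conjugation by `w` maps to the `d m`; these give density of the ranges.
  let G : ℕ → unitary D → Set D := fun k w =>
    ((fun p : ℕ × ℕ => (η ^ p.1) (d p.2)) '' (Set.Iic k ×ˢ Set.Iic k)) ∪
      (fun m => star (w : D) * d m * w) '' Set.Iic k
  have hG : ∀ k w, (G k w).Finite := fun k w =>
    (((Set.finite_Iic k).prod (Set.finite_Iic k)).image _).union ((Set.finite_Iic k).image _)
  have step : ∀ (k : ℕ) (w : unitary D) (F : Set D), F.Finite → ∃ w' : unitary D, ∀ y ∈ F,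
      ‖(w' : D) * η y * star (w' : D) - w * y * star (w : D)‖ ≤ 1 / 2 / 2 ^ k := by
    intro k w F hF
    have hev : ∀ᶠ n in atTop, ∀ y ∈ F, ‖star (u n : D) * y * u n - η y‖ < 1 / 2 / 2 ^ k := by
      rw [hF.eventually_all]
      intro y _
      exact (hu y).eventually (gt_mem_nhds (by positivity))
    obtain ⟨n, hn⟩ := hev.exists
    -- Since `η y` is close to `star (u n) * y * u n`, conjugating it by `w * u n` gives nearly `w *
    -- y * star w`.
    refine ⟨w * u n, fun y hy => le_trans (le_of_eq ?_) (hn y hy).le⟩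
    have h1 : ((w * u n : unitary D) : D) * η y * star ((w * u n : unitary D) : D)
        - w * y * star (w : D)
        = -(((w * u n : unitary D) : D) * (star (u n : D) * y * u n - η y) *
          (star (w * u n) : unitary D)) := by
      have e1 : (u n : D) * star (u n : D) = 1 := Unitary.mul_star_self_of_mem (u n).2
      have e2 : (w : D) * u n * (star (u n : D) * y * u n) * (star (u n : D) * star (w : D))
          = w * y * star (w : D) := by
        calc _ = (w : D) * (u n * star (u n : D)) * y * (u n * star (u n : D)) * star (w : D) := by
              simp only [mul_assoc]
          _ = _ := by rw [e1, mul_one, mul_one]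
      simp only [Submonoid.coe_mul, Unitary.coe_star, star_mul, mul_sub, sub_mul, e2]
      abel
    rw [h1, norm_neg, CStarRing.norm_mul_coe_unitary, CStarRing.norm_coe_unitary_mul]
  choose! W hW using step
  let st : ℕ → unitary D × {F : Set D // F.Finite} := fun k => Nat.rec
    (⟨1, ⟨G 0 1, hG 0 1⟩⟩) (fun k s => ⟨W k s.1 s.2.1, ⟨η '' s.2.1 ∪ G (k + 1) (W k s.1 s.2.1),
      (s.2.2.image η).union (hG _ _)⟩⟩) k
  have hst : ∀ k, G k (st k).1 ⊆ (st k).2.1 := by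
    intro k
    cases k with
    | zero => exact subset_rfl
    | succ k => exact Set.subset_union_right
  refine ⟨fun k => (st k).1, fun k => (st k).2.1, fun k y hy => hW k _ _ (st k).2.2 y hy,
    fun k y hy => Or.inl ⟨y, hy, rfl⟩, fun k i hi m hm => hst k (Or.inl ⟨(i, m), ⟨hi, hm⟩, rfl⟩),
    fun k m hm => hst k (Or.inr ⟨m, hm, rfl⟩)⟩

/-- The limit homomorphisms of an approximate intertwining. -/
theorem exists_intertwining [TopologicalSpace.SeparableSpace D] (η : D →⋆ₐ[ℂ] D)
    (u : ℕ → unitary D)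
    (hu : ∀ d, Tendsto (fun n => ‖star (u n : D) * d * u n - η d‖) atTop (𝓝 0)) :
    ∃ μ : ℕ → D →⋆ₐ[ℂ] D, (∀ n x, μ (n + 1) (η x) = μ n x) ∧ Dense (⋃ n, Set.range (μ n)) := by
  let d := TopologicalSpace.denseSeq D
  have hd : DenseRange d := TopologicalSpace.denseRange_denseSeq D
  obtain ⟨w, F, h1, h2, h3, h4⟩ := exists_intertwining_sequence η u hu d
  let γ : ℕ → D →⋆ₐ[ℂ] D := fun k => (Unitary.conjStarAlgAut ℂ D (w k) : D →⋆ₐ[ℂ] D)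
  have hγ : ∀ k x, γ k x = w k * x * star (w k : D) := fun k x => rfl
  -- `g (n + 1) k` after `η` is `g n (k + 1)`, so the limits over `k` satisfy `μ (n + 1) ∘ η = μ n`.
  let g : ℕ → ℕ → D →⋆ₐ[ℂ] D := fun n k => (γ (n + k)).comp (η ^ k)
  have hg : ∀ n k x, g n k x = γ (n + k) ((η ^ k) x) := fun n k x => rfl
  have hpow : ∀ k x, (η ^ (k + 1)) x = η ((η ^ k) x) := fun k x => by rw [pow_succ']; rfl
  have hpow' : ∀ k x, (η ^ (k + 1)) x = (η ^ k) (η x) := fun k x => by rw [pow_succ]; rfl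
  have hdist : ∀ n k x, (η ^ k) x ∈ F (n + k) →
      dist (g n k x) (g n (k + 1) x) ≤ 1 / 2 / 2 ^ (n + k) := by
    intro n k x hx
    rw [dist_comm, dist_eq_norm, hg, hg, hpow, hγ, hγ]
    exact h1 (n + k) _ hx
  have hlim : ∀ n, ∃ μ : D →⋆ₐ[ℂ] D, ∀ x, Tendsto (fun k => g n k x) atTop (𝓝 (μ x)) := by
    intro n
    refine exists_limit_hom (g n) hd ?_
    rintro _ ⟨m, rfl⟩
    -- The shift by `m` ensures that `d m` has already entered the finite sets.
    have hC : CauchySeq fun k => g n (k + m) (d m) := by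
      refine cauchySeq_of_le_geometric_two (C := 1) fun k => ?_
      have := hdist n (k + m) (d m) (h3 _ _ (by omega) _ (by omega))
      rw [show k + 1 + m = k + m + 1 by ring]
      refine this.trans ?_
      gcongr
      · norm_num
      · omega
    exact (cauchySeq_shift m).1 hC
  choose μ hμ using hlim
  refine ⟨μ, fun n x => ?_, ?_⟩
  · refine tendsto_nhds_unique (hμ (n + 1) (η x)) ?_
    refine ((tendsto_add_atTop_iff_nat 1).2 (hμ n x)).congr fun k => ?_
    rw [hg, hg, hpow', show n + (k + 1) = n + 1 + k by ring]
  · refine Dense.of_closure (hd.mono ?_)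
    rintro _ ⟨m, rfl⟩
    rw [Metric.mem_closure_iff]
    intro ε hε
    obtain ⟨N, hN⟩ := exists_pow_lt_of_lt_one hε (show (1 / 2 : ℝ) < 1 by norm_num)
    set k := max m N with hk
    -- `g k 0` maps `y` exactly to `d m`, and the remaining geometric errors keep `μ k y` within `1
    -- / 2 ^ k` of it.
    set y := star (w k : D) * d m * w k with hy
    have hF : ∀ i, (η ^ i) y ∈ F (k + i) := by
      intro i
      induction i with
      | zero => exact h4 k m (le_max_left _ _)
      | succ i ih => rw [hpow]; exact h2 _ _ ih
    have h0 : g k 0 y = d m := by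
      have e1 : (w k : D) * star (w k : D) = 1 := Unitary.mul_star_self_of_mem (w k).2
      have e2 : g k 0 y = w k * y * star (w k : D) := rfl
      rw [e2, hy]
      calc _ = (w k : D) * star (w k : D) * d m * (w k * star (w k : D)) := by simp only [mul_assoc]
        _ = d m := by rw [e1, one_mul, mul_one]
    have h5 : dist (g k 0 y) (μ k y) ≤ 1 / 2 ^ k := by
      refine dist_le_of_le_geometric_two_of_tendsto₀ (f := fun i => g k i y) (fun i => ?_) (hμ k y)
      refine (hdist k i y (hF i)).trans (le_of_eq ?_)
      rw [pow_add]
      field_simp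
    refine ⟨μ k y, Set.mem_iUnion.2 ⟨k, y, rfl⟩, ?_⟩
    rw [← h0]
    refine h5.trans_lt (lt_of_le_of_lt ?_ hN)
    rw [one_div_pow]
    gcongr
    · norm_num
    · exact le_max_right _ _

/-- A strongly self-absorbing algebra is generated by a sequence of commuting copies of itself. -/
theorem IsStronglySelfAbsorbing.exists_commuting_homs (h : IsStronglySelfAbsorbing D) :
    ∃ l : ℕ → D →⋆ₐ[ℂ] D, (∀ i j, i < j → ∀ a b, Commute (l i a) (l j b)) ∧
      ∀ T : StarSubalgebra ℂ D, IsClosed (T : Set D) → (∀ i x, l i x ∈ T) → T = ⊤ := by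
  obtain ⟨hsep, -, -, E, _, ι₁, ι₂, hE, φ, v, hv⟩ := h
  let ψ : E →⋆ₐ[ℂ] D := (φ.symm : E →⋆ₐ[ℂ] D)
  have hψφ : ∀ x, ψ (φ x) = x := φ.symm_apply_apply
  let η : D →⋆ₐ[ℂ] D := ψ.comp ι₁
  let η' : D →⋆ₐ[ℂ] D := ψ.comp ι₂
  have hcomm : ∀ a b, Commute (η a) (η' b) := fun a b => (hE.commute a b).map ψ
  have hdense : DenseRange (mulMap η η' hcomm) :=
    dense_of_surjective hE.denseRange ψ φ.symm.surjective hcomm (fun a => ⟨a, rfl⟩) fun b => ⟨b, rfl⟩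
  let u : ℕ → unitary D := fun n => ⟨ψ (v n), by
    rw [Unitary.mem_iff, ← map_star, ← map_mul, ← map_mul, Unitary.star_mul_self_of_mem (v n).2,
      Unitary.mul_star_self_of_mem (v n).2, map_one]
    exact ⟨rfl, rfl⟩⟩
  obtain ⟨μ, hμ, hμd⟩ := exists_intertwining η u fun d => by
    refine squeeze_zero (fun _ => norm_nonneg _) (fun n => ?_) (hv d)
    have : star (u n : D) * d * u n - η d = ψ (star (v n : E) * φ d * v n - ι₁ d) := by
      rw [map_sub, map_mul, map_mul, hψφ, map_star]
      rfl
    rw [this]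
    exact NonUnitalStarAlgHom.norm_apply_le ψ _
  have hsub : ∀ i j, i ≤ j → ∀ a, ∃ b, μ j b = μ i a := by
    intro i j hij
    induction j, hij using Nat.le_induction with
    | base => exact fun a => ⟨a, rfl⟩
    | succ j _ ih =>
      intro a
      obtain ⟨b, hb⟩ := ih a
      exact ⟨η b, by rw [hμ, hb]⟩
  -- The range of `μ (n + 1)` is generated by `μ (n + 1) ∘ η = μ n` and the commuting map `μ (n + 1)
  -- ∘ η'`. So each step adds one copy of `D` commuting with all earlier ones.
  let l : ℕ → D →⋆ₐ[ℂ] D := fun n => match n with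
    | 0 => μ 0
    | n + 1 => (μ (n + 1)).comp η'
  have hl : ∀ i a, ∃ b, μ i b = l i a := by
    intro i a
    cases i with
    | zero => exact ⟨a, rfl⟩
    | succ i => exact ⟨η' a, rfl⟩
  refine ⟨l, fun i j hij a b => ?_, fun T hT hlT => ?_⟩
  · obtain ⟨j, rfl⟩ : ∃ k, j = k + 1 := ⟨j - 1, by omega⟩
    obtain ⟨a', ha'⟩ := hl i a
    obtain ⟨a'', ha''⟩ := hsub i j (by omega) a'
    rw [← ha', ← ha'', ← hμ]
    exact (hcomm a'' b).map (μ (j + 1))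
  · have hall : ∀ n x, μ n x ∈ T := by
      intro n
      induction n with
      | zero => exact hlT 0
      | succ n ih =>
        intro x
        refine hdense.induction_on (p := fun x => μ (n + 1) x ∈ T) x
          (hT.preimage (continuous_starHom (μ (n + 1) : D →⋆ₙₐ[ℂ] D))) fun t => ?_
        induction t with
        | zero => rw [map_zero, map_zero]; exact zero_mem T
        | add x y hx hy => rw [map_add, map_add]; exact add_mem hx hy
        | tmul a b =>
          rw [mulMap_tmul, map_mul, hμ]
          exact mul_mem (ih a) (hlT (n + 1) b)
    rw [StarSubalgebra.eq_top_iff]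
    intro x
    have hx : x ∈ closure (T : Set D) := closure_mono (Set.iUnion_subset fun n => by
      rintro _ ⟨y, rfl⟩
      exact hall n y) (hμd x)
    rwa [hT.closure_eq] at hx

end Intertwining

/-! ### Commuting representations force large dimension. -/

section Rank

/-- An algebra generated by its commutators, as an ideal, has no nonzero representation by
scalars. -/
theorem exists_not_scalar {R V : Type*} [Ring R] [Algebra ℂ R] (hR : commutatorIdeal R = ⊤)
    [AddCommGroup V] [Module ℂ V] [Nontrivial V] (ψ : R →ₐ[ℂ] Module.End ℂ V) :
    ∃ a, ∀ c : ℂ, ψ a ≠ algebraMap ℂ _ c := by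
  by_contra! H
  have h1 : commutatorIdeal R ≤ TwoSidedIdeal.ker ψ := by
    refine TwoSidedIdeal.span_le.2 ?_
    rintro _ ⟨a, b, rfl⟩
    obtain ⟨c, hc⟩ := H a
    obtain ⟨c', hc'⟩ := H b
    rw [SetLike.mem_coe, TwoSidedIdeal.mem_ker, map_sub, map_mul, map_mul, hc, hc', sub_eq_zero]
    exact Algebra.commutes _ _
  have h2 : (1 : R) ∈ TwoSidedIdeal.ker ψ := h1 (by rw [hR]; trivial)
  rw [TwoSidedIdeal.mem_ker, map_one] at h2
  exact one_ne_zero h2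

/-- The restriction of a representation to an invariant subspace. -/
noncomputable def restrictRep {R V : Type*} [Ring R] [Algebra ℂ R] [AddCommGroup V] [Module ℂ V]
    (ψ : R →ₐ[ℂ] Module.End ℂ V) (W : Submodule ℂ V) (hW : ∀ a, ∀ x ∈ W, ψ a x ∈ W) :
    R →ₐ[ℂ] Module.End ℂ W where
  toFun a := (ψ a).restrict (hW a)
  map_one' := by ext; simp
  map_mul' a b := by ext; simp
  map_zero' := by ext; simp
  map_add' a b := by ext; simp
  commutes' c := by ext; simp

/-- A nonzero space with `n` commuting representations of an algebra generated by its commutators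
has dimension at least `2 ^ n`. -/
theorem two_pow_le_finrank {R : Type*} [Ring R] [Algebra ℂ R] (hR : commutatorIdeal R = ⊤) (n : ℕ)
    {V : Type*} [AddCommGroup V] [Module ℂ V] [FiniteDimensional ℂ V] [Nontrivial V]
    (ψ : Fin n → R →ₐ[ℂ] Module.End ℂ V)
    (hψ : ∀ i j, i < j → ∀ a b, Commute (ψ i a) (ψ j b)) : 2 ^ n ≤ Module.finrank ℂ V := by
  induction n generalizing V with
  | zero => exact Module.finrank_pos
  | succ n ih =>
    obtain ⟨a, ha⟩ := exists_not_scalar hR (ψ (Fin.last n))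
    -- `T` is not scalar, so for an eigenvalue `c` both the kernel and the range of `T - c` are
    -- nonzero. The other `n` representations commute with `T` and preserve both spaces, whose
    -- dimensions add up to that of `V`.
    set T := ψ (Fin.last n) a with hT
    obtain ⟨c, hc⟩ := Module.End.exists_eigenvalue T
    set U := T - algebraMap ℂ (Module.End ℂ V) c with hU
    have hcomm : ∀ (i : Fin n) b, Commute (ψ i.castSucc b) U := fun i b =>
      (hψ _ _ (Fin.castSucc_lt_last i) b a).sub_right (Algebra.commutes c _).symm
    have hker : ∀ (i : Fin n) b, ∀ x ∈ LinearMap.ker U, ψ i.castSucc b x ∈ LinearMap.ker U := by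
      intro i b x hx
      rw [LinearMap.mem_ker] at hx ⊢
      have := LinearMap.congr_fun (hcomm i b).eq x
      rw [Module.End.mul_apply, Module.End.mul_apply, hx, map_zero] at this
      exact this.symm
    have hrange : ∀ (i : Fin n) b, ∀ x ∈ LinearMap.range U, ψ i.castSucc b x ∈ LinearMap.range U := by
      rintro i b _ ⟨x, rfl⟩
      exact ⟨ψ i.castSucc b x, (LinearMap.congr_fun (hcomm i b).eq x).symm⟩
    have h1 : Nontrivial (LinearMap.ker U) := by
      rw [Submodule.nontrivial_iff_ne_bot]
      intro h
      obtain ⟨x, hx⟩ := hc.exists_hasEigenvector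
      have : x ∈ LinearMap.ker U := by
        rw [LinearMap.mem_ker, hU, LinearMap.sub_apply, hx.apply_eq_smul, Module.algebraMap_end_apply,
          sub_self]
      rw [h, Submodule.mem_bot] at this
      exact hx.2 this
    have h2 : Nontrivial (LinearMap.range U) := by
      rw [Submodule.nontrivial_iff_ne_bot]
      intro h
      rw [LinearMap.range_eq_bot, hU, sub_eq_zero] at h
      exact ha c h
    have e1 := ih (V := LinearMap.ker U) (fun i => restrictRep (ψ i.castSucc) _ (hker i))
      fun i j hij a b => LinearMap.ext fun x =>
        Subtype.ext (LinearMap.congr_fun (hψ i.castSucc j.castSucc hij a b).eq x)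
    have e2 := ih (V := LinearMap.range U) (fun i => restrictRep (ψ i.castSucc) _ (hrange i))
      fun i j hij a b => LinearMap.ext fun x =>
        Subtype.ext (LinearMap.congr_fun (hψ i.castSucc j.castSucc hij a b).eq x)
    have e3 := LinearMap.finrank_range_add_finrank_ker U
    rw [pow_succ]
    omega

end Rank

/-! ### Ranks of matrix values and the choice of the number of copies. -/

section RankOfValues

/-- The algebras `g r R` commute with the entries of `p`, so through `χ` they act on the range of
the matrix value. Although `χ` need not be unital, `χ 1` is the identity on this range, so the
representations are unital. Nothing but nonvanishing is asked of `p`. -/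
theorem two_pow_le_rank {𝒮 R : Type*} [Ring 𝒮] [Algebra ℂ 𝒮] [Ring R] [Algebra ℂ R]
    (hR : commutatorIdeal R = ⊤) (n : ℕ) (g : Fin n → R →ₐ[ℂ] 𝒮)
    (hg : ∀ i j, i < j → ∀ a b, Commute (g i a) (g j b)) {ν κ : Type} [Fintype ν] [DecidableEq ν]
    [Fintype κ] [DecidableEq κ] (χ : 𝒮 →ₙₐ[ℂ] Matrix ν ν ℂ) (p : Matrix κ κ 𝒮)
    (hp : ∀ r a i j, Commute (g r a) (p i j)) (hne : Matrix.comp κ κ ν ν ℂ (p.map χ) ≠ 0) :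
    2 ^ n ≤ (Matrix.comp κ κ ν ν ℂ (p.map χ)).rank := by
  let C : Matrix κ κ (Matrix ν ν ℂ) ≃ₐ[ℂ] Matrix (κ × ν) (κ × ν) ℂ := Matrix.compAlgEquiv κ ν ℂ ℂ
  set M := C (p.map χ) with hM
  change M ≠ 0 at hne
  change 2 ^ n ≤ M.rank
  let K : 𝒮 → Matrix (κ × ν) (κ × ν) ℂ := fun x => C (Matrix.diagonal fun _ => χ x)
  have hKM : ∀ x, (∀ i j, Commute x (p i j)) → K x * M = M * K x := by
    intro x hx
    rw [hM, ← map_mul, ← map_mul]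
    congr 1
    ext i j : 2
    rw [Matrix.diagonal_mul, Matrix.mul_diagonal, Matrix.map_apply, ← map_mul, ← map_mul,
      (hx i j).eq]
  have hK1 : K 1 * M = M := by
    rw [hM, ← map_mul]
    congr 1
    ext i j : 2
    rw [Matrix.diagonal_mul, Matrix.map_apply, ← map_mul, one_mul]
  have hKmul : ∀ x y, K (x * y) = K x * K y := by
    intro x y
    rw [← map_mul, Matrix.diagonal_mul_diagonal]
    simp only [K, map_mul]
  have hKadd : ∀ x y, K (x + y) = K x + K y := by
    intro x y
    rw [← map_add, Matrix.diagonal_add]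
    simp only [K, map_add]
  have hKsmul : ∀ (c : ℂ) x, K (c • x) = c • K x := by
    intro c x
    have : (Matrix.diagonal fun _ : κ => χ (c • x)) = c • Matrix.diagonal fun _ : κ => χ x := by
      rw [← Matrix.diagonal_smul]
      simp only [map_smul]
      rfl
    simp only [K]
    rw [this, map_smul]
  let V := LinearMap.range M.mulVecLin
  have hinv : ∀ x, (∀ i j, Commute x (p i j)) → ∀ v ∈ V, (K x).mulVecLin v ∈ V := by
    rintro x hx _ ⟨w, rfl⟩
    refine ⟨(K x).mulVec w, ?_⟩
    rw [Matrix.mulVecLin_apply, Matrix.mulVecLin_apply, Matrix.mulVecLin_apply, Matrix.mulVec_mulVec,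
      Matrix.mulVec_mulVec, hKM x hx]
  have hone : ∀ v ∈ V, (K 1).mulVec v = v := by
    rintro _ ⟨w, rfl⟩
    rw [Matrix.mulVecLin_apply, Matrix.mulVec_mulVec, hK1]
  have hV : Nontrivial V := by
    rw [Submodule.nontrivial_iff_ne_bot]
    intro h
    rw [LinearMap.range_eq_bot] at h
    refine hne (Matrix.ext fun i j => ?_)
    have := congrFun (LinearMap.congr_fun h (Pi.single j 1)) i
    simpa using this
  let ψ : Fin n → R →ₐ[ℂ] Module.End ℂ V := fun r =>
    { toFun := fun a => (K (g r a)).mulVecLin.restrict (hinv _ (hp r a))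
      map_one' := LinearMap.ext fun v => Subtype.ext (by
        change (K (g r 1)).mulVec v = v
        rw [map_one]
        exact hone v v.2)
      map_mul' := fun a b => LinearMap.ext fun v => Subtype.ext (by
        change (K (g r (a * b))).mulVec v = (K (g r a)).mulVec ((K (g r b)).mulVec v)
        rw [map_mul, hKmul, Matrix.mulVec_mulVec])
      map_zero' := LinearMap.ext fun v => Subtype.ext (by
        change (K (g r 0)).mulVec v = 0
        have h0 : K 0 = 0 := by simpa using hKsmul 0 0
        rw [map_zero, h0, Matrix.zero_mulVec])
      map_add' := fun a b => LinearMap.ext fun v => Subtype.ext (by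
        change (K (g r (a + b))).mulVec v = (K (g r a)).mulVec v + (K (g r b)).mulVec v
        rw [map_add, hKadd, Matrix.add_mulVec])
      commutes' := fun c => LinearMap.ext fun v => Subtype.ext (by
        change (K (g r (algebraMap ℂ R c))).mulVec v = c • (v : κ × ν → ℂ)
        rw [AlgHomClass.commutes, Algebra.algebraMap_eq_smul_one, hKsmul, Matrix.smul_mulVec,
          hone v v.2]) }
  refine two_pow_le_finrank hR n ψ fun i j hij a b => LinearMap.ext fun v => Subtype.ext ?_
  change (K (g i a)).mulVec ((K (g j b)).mulVec v) = (K (g j b)).mulVec ((K (g i a)).mulVec v)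
  rw [Matrix.mulVec_mulVec, Matrix.mulVec_mulVec, ← hKmul, ← hKmul, (hg i j hij a b).eq]

/-- Exponentials outgrow cubes. -/
theorem exists_growing_exponents (a b : ℕ → ℕ) : ∃ n : ℕ → ℕ, StrictMono n ∧
    ∀ j, (j + 1) * (a (j + 1) + (n (j + 1) + 1) * b (j + 1)) ^ 3 ≤ 2 ^ (n (j + 1) - n j) := by
  have step : ∀ j n, ∃ m, n < m ∧ (j + 1) * (a (j + 1) + (m + 1) * b (j + 1)) ^ 3 ≤ 2 ^ (m - n) := by
    intro j n
    set K := a (j + 1) + (n + 2) * b (j + 1) with hK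
    -- With `m = n + t` and `t ≥ 1` the linear expression is at most `K * (2 * t)`, so `t ^ 3 * c ≤
    -- 2 ^ t` is enough, which holds for large `t`.
    set c : ℝ := (j + 1) * K ^ 3 * 8 + 1 with hc
    have hc0 : 0 < c := by positivity
    have h1 := (tendsto_pow_const_div_const_pow_of_one_lt 3 (show (1 : ℝ) < 2 by norm_num)).eventually
      (gt_mem_nhds (show (0 : ℝ) < 1 / c by positivity))
    obtain ⟨t, ht, ht1⟩ := (h1.and (eventually_ge_atTop 1)).exists
    refine ⟨n + t, by omega, ?_⟩
    have h2 : a (j + 1) + (n + t + 1) * b (j + 1) ≤ K * (2 * t) := by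
      have h3 : n + t + 1 ≤ (n + 2) * (2 * t) := by nlinarith
      calc _ ≤ a (j + 1) * (2 * t) + (n + 2) * (2 * t) * b (j + 1) := by
            gcongr
            nlinarith
        _ = K * (2 * t) := by rw [hK]; ring
    rw [div_lt_div_iff₀ (by positivity) hc0, one_mul] at ht
    have h4 : (j + 1) * (K * (2 * t)) ^ 3 ≤ 2 ^ t := by
      have h5 : ((j + 1) * (K * (2 * t)) ^ 3 : ℝ) ≤ 2 ^ t := by
        have : (0 : ℝ) ≤ (t : ℝ) ^ 3 := by positivity
        calc ((j + 1) * (K * (2 * t)) ^ 3 : ℝ) = t ^ 3 * ((j + 1) * K ^ 3 * 8) := by ring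
          _ ≤ t ^ 3 * c := by rw [hc]; nlinarith
          _ ≤ 2 ^ t := ht.le
      exact_mod_cast h5
    rw [Nat.add_sub_cancel_left]
    exact le_trans (by gcongr) h4
  choose m hm hm' using step
  let n : ℕ → ℕ := fun j => Nat.rec 0 (fun j n => m j n) j
  exact ⟨n, strictMono_nat_of_lt_succ fun j => hm j (n j), fun j => hm' j (n j)⟩

end RankOfValues

/-! ### The growing sequence of subalgebras. -/

section Exhaustions

/-- `A` is exhausted by images of algebras with the property `P`. -/
def HasExhaustion (P : (A : Type u) → [CStarAlgebra A] → ℕ → Prop) (A : Type u) [CStarAlgebra A] :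
    Prop :=
  ∃ (B : ℕ → Type u) (_ : ∀ i, CStarAlgebra (B i)) (d : ℕ → ℕ) (ι : ∀ i, B i →⋆ₐ[ℂ] A),
    (∀ i, P (B i) (d i)) ∧ (∀ i, Set.range (ι i) ⊆ Set.range (ι (i + 1))) ∧
    Dense (⋃ i, Set.range (ι i))

/-- The property `P` passes to C*-algebras generated by commuting images, and adds the
dimensions. -/
def TensorClosed (P : (A : Type u) → [CStarAlgebra A] → ℕ → Prop) : Prop :=
  ∀ (A B E : Type u) [CStarAlgebra A] [CStarAlgebra B] [CStarAlgebra E] (a b : ℕ), P A a → P B b →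
    ∀ (α : A →⋆ₐ[ℂ] E) (β : B →⋆ₐ[ℂ] E) (comm : ∀ a b, Commute (α a) (β b)),
      DenseRange (mulMap α β comm) → P E (a + b)

/-- This allows the copies of `D` to be adjoined one at a time: the two maps are corestricted to the
closed algebra `T` that they generate. -/
theorem TensorClosed.subalgebra {P : (A : Type u) → [CStarAlgebra A] → ℕ → Prop}
    (hP : TensorClosed P) {B C E : Type u} [CStarAlgebra B] [CStarAlgebra C] [CStarAlgebra E]
    {b c : ℕ} (hB : P B b) (hC : P C c) (f : B →⋆ₐ[ℂ] E) (g : C →⋆ₐ[ℂ] E)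
    (comm : ∀ x y, Commute (f x) (g y)) (T : StarSubalgebra ℂ E) [IsClosed (T : Set E)]
    (hT : T = (f.range ⊔ g.range).topologicalClosure) : P T (b + c) := by
  have hle : f.range ⊔ g.range ≤ T := by
    rw [hT]; exact StarSubalgebra.le_topologicalClosure _
  have hf : ∀ x, f x ∈ T := fun x => hle (le_sup_left (a := f.range) (b := g.range) ⟨x, rfl⟩)
  have hg : ∀ x, g x ∈ T := fun x => hle (le_sup_right (a := f.range) (b := g.range) ⟨x, rfl⟩)
  have comm' : ∀ x y, Commute (f.codRestrict T hf x) (g.codRestrict T hg y) := fun x y =>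
    Subtype.ext (comm x y).eq
  refine hP B C T b c hB hC (f.codRestrict T hf) (g.codRestrict T hg) comm' fun x => ?_
  rw [closure_subtype]
  have h1 : (f.range ⊔ g.range).topologicalClosure ≤ (mulMap f g comm).range.topologicalClosure := by
    refine StarSubalgebra.topologicalClosure_mono (sup_le ?_ ?_)
    · rintro _ ⟨x, rfl⟩
      exact ⟨x ⊗ₜ 1, by
        change mulMap f g comm (x ⊗ₜ 1) = f x
        rw [mulMap_tmul, map_one, mul_one]⟩
    · rintro _ ⟨x, rfl⟩
      exact ⟨1 ⊗ₜ x, by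
        change mulMap f g comm (1 ⊗ₜ x) = g x
        rw [mulMap_tmul, map_one, one_mul]⟩
  have h2 : (x : E) ∈ closure (Set.range (mulMap f g comm)) := by
    have hx : (x : E) ∈ (f.range ⊔ g.range).topologicalClosure := by
      rw [← hT]; exact x.2
    exact h1 hx
  refine closure_mono ?_ h2
  rintro _ ⟨t, rfl⟩
  refine ⟨mulMap (f.codRestrict T hf) (g.codRestrict T hg) comm' t, ⟨t, rfl⟩, ?_⟩
  induction t with
  | zero => rw [map_zero, map_zero]; rfl
  | add x y hx hy => rw [map_add, map_add, ← hx, ← hy]; rfl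
  | tmul x y => rw [mulMap_tmul, mulMap_tmul]; rfl

/-- A `D`-stable algebra is exhausted by subalgebras whose matrix values have large ranks. -/
theorem exists_growing_sequence {P : (A : Type u) → [CStarAlgebra A] → ℕ → Prop}
    (hP : TensorClosed P) {A D : Type u} [CStarAlgebra A] [CStarAlgebra D] (hA : HasExhaustion P A)
    (hD : HasExhaustion P D) (hssa : IsStronglySelfAbsorbing D) (hst : IsTensorStable A D) :
    ∃ (S : ℕ → StarSubalgebra ℂ A) (_ : ∀ j, IsClosed (S j : Set A)) (δ : ℕ → ℕ) (hS : Monotone S)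
      (j₁ : ℕ), Dense (⋃ j, (S j : Set A)) ∧ (∀ j, P (S j) (δ j)) ∧
      ∀ (i j : ℕ) (hij : i < j), j₁ ≤ j → ∀ (ν κ : Type) [Fintype ν] [DecidableEq ν] [Fintype κ]
        [DecidableEq κ] (χ : S j →ₙₐ[ℂ] Matrix ν ν ℂ) (p : Matrix κ κ (S i)),
        Matrix.comp κ κ ν ν ℂ (p.map fun x => χ ⟨x, hS hij.le x.2⟩) ≠ 0 →
        j * δ j ^ 3 ≤ (Matrix.comp κ κ ν ν ℂ (p.map fun x => χ ⟨x, hS hij.le x.2⟩)).rank := by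
  obtain ⟨l, hlcomm, hlgen⟩ := hssa.exists_commuting_homs
  have hchar := hssa.isEmpty_character
  obtain ⟨B, _, a, ι, hBP, hιmono, hιd⟩ := hA
  obtain ⟨C, _, b, κ, hCP, hκmono, hκd⟩ := hD
  obtain ⟨E, _, ι₁, ι₂, hE, ⟨e⟩⟩ := hst
  let ε : E →⋆ₐ[ℂ] A := (e : E →⋆ₐ[ℂ] A)
  let α : A →⋆ₐ[ℂ] A := ε.comp ι₁
  let β : D →⋆ₐ[ℂ] A := ε.comp ι₂
  have hcomm : ∀ x y, Commute (α x) (β y) := fun x y => (hE.commute x y).map ε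
  have hdense : DenseRange (mulMap α β hcomm) :=
    dense_of_surjective hE.denseRange ε e.surjective hcomm (fun a => ⟨a, rfl⟩) fun b => ⟨b, rfl⟩
  have hι : ∀ i j, i ≤ j → Set.range (ι i) ⊆ Set.range (ι j) := fun i j hij =>
    monotone_nat_of_le_succ (f := fun i => Set.range (ι i)) hιmono hij
  have hκ : ∀ i j, i ≤ j → Set.range (κ i) ⊆ Set.range (κ j) := fun i j hij =>
    monotone_nat_of_le_succ (f := fun i => Set.range (κ i)) hκmono hij
  let f : ∀ i, ℕ → C i →⋆ₐ[ℂ] A := fun i m => (β.comp (l m)).comp (κ i)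
  obtain ⟨S, hS0, hS1⟩ : ∃ S : ℕ → ℕ → StarSubalgebra ℂ A,
      (∀ i, S i 0 = ((α.comp (ι i)).range ⊔ (f i 0).range).topologicalClosure) ∧
      ∀ i n, S i (n + 1) = (S i n ⊔ (f i (n + 1)).range).topologicalClosure :=
    ⟨fun i n => Nat.rec ((α.comp (ι i)).range ⊔ (f i 0).range).topologicalClosure
      (fun n T => (T ⊔ (f i (n + 1)).range).topologicalClosure) n, fun _ => rfl, fun _ _ => rfl⟩
  have hcl : ∀ i n, IsClosed (S i n : Set A) := by
    intro i n
    cases n with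
    | zero => rw [hS0]; exact StarSubalgebra.isClosed_topologicalClosure _
    | succ n => rw [hS1]; exact StarSubalgebra.isClosed_topologicalClosure _
  have hSn : ∀ i, Monotone (S i) := fun i => monotone_nat_of_le_succ fun n => by
    rw [hS1]
    exact le_sup_left.trans (StarSubalgebra.le_topologicalClosure _)
  have hαS : ∀ i x, α (ι i x) ∈ S i 0 := fun i x => by
    rw [hS0]
    exact StarSubalgebra.le_topologicalClosure _
      (le_sup_left (a := (α.comp (ι i)).range) (b := (f i 0).range) ⟨x, rfl⟩)
  have hfS : ∀ i m x, β (l m (κ i x)) ∈ S i m := by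
    intro i m x
    cases m with
    | zero =>
      rw [hS0]
      exact StarSubalgebra.le_topologicalClosure _
        (le_sup_right (a := (α.comp (ι i)).range) (b := (f i 0).range) ⟨x, rfl⟩)
    | succ m =>
      rw [hS1]
      exact StarSubalgebra.le_topologicalClosure _
        (le_sup_right (a := S i m) (b := (f i (m + 1)).range) ⟨x, rfl⟩)
  -- the subalgebra `S i n` is the smallest one containing its generators
  have hleast : ∀ i n (T : StarSubalgebra ℂ A), IsClosed (T : Set A) → (∀ x, α (ι i x) ∈ T) →
      (∀ m ≤ n, ∀ x, β (l m (κ i x)) ∈ T) → S i n ≤ T := by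
    intro i n T hT h1 h2
    induction n with
    | zero =>
      rw [hS0]
      refine StarSubalgebra.topologicalClosure_minimal (sup_le ?_ ?_) hT
      · rintro _ ⟨x, rfl⟩
        exact h1 x
      · rintro _ ⟨x, rfl⟩
        exact h2 0 le_rfl x
    | succ n ih =>
      rw [hS1]
      refine StarSubalgebra.topologicalClosure_minimal (sup_le (ih fun m hm => h2 m (by omega)) ?_) hT
      rintro _ ⟨x, rfl⟩
      exact h2 (n + 1) le_rfl x
  have hSi : ∀ i j n, i ≤ j → S i n ≤ S j n := by
    intro i j n hij
    refine hleast i n _ (hcl j n) (fun x => ?_) fun m hm x => ?_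
    · obtain ⟨y, hy⟩ := hι i j hij ⟨x, rfl⟩
      rw [← hy]
      exact hSn j (Nat.zero_le n) (hαS j y)
    · obtain ⟨y, hy⟩ := hκ i j hij ⟨x, rfl⟩
      rw [← hy]
      exact hSn j hm (hfS j m y)
  -- The centralizer of the `m`-th copy is a closed star subalgebra containing the generators of `S
  -- i n`.
  have hScomm : ∀ i n m, n < m → ∀ x ∈ S i n, ∀ d, Commute x (β (l m d)) := by
    intro i n m hnm
    let Z : StarSubalgebra ℂ A := StarSubalgebra.centralizer ℂ (Set.range fun d => β (l m d))
    have hZ : ∀ x, x ∈ Z ↔ ∀ d, Commute x (β (l m d)) := by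
      intro x
      rw [StarSubalgebra.mem_centralizer_iff]
      constructor
      · intro h d
        exact (h _ ⟨d, rfl⟩).1.symm
      · rintro h _ ⟨d, rfl⟩
        refine ⟨(h d).eq.symm, ?_⟩
        dsimp only
        rw [← map_star, ← map_star]
        exact (h (star d)).eq.symm
    have hle : S i n ≤ Z := by
      refine hleast i n Z ?_ (fun x => ?_) fun k hk x => ?_
      · change IsClosed ((StarSubalgebra.centralizer ℂ (Set.range fun d => β (l m d)) :
          StarSubalgebra ℂ A) : Set A)
        rw [StarSubalgebra.coe_centralizer]
        exact Set.isClosed_centralizer _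
      · rw [hZ]
        exact fun d => hcomm _ _
      · rw [hZ]
        exact fun d => (hlcomm k m (by omega) _ _).map β
    exact fun x hx => (hZ x).1 (hle hx)
  have hPS : ∀ i n, P (S i n) (a i + (n + 1) * b i) := by
    intro i n
    induction n with
    | zero =>
      have := hP.subalgebra (hBP i) (hCP i) (α.comp (ι i)) (f i 0) (fun x y => hcomm _ _) (S i 0)
        (hS0 i)
      rwa [zero_add, one_mul]
    | succ n ih =>
      have h1 : (S i n).subtype.range = S i n := by
        ext x
        exact ⟨fun ⟨y, hy⟩ => hy ▸ y.2, fun hx => ⟨⟨x, hx⟩, rfl⟩⟩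
      have := hP.subalgebra ih (hCP i) (S i n).subtype (f i (n + 1))
        (fun x y => hScomm i n (n + 1) (Nat.lt_succ_self n) x x.2 _) (S i (n + 1))
        (by rw [h1]; exact hS1 i n)
      rwa [show a i + (n + 1 + 1) * b i = a i + (n + 1) * b i + b i by ring]
  obtain ⟨n, hn, hn'⟩ := exists_growing_exponents a b
  have hmono : Monotone fun j => S j (n j) := fun i j hij =>
    (hSi i j (n i) hij).trans (hSn j (hn.monotone hij))
  -- a stage of `D` that is generated by its commutators
  let Dc : ℕ → StarSubalgebra ℂ D := fun i => (κ i).range.topologicalClosure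
  have hDccl : ∀ i, IsClosed (Dc i : Set D) := fun i => StarSubalgebra.isClosed_topologicalClosure _
  have hDcmono : Monotone Dc := fun i j hij => StarSubalgebra.topologicalClosure_mono (hκ i j hij)
  obtain ⟨i₀, hi₀⟩ := exists_commutatorIdeal_eq_top hchar Dc hDcmono
    (hκd.mono (Set.iUnion_mono fun i => StarSubalgebra.le_topologicalClosure (κ i).range))
  have hDcS : ∀ j m k, i₀ ≤ j → m ≤ k → ∀ d ∈ Dc i₀, β (l m d) ∈ S j k := by
    intro j m k hj hm d hd
    have h1 : Dc i₀ ≤ (S j k).comap (β.comp (l m)) := by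
      refine StarSubalgebra.topologicalClosure_minimal ?_
        ((hcl j k).preimage (continuous_starHom (β.comp (l m) : D →⋆ₙₐ[ℂ] A)))
      rintro _ ⟨x, rfl⟩
      obtain ⟨y, hy⟩ := hκ i₀ j hj ⟨x, rfl⟩
      change β (l m (κ i₀ x)) ∈ S j k
      rw [← hy]
      exact hSn j hm (hfS j m y)
    exact h1 hd
  refine ⟨fun j => S j (n j), fun j => hcl j (n j), fun j => a j + (n j + 1) * b j, hmono, i₀, ?_,
    fun j => hPS j (n j), ?_⟩
  · let T : StarSubalgebra ℂ A := (⨆ j, S j (n j)).topologicalClosure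
    have hT : IsClosed (T : Set A) := StarSubalgebra.isClosed_topologicalClosure _
    have hle : ∀ j, S j (n j) ≤ T := fun j =>
      (le_iSup (fun j => S j (n j)) j).trans (StarSubalgebra.le_topologicalClosure _)
    have h1 : ∀ x, α x ∈ T := fun x => by
      have h2 : (⋃ i, Set.range (ι i)) ⊆ (T.comap α : Set A) := by
        refine Set.iUnion_subset fun i => ?_
        rintro _ ⟨y, rfl⟩
        exact hle i (hSn i (Nat.zero_le _) (hαS i y))
      exact closure_minimal h2 (hT.preimage (continuous_starHom (α : A →⋆ₙₐ[ℂ] A))) (hιd x)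
    have h2 : ∀ m d, β (l m d) ∈ T := fun m d => by
      have h2 : (⋃ i, Set.range (κ i)) ⊆ (T.comap (β.comp (l m)) : Set D) := by
        refine Set.iUnion_subset fun i => ?_
        rintro _ ⟨y, rfl⟩
        change β (l m (κ i y)) ∈ T
        -- The copy `m` belongs to stage `max i m`, because a strictly increasing sequence satisfies
        -- `k ≤ n k`.
        obtain ⟨z, hz⟩ := hκ i (max i m) (le_max_left _ _) ⟨y, rfl⟩
        rw [← hz]
        exact hle (max i m) (hSn _ ((le_max_right i m).trans hn.le_apply) (hfS _ m z))
      exact closure_minimal h2 (hT.preimage (continuous_starHom (β.comp (l m) : D →⋆ₙₐ[ℂ] A))) (hκd d)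
    have h3 : ∀ d, β d ∈ T := fun d => by
      have := hlgen (T.comap β) (hT.preimage (continuous_starHom (β : D →⋆ₙₐ[ℂ] A))) h2
      have hd : d ∈ T.comap β := by rw [this]; trivial
      exact hd
    have h4 : ∀ x, x ∈ T := fun x => by
      refine hdense.induction_on (p := fun x => x ∈ T) x hT fun t => ?_
      induction t with
      | zero => rw [map_zero]; exact zero_mem T
      | add x y hx hy => rw [map_add]; exact add_mem hx hy
      | tmul x y => rw [mulMap_tmul]; exact mul_mem (h1 x) (h3 y)
    intro x
    have hx : x ∈ closure ((⨆ j, S j (n j) : StarSubalgebra ℂ A) : Set A) := h4 x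
    rwa [StarSubalgebra.coe_iSup_of_directed hmono.directed_le] at hx
  · intro i j hij hj ν κ' _ _ _ _ χ p hne
    obtain ⟨j, rfl⟩ : ∃ k, j = k + 1 := ⟨j - 1, by omega⟩
    -- The copies with numbers `n i + 1, …, n (j + 1)` lie in the later stage, as `i₀ ≤ j + 1`, and
    -- commute with the earlier one.
    let g : Fin (n (j + 1) - n i) → Dc i₀ →ₐ[ℂ] S (j + 1) (n (j + 1)) := fun r =>
      (((β.comp (l (n i + 1 + r))).comp (Dc i₀).subtype).codRestrict _ fun d =>
        hDcS (j + 1) (n i + 1 + r) (n (j + 1)) hj (by omega) d d.2 : Dc i₀ →⋆ₐ[ℂ] S (j + 1) (n (j + 1)))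
    have hrank := two_pow_le_rank hi₀ (n (j + 1) - n i) g
      (fun r s hrs x y => Subtype.ext ((hlcomm _ _ (by simpa using hrs) x.1 y.1).map β).eq) χ
      (p.map fun x => (⟨x, hmono hij.le x.2⟩ : S (j + 1) (n (j + 1))))
      (fun r x k k' => Subtype.ext
        (hScomm i (n i) (n i + 1 + r) (by omega) _ (p k k').2 _).symm.eq) hne
    refine le_trans (hn' j) (le_trans ?_ hrank)
    -- The exponents were chosen for consecutive stages; an earlier `i` leaves even more copies.
    have : n i ≤ n j := hn.monotone (by omega)
    exact Nat.pow_le_pow_right two_pos (by omega)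

end Exhaustions

/-! ### Passing from direct systems to unital exhaustions. -/

section Units

/-- The connecting maps into the limit of a sequence are eventually unital. -/
theorem IsInductiveLimit.exists_map_one {S : CStarSystem.{u}} {A : Type u} [CStarAlgebra A]
    {ι : ∀ i, S.obj i →⋆ₙₐ[ℂ] A} (h : IsInductiveLimit S A ι) : ∃ i₀, ∀ i, i₀ ≤ i → ι i 1 = 1 := by
  obtain ⟨y, hy, hy'⟩ := Metric.mem_closure_iff.1 (h.dense 1) 1 one_pos
  obtain ⟨i₀, hi₀⟩ := Set.mem_iUnion.1 hy
  obtain ⟨a, rfl⟩ := hi₀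
  refine ⟨i₀, fun i hi => ?_⟩
  rw [← h.compat hi a, dist_eq_norm] at hy'
  set b := S.map hi a
  -- This projection annihilates `ι i b`, which is at distance less than `1` from the unit; hence `q
  -- = q * (1 - ι i b)` has norm below `1` unless it is zero.
  set q := 1 - ι i 1 with hq
  have hι : ι i 1 * ι i 1 = ι i 1 := by rw [← map_mul, one_mul]
  have hqp : IsStarProjection q := by
    refine ⟨?_, ?_⟩
    · change q * q = q
      rw [hq, mul_sub, sub_mul, sub_mul, hι, mul_one, mul_one, one_mul, sub_self, sub_zero]
    · change star q = q
      rw [hq, star_sub, star_one, ← map_star, star_one]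
  have hqb : q * (1 - ι i b) = q := by
    have h1 : ι i 1 * ι i b = ι i b := by rw [← map_mul, one_mul]
    have h2 : q * ι i b = 0 := by rw [hq, sub_mul, h1, one_mul, sub_self]
    rw [mul_sub, h2, sub_zero, mul_one]
  by_contra hne
  have hq0 : q ≠ 0 := fun h0 => hne (sub_eq_zero.1 h0).symm
  have h1 : ‖q‖ = 1 := norm_eq_one_of_isStarProjection hqp hq0
  have h2 : ‖q‖ ≤ ‖q‖ * ‖1 - ι i b‖ := by
    conv_lhs => rw [← hqb]
    exact norm_mul_le _ _
  rw [h1, one_mul] at h2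
  exact absurd hy' (not_lt.2 h2)

theorem IsInductiveLimit.dense_add {S : CStarSystem.{u}} {A : Type u} [CStarAlgebra A]
    {ι : ∀ i, S.obj i →⋆ₙₐ[ℂ] A} (h : IsInductiveLimit S A ι) (i₀ : ℕ) :
    Dense (⋃ k, Set.range (ι (i₀ + k))) := by
  refine h.dense.mono (Set.iUnion_subset fun i => ?_)
  rintro _ ⟨a, rfl⟩
  exact Set.mem_iUnion.2 ⟨i, S.map (Nat.le_add_left i i₀) a, h.compat _ a⟩

/-- A star homomorphism that preserves the unit. -/
def unitalHom {A B : Type u} [CStarAlgebra A] [CStarAlgebra B] (φ : A →⋆ₙₐ[ℂ] B) (h : φ 1 = 1) :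
    A →⋆ₐ[ℂ] B :=
  { φ with
    map_one' := h
    commutes' := fun c => by
      change φ _ = _
      rw [Algebra.algebraMap_eq_smul_one, map_smul, h, Algebra.algebraMap_eq_smul_one] }

theorem IsRSHLimit.hasExhaustion {A : Type u} [CStarAlgebra A] (hA : IsRSHLimit A) :
    HasExhaustion RSHDimLE A := by
  obtain ⟨S, R, ι, hfin, h⟩ := hA
  obtain ⟨i₀, hi₀⟩ := h.exists_map_one
  choose d hd using fun i => exists_coveringDimLE (hfin i)
  refine ⟨fun k => S.obj (i₀ + k), fun k => S.cstar _, fun k => d (i₀ + k),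
    fun k => unitalHom (ι (i₀ + k)) (hi₀ _ (Nat.le_add_right _ _)), fun k => ⟨R _, hd _⟩, fun k => ?_,
    h.dense_add i₀⟩
  rintro _ ⟨a, rfl⟩
  exact ⟨S.map (Nat.le_succ (i₀ + k)) a, h.compat _ a⟩

end Units

/-! ### Supports, scalar multipliers and separability of homogeneous algebras. -/

section

open scoped Matrix.Norms.L2Operator Kronecker

namespace HomogeneousDecomposition

section Support

/-- The norm of a projection-valued function is continuous with values `0` and `1` only. -/
theorem isClopen_ne_zero {X n : Type*} [TopologicalSpace X] [Fintype n] [DecidableEq n]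
    {P : C(X, Matrix n n ℂ)} (hP : IsStarProjection P) : IsClopen {x | P x ≠ 0} := by
  have h1 : ∀ x, P x ≠ 0 → ‖P x‖ = 1 := fun x hx =>
    norm_eq_one_of_isStarProjection
      ⟨congrArg (fun f : C(X, Matrix n n ℂ) => f x) hP.isIdempotentElem.eq,
        congrArg (fun f : C(X, Matrix n n ℂ) => f x) hP.isSelfAdjoint⟩ hx
  refine ⟨?_, isOpen_ne_fun P.continuous continuous_const⟩
  have h2 : {x | P x ≠ 0} = {x | ‖P x‖ = 1} := by
    ext x
    refine ⟨h1 x, fun h h0 => ?_⟩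
    rw [Set.mem_ofPred_eq, h0, norm_zero] at h
    exact zero_ne_one h
  rw [h2]
  exact isClosed_eq P.continuous.norm continuous_const

/-- The points at which the projections vanish may be removed. -/
theorem exists_ne_zero {A : Type u} [CStarAlgebra A] (H : HomogeneousDecomposition A) :
    ∃ H' : HomogeneousDecomposition A, ∀ t x, H'.P t x ≠ 0 := by
  have hc := fun t => isClopen_ne_zero (H.isStarProjection_P t)
  have : ∀ t, CompactSpace {x | H.P t x ≠ 0} := fun t => isCompact_iff_compactSpace.1 (hc t).1.isCompact
  have hcoord : ∀ t a, H.P t * H.coord t a * H.P t = H.coord t a := fun t a =>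
    (H.range_eq fun t => H.coord t a).1 ⟨a, fun _ => rfl⟩ t
  refine Exists.imp (fun H' (h : ∀ t, True ∧ ∀ x, H'.P t x ≠ 0) t => (h t).2) (exists_of_family (A := A) (Q := fun _ _ => True)
    (fun t => {x | H.P t x ≠ 0}) (fun t => Fin (H.m t))
    (fun t => { toFun := fun a => (H.coord t a).restrict {x | H.P t x ≠ 0}
                map_smul' := fun c a => by rw [map_smul]; rfl
                map_zero' := by rw [map_zero]; rfl
                map_add' := fun a b => by rw [map_add]; rfl
                map_mul' := fun a b => by rw [map_mul]; rfl
                map_star' := fun a => by rw [map_star]; rfl }) ?_ ?_ (fun _ => trivial) ?_)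
  · intro a ha
    refine H.injective (funext fun t => ?_)
    change H.coord t a = H.coord t 0
    rw [map_zero]
    ext1 x
    by_cases hx : H.P t x = 0
    · rw [← hcoord]
      change H.P t x * H.coord t a x * H.P t x = 0
      rw [hx, mul_zero]
    · exact congrArg (fun f => f ⟨x, hx⟩) (ha t)
  · intro f hf
    choose F hF using fun t => ContinuousMap.exists_restrict_eq (hc t).1 (f t)
    have hP : ∀ t, H.P t * H.P t = H.P t := fun t => (H.isStarProjection_P t).isIdempotentElem
    obtain ⟨a, ha⟩ := (H.range_eq fun t => H.P t * F t * H.P t).2 fun t => by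
      rw [mul_assoc, mul_assoc, mul_assoc, hP, ← mul_assoc, ← mul_assoc, hP]
    refine ⟨a, fun t => ?_⟩
    rw [← hf t, ← hF t]
    change (H.coord t a).restrict _ = (H.coord t 1).restrict _ * _ * (H.coord t 1).restrict _
    rw [ha, H.coord_one]
    rfl
  · intro t x
    change H.coord t 1 x ≠ 0
    rw [H.coord_one]
    exact x.2

end Support

variable {A : Type u} [CStarAlgebra A] (H : HomogeneousDecomposition A)

section Multipliers

/-- The elements `f P` of a direct summand, for scalar functions `f`. -/
theorem exists_scalarHom (t : Fin H.r) : ∃ Λ : C(H.X t, ℂ) →⋆ₙₐ[ℂ] A,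
    (∀ f, Λ f ∈ H.summand t) ∧ ∀ f, H.coord t (Λ f) = f • H.P t := by
  have hP : H.P t * H.P t = H.P t := (H.isStarProjection_P t).isIdempotentElem
  have hPs : star (H.P t) = H.P t := (H.isStarProjection_P t).isSelfAdjoint
  have hmul : ∀ f g : C(H.X t, ℂ), (f • H.P t) * (g • H.P t) = (f * g) • H.P t := fun f g => by
    conv_rhs => rw [← hP]
    ext1 x
    change (f x • H.P t x) * (g x • H.P t x) = (f x * g x) • (H.P t x * H.P t x)
    rw [smul_mul_smul_comm]
  choose Λ hΛ hΛ' using fun f : C(H.X t, ℂ) => H.exists_mem_summand t (f • H.P t) (by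
    ext1 x
    change H.P t x * (f x • H.P t x) * H.P t x = f x • H.P t x
    have : H.P t x * H.P t x = H.P t x := congrArg (fun f => f x) hP
    rw [mul_smul_comm, smul_mul_assoc, this, this])
  have huniq : ∀ a b, a ∈ H.summand t → b ∈ H.summand t → H.coord t a = H.coord t b → a = b :=
    fun a b ha hb h => sub_eq_zero.1
      (H.eq_zero_of_mem_summand ((H.summand t).sub_mem ha hb) (by rw [map_sub, h, sub_self]))
  have hsmul : ∀ (c : ℂ) a, a ∈ H.summand t → c • a ∈ H.summand t := fun c a ha => by
    rw [← smul_one_mul c a]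
    exact (H.summand t).mul_mem_left _ _ ha
  have hstar : ∀ a, a ∈ H.summand t → star a ∈ H.summand t := fun a ha => (H.layer t).star_mem a ha
  refine ⟨{ toFun := Λ
            map_smul' := fun c f => huniq _ _ (hΛ _) (hsmul c _ (hΛ _)) ?_
            map_zero' := huniq _ _ (hΛ _) (zero_mem _) ?_
            map_add' := fun f g => huniq _ _ (hΛ _) (add_mem (hΛ _) (hΛ _)) ?_
            map_mul' := fun f g => huniq _ _ (hΛ _) ((H.summand t).mul_mem_left _ _ (hΛ _)) ?_
            map_star' := fun f => huniq _ _ (hΛ _) (hstar _ (hΛ _)) ?_ }, hΛ, hΛ'⟩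
  · rw [map_smul, hΛ', hΛ', MonoidHom.id_apply, smul_smul_fun]
  · rw [hΛ', map_zero]
    ext1 x
    exact zero_smul _ _
  · rw [map_add, hΛ', hΛ', hΛ', add_smul_fun]
  · rw [map_mul, hΛ', hΛ', hΛ', hmul]
  · rw [map_star, hΛ', hΛ']
    conv_lhs => rw [← hPs]
    ext1 x
    exact (star_smul (f x) (H.P t x)).symm

/-- Elements are combinations of compressed matrix units with scalar functions as coefficients. -/
theorem exists_matrixUnits (Λ : ∀ t, C(H.X t, ℂ) →⋆ₙₐ[ℂ] A)
    (hΛ' : ∀ t f, H.coord t (Λ t f) = f • H.P t) :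
    ∃ θ : ∀ t, Fin (H.m t) → Fin (H.m t) → A,
      ∀ a, a = ∑ t, ∑ k, ∑ l, Λ t (entry (H.coord t a) k l) * θ t k l := by
  have hP : ∀ t, H.P t * H.P t = H.P t := fun t => (H.isStarProjection_P t).isIdempotentElem
  choose θ hθ hθ' using fun t (k l : Fin (H.m t)) => H.exists_mem_summand t
    (H.P t * ContinuousMap.const _ (Matrix.single k l 1) * H.P t)
    (by rw [mul_assoc, mul_assoc, mul_assoc, hP, ← mul_assoc, ← mul_assoc, hP])
  refine ⟨θ, fun a => H.injective (funext fun t => ?_)⟩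
  change H.coord t a = H.coord t _
  rw [map_sum, Finset.sum_eq_single t]
  · have h1 : H.P t * H.coord t a * H.P t = H.coord t a :=
      (H.range_eq fun t => H.coord t a).1 ⟨a, fun _ => rfl⟩ t
    rw [map_sum]
    simp_rw [map_sum, map_mul, hΛ', hθ']
    ext1 x
    have hPx : H.P t x * H.P t x = H.P t x := congrArg (fun f => f x) (hP t)
    have h2 : H.P t x * H.coord t a x * H.P t x = H.coord t a x := congrArg (fun f => f x) h1
    conv_lhs => rw [← h2, Matrix.matrix_eq_sum_single (H.coord t a x)]
    rw [ContinuousMap.sum_apply, Finset.mul_sum, Finset.sum_mul]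
    refine Finset.sum_congr rfl fun k _ => ?_
    rw [ContinuousMap.sum_apply, Finset.mul_sum, Finset.sum_mul]
    refine Finset.sum_congr rfl fun l _ => ?_
    change _ = (H.coord t a x k l • H.P t x) * (H.P t x * Matrix.single k l 1 * H.P t x)
    rw [smul_mul_assoc, ← mul_assoc, ← mul_assoc, hPx, ← smul_mul_assoc, ← mul_smul_comm,
      Matrix.smul_single, smul_eq_mul, mul_one]
  · intro t' _ ht
    rw [map_sum]
    refine Finset.sum_eq_zero fun k _ => ?_
    rw [map_sum]
    refine Finset.sum_eq_zero fun l _ => ?_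
    exact H.mem_summand.1 ((H.summand t').mul_mem_left _ _ (hθ t' k l)) t (Ne.symm ht)
  · intro h
    exact absurd (Finset.mem_univ t) h

/-- The algebra is a continuous image of a finite product of the spaces `C(X t)`, which are
separable as `X t` is compact metrizable. -/
theorem separableSpace (H : HomogeneousDecomposition A) : TopologicalSpace.SeparableSpace A := by
  choose Λ _ hΛ' using H.exists_scalarHom
  obtain ⟨θ, hθ⟩ := H.exists_matrixUnits Λ hΛ'
  let F : (∀ t, Fin (H.m t) → Fin (H.m t) → C(H.X t, ℂ)) → A := fun f =>
    ∑ t, ∑ k, ∑ l, Λ t (f t k l) * θ t k l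
  have hF : Continuous F := by
    have := fun t => continuous_starHom (Λ t)
    fun_prop
  exact (Function.Surjective.denseRange fun a => ⟨fun t k l => entry (H.coord t a) k l, (hθ a).symm⟩ :
    DenseRange F).separableSpace hF

end Multipliers

end HomogeneousDecomposition

end

/-! ### Reduction of AH algebras to finite-dimensional base spaces. -/

section

open scoped Matrix.Norms.L2Operator Kronecker

namespace HomogeneousDecomposition

section Factor

variable {A : Type u} [CStarAlgebra A] (H : HomogeneousDecomposition A)

/-- The coordinates of the elements of `G`. -/
noncomputable def coordinates (G : Finset A) (t : Fin H.r) :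
    C(H.X t, ↥G × Fin (H.m t) × Fin (H.m t) → ℂ) :=
  ContinuousMap.pi fun p => entry (H.coord t p.1) p.2.1 p.2.2

/-- The elements whose coordinates factor through those of the elements of `G`. -/
def factorSubalgebra (G : Finset A) (h1 : 1 ∈ G) : StarSubalgebra ℂ A where
  carrier := {a | ∀ t x x', H.coordinates G t x = H.coordinates G t x' →
    H.coord t a x = H.coord t a x'}
  mul_mem' ha hb t x x' h := by
    rw [map_mul, ContinuousMap.mul_apply, ContinuousMap.mul_apply, ha t x x' h, hb t x x' h]
  add_mem' ha hb t x x' h := by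
    rw [map_add, ContinuousMap.add_apply, ContinuousMap.add_apply, ha t x x' h, hb t x x' h]
  star_mem' ha t x x' h := by
    rw [map_star, ContinuousMap.star_apply, ContinuousMap.star_apply, ha t x x' h]
  -- The coordinates of the unit are the projections `P t`, which need not be constant; hence the
  -- requirement `1 ∈ G`.
  algebraMap_mem' c t x x' h := by
    rw [Algebra.algebraMap_eq_smul_one, map_smul, ContinuousMap.smul_apply, ContinuousMap.smul_apply]
    congr 1
    ext k l
    exact congrFun h (⟨1, h1⟩, k, l)

variable {G : Finset A} {h1 : 1 ∈ G}

theorem subset_factorSubalgebra {a : A} (ha : a ∈ G) : a ∈ H.factorSubalgebra G h1 := by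
  intro t x x' h
  ext k l
  exact congrFun h (⟨a, ha⟩, k, l)

theorem isClosed_factorSubalgebra : IsClosed (H.factorSubalgebra G h1 : Set A) := by
  have hc : ∀ t x, Continuous fun a => H.coord t a x := fun t x =>
    (continuous_eval_const x).comp (continuous_starHom (H.coord t))
  have : (H.factorSubalgebra G h1 : Set A) = ⋂ (t) (x) (x')
      (_ : H.coordinates G t x = H.coordinates G t x'), {a | H.coord t a x = H.coord t a x'} := by
    ext a
    simp only [Set.mem_iInter]
    rfl
  rw [this]
  exact isClosed_iInter fun t => isClosed_iInter fun x => isClosed_iInter fun x' =>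
    isClosed_iInter fun _ => isClosed_eq (hc t x) (hc t x')

/-- The map of a base space onto the range of the coordinates. -/
noncomputable def toRange (G : Finset A) (t : Fin H.r) :
    C(H.X t, Set.range (H.coordinates G t)) :=
  ⟨Set.rangeFactorization (H.coordinates G t), (H.coordinates G t).continuous.rangeFactorization⟩

instance (G : Finset A) (t : Fin H.r) : CompactSpace (Set.range (H.coordinates G t)) :=
  isCompact_iff_compactSpace.1 (isCompact_range (H.coordinates G t).continuous)

theorem toRange_surjective (G : Finset A) (t : Fin H.r) : Function.Surjective (H.toRange G t) :=
  Set.rangeFactorization_surjective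

theorem isQuotientMap_toRange (G : Finset A) (t : Fin H.r) : IsQuotientMap (H.toRange G t) :=
  (H.toRange G t).continuous.isClosedMap.isQuotientMap (H.toRange G t).continuous
    (H.toRange_surjective G t)

/-- Functions that factor through the coordinates. -/
theorem exists_factor_toRange {Z : Type*} [TopologicalSpace Z] {G : Finset A} {t : Fin H.r}
    (f : C(H.X t, Z)) (hf : ∀ x x', H.coordinates G t x = H.coordinates G t x' → f x = f x') :
    ∃ g : C(Set.range (H.coordinates G t), Z), ∀ x, g (H.toRange G t x) = f x := by
  have hf' : Function.FactorsThrough f (H.toRange G t) := fun x x' h =>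
    hf x x' (congrArg Subtype.val h)
  exact ⟨(H.isQuotientMap_toRange G t).lift f hf', fun x =>
    congrArg (fun f => f x) ((H.isQuotientMap_toRange G t).lift_comp f hf')⟩

/-- The coordinates of `G` map each base space onto a compact subset of a finite-dimensional complex
space. This is a quotient map, so the elements in question, the projections included, descend to
functions on that subset. -/
theorem homogeneousDimLE_factorSubalgebra (hH : ∀ t x, H.P t x ≠ 0) (G : Finset A) (h1 : 1 ∈ G)
    [IsClosed (H.factorSubalgebra G h1 : Set A)] :
    ∃ d, HomogeneousDimLE (H.factorSubalgebra G h1) d := by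
  let W := H.factorSubalgebra G h1
  choose q hq using fun t (a : W) => H.exists_factor_toRange (H.coord t a) (a.2 t)
  have huniq : ∀ t (f g : C(Set.range (H.coordinates G t), Matrix (Fin (H.m t)) (Fin (H.m t)) ℂ)),
      (∀ x, f (H.toRange G t x) = g (H.toRange G t x)) → f = g := by
    intro t f g h
    ext1 y
    obtain ⟨x, rfl⟩ := H.toRange_surjective G t y
    exact h x
  let q' : ∀ t, W →⋆ₙₐ[ℂ] C(Set.range (H.coordinates G t), Matrix (Fin (H.m t)) (Fin (H.m t)) ℂ) :=
    fun t =>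
    { toFun := q t
      map_smul' := fun c a => huniq t _ _ fun x => by
        change q t (c • a) (H.toRange G t x) = c • q t a (H.toRange G t x)
        rw [hq, hq]
        exact congrArg (fun f => f x) (map_smul (H.coord t) c (a : A))
      map_zero' := huniq t _ _ fun x => by
        rw [hq]
        exact congrArg (fun f => f x) (map_zero (H.coord t))
      map_add' := fun a b => huniq t _ _ fun x => by
        change _ = q t a (H.toRange G t x) + q t b (H.toRange G t x)
        rw [hq, hq, hq]
        exact congrArg (fun f => f x) (map_add (H.coord t) (a : A) b)
      map_mul' := fun a b => huniq t _ _ fun x => by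
        change _ = q t a (H.toRange G t x) * q t b (H.toRange G t x)
        rw [hq, hq, hq]
        exact congrArg (fun f => f x) (map_mul (H.coord t) (a : A) b)
      map_star' := fun a => huniq t _ _ fun x => by
        change _ = star (q t a _)
        rw [hq, hq]
        exact congrArg (fun f => f x) (map_star (H.coord t) (a : A)) }
  have hq' : ∀ t a x, q' t a (H.toRange G t x) = H.coord t (a : A) x := hq
  have hq1 : ∀ t x, q' t 1 (H.toRange G t x) = H.P t x := fun t x => by
    rw [hq', ← H.coord_one]
    rfl
  -- The factor `Bool` separates real and imaginary parts; the sum over `t` serves as a common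
  -- bound.
  let c : Fin H.r → ℕ := fun t => Fintype.card ((↥G × Fin (H.m t) × Fin (H.m t)) × Bool)
  refine ⟨∑ t, c t, exists_of_family (Q := fun X _ => CoveringDimLE X (∑ t, c t))
    (fun t => Set.range (H.coordinates G t)) (fun t => Fin (H.m t)) q' ?_ ?_ (fun t => ?_) ?_⟩
  · intro a ha
    refine Subtype.ext (H.injective (funext fun t => ?_))
    change H.coord t a = H.coord t 0
    rw [map_zero]
    ext1 x
    rw [← hq', ha]
    rfl
  · intro f hf
    obtain ⟨a, ha⟩ := (H.range_eq fun t => (f t).comp (H.toRange G t)).2 fun t => by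
      ext1 x
      change H.P t x * f t (H.toRange G t x) * H.P t x = f t (H.toRange G t x)
      rw [← hq1]
      exact congrArg (fun f => f (H.toRange G t x)) (hf t)
    have haW : a ∈ W := fun t x x' h => by
      rw [ha]
      exact congrArg (f t) (Subtype.ext h)
    refine ⟨⟨a, haW⟩, fun t => huniq t _ _ fun x => ?_⟩
    rw [hq']
    exact congrArg (fun f => f x) (ha t)
  · refine CoveringDimLE.mono (coveringDimLE_of_separating
      (κ := (↥G × Fin (H.m t) × Fin (H.m t)) × Bool) (fun p => ⟨fun y =>
        if p.2 then (y.1 p.1).re else (y.1 p.1).im, ?_⟩) ?_)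
      (Finset.single_le_sum (f := c) (fun _ _ => Nat.zero_le _) (Finset.mem_univ t))
    · cases p.2
      · exact Complex.continuous_im.comp ((continuous_apply p.1).comp continuous_subtype_val)
      · exact Complex.continuous_re.comp ((continuous_apply p.1).comp continuous_subtype_val)
    · intro y y' h
      refine Subtype.ext (funext fun p => Complex.ext ?_ ?_)
      · exact h (p, true)
      · exact h (p, false)
  · intro t y
    obtain ⟨x, rfl⟩ := H.toRange_surjective G t y
    rw [hq1]
    exact hH t x

/-- The algebra of the elements that factor through the coordinates of `G` is finitely generated. -/
theorem exists_generators (G : Finset A) (h1 : 1 ∈ G) : ∃ G' : Finset A,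
    ∀ {B : Type u} [CStarAlgebra B] (φ : A →⋆ₙₐ[ℂ] B) (T : StarSubalgebra ℂ B),
      IsClosed (T : Set B) → (∀ g ∈ G', φ g ∈ T) → ∀ a ∈ H.factorSubalgebra G h1, φ a ∈ T := by
  classical
  choose Λ _ hΛ' using H.exists_scalarHom
  obtain ⟨θ, hθ⟩ := H.exists_matrixUnits Λ hΛ'
  let G₁ : Finset A := Finset.univ.image fun t => Λ t 1
  let G₂ : Finset A := Finset.univ.image
    fun p : Σ t, ↥G × Fin (H.m t) × Fin (H.m t) => Λ p.1 (entry (H.coord p.1 p.2.1) p.2.2.1 p.2.2.2)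
  let G₃ : Finset A := Finset.univ.image
    fun p : Σ t, Fin (H.m t) × Fin (H.m t) => θ p.1 p.2.1 p.2.2
  refine ⟨G₁ ∪ G₂ ∪ G₃, fun {B} _ φ T hT hG a ha => ?_⟩
  have hG₁ : ∀ t, φ (Λ t 1) ∈ T := fun t => hG _ <| by
    simp only [G₁, Finset.mem_union, Finset.mem_image, Finset.mem_univ, true_and]
    exact Or.inl (Or.inl ⟨t, rfl⟩)
  have hG₂ : ∀ t (g : ↥G) k l, φ (Λ t (entry (H.coord t g) k l)) ∈ T := fun t g k l => hG _ <| by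
    simp only [G₂, Finset.mem_union, Finset.mem_image, Finset.mem_univ, true_and]
    exact Or.inl (Or.inr ⟨⟨t, g, k, l⟩, rfl⟩)
  have hG₃ : ∀ t k l, φ (θ t k l) ∈ T := fun t k l => hG _ <| by
    simp only [G₃, Finset.mem_union, Finset.mem_image, Finset.mem_univ, true_and]
    exact Or.inr ⟨⟨t, k, l⟩, rfl⟩
  -- Stone–Weierstrass on the range of the coordinates: the functions `f` with this property form a
  -- closed star subalgebra containing the coordinate functions, which separate points.
  have key : ∀ t (f : C(Set.range (H.coordinates G t), ℂ)), φ (Λ t (f.comp (H.toRange G t))) ∈ T := by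
    intro t f
    let c : C(Set.range (H.coordinates G t), ℂ) →⋆ₐ[ℂ] C(H.X t, ℂ) :=
      ContinuousMap.compStarAlgHom' ℂ ℂ (H.toRange G t)
    let Φ : C(Set.range (H.coordinates G t), ℂ) →⋆ₙₐ[ℂ] B :=
      (φ.comp (Λ t)).comp (c : C(Set.range (H.coordinates G t), ℂ) →⋆ₙₐ[ℂ] C(H.X t, ℂ))
    let V : StarSubalgebra ℂ C(Set.range (H.coordinates G t), ℂ) :=
      { carrier := {f | Φ f ∈ T}
        mul_mem' := fun {f g} hf hg => by
          change Φ (f * g) ∈ T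
          rw [map_mul]
          exact mul_mem hf hg
        add_mem' := fun {f g} hf hg => by
          change Φ (f + g) ∈ T
          rw [map_add]
          exact add_mem hf hg
        star_mem' := fun {f} hf => by
          change Φ (star f) ∈ T
          rw [map_star]
          exact star_mem hf
        algebraMap_mem' := fun z => by
          change Φ (algebraMap _ _ z) ∈ T
          rw [Algebra.algebraMap_eq_smul_one, map_smul]
          refine T.smul_mem ?_ z
          exact hG₁ t }
    have hV : IsClosed (V : Set C(Set.range (H.coordinates G t), ℂ)) :=
      hT.preimage (continuous_starHom Φ)
    have hsep : V.SeparatesPoints := by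
      intro y y' hyy'
      obtain ⟨p, hp⟩ : ∃ p, y.1 p ≠ y'.1 p := by
        by_contra! h
        exact hyy' (Subtype.ext (funext h))
      let g : C(Set.range (H.coordinates G t), ℂ) :=
        ⟨fun y => y.1 p, (continuous_apply p).comp continuous_subtype_val⟩
      exact ⟨g, ⟨g, hG₂ t p.1 p.2.1 p.2.2, rfl⟩, hp⟩
    have htop := ContinuousMap.starSubalgebra_topologicalClosure_eq_top_of_separatesPoints V hsep
    have hf : f ∈ V.topologicalClosure := by rw [htop]; trivial
    have hf' : f ∈ (V : Set C(Set.range (H.coordinates G t), ℂ)) := by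
      rw [← hV.closure_eq]
      exact hf
    exact hf'
  rw [hθ a, map_sum]
  refine sum_mem fun t _ => ?_
  rw [map_sum]
  refine sum_mem fun k _ => ?_
  rw [map_sum]
  refine sum_mem fun l _ => ?_
  rw [map_mul]
  refine mul_mem ?_ (hG₃ t k l)
  obtain ⟨g, hg⟩ := H.exists_factor_toRange (G := G) (entry (H.coord t a) k l) fun x x' h => by
    change H.coord t a x k l = H.coord t a x' k l
    rw [ha t x x' h]
  have : g.comp (H.toRange G t) = entry (H.coord t a) k l := ContinuousMap.ext hg
  rw [← this]
  exact key t g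

end Factor

end HomogeneousDecomposition

/-- Each stage is replaced by the subalgebra `W i` of elements factoring through a finite set `G i`.
Finite generation of `W i` allows `G (i + 1)` to absorb the images of its generators, so that `W i`
maps into `W (i + 1)`; separability lets the `G i` capture a dense set. -/
theorem IsAH.hasExhaustion {A : Type u} [CStarAlgebra A] (hA : IsAH A) :
    HasExhaustion HomogeneousDimLE A := by
  classical
  obtain ⟨S, H', ι, h⟩ := hA
  choose H hH using fun i => (H' i).exists_ne_zero
  have hsep : ∀ i, TopologicalSpace.SeparableSpace (S.obj i) := fun i => (H i).separableSpace
  let w : ∀ i, ℕ → S.obj i := fun i => TopologicalSpace.denseSeq (S.obj i)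
  -- The images in stage `i` of the first `i + 1` terms of the dense sequences of the stages up to
  -- `i`; every term of every sequence is eventually included.
  let F : ∀ i, Finset (S.obj i) := fun i => Finset.univ.image
    fun p : Fin (i + 1) × Fin (i + 1) => S.map (Nat.le_of_lt_succ p.1.2) (w p.1 p.2)
  choose gen hgen using fun i (G : {G : Finset (S.obj i) // 1 ∈ G}) =>
    (H i).exists_generators G.1 G.2
  obtain ⟨G, hG0, hG1⟩ : ∃ G : ∀ i, {G : Finset (S.obj i) // 1 ∈ G},
      (G 0).1 = insert 1 (F 0) ∧ ∀ i, (G (i + 1)).1 =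
        insert 1 (F (i + 1) ∪ (gen i (G i)).image (S.map (Nat.le_succ i))) :=
    ⟨fun i => Nat.rec ⟨insert 1 (F 0), Finset.mem_insert_self _ _⟩
      (fun i G => ⟨insert 1 (F (i + 1) ∪ (gen i G).image (S.map (Nat.le_succ i))),
        Finset.mem_insert_self _ _⟩) i, rfl, fun _ => rfl⟩
  let W : ∀ i, StarSubalgebra ℂ (S.obj i) := fun i => (H i).factorSubalgebra (G i).1 (G i).2
  have hW : ∀ i, IsClosed (W i : Set (S.obj i)) := fun i => (H i).isClosed_factorSubalgebra
  have hFW : ∀ i, ∀ x ∈ F i, x ∈ W i := fun i x hx => (H i).subset_factorSubalgebra <| by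
    cases i with
    | zero => rw [hG0]; exact Finset.mem_insert_of_mem hx
    | succ i => rw [hG1]; exact Finset.mem_insert_of_mem (Finset.mem_union_left _ hx)
  have hWW : ∀ i, ∀ x ∈ W i, S.map (Nat.le_succ i) x ∈ W (i + 1) := fun i =>
    hgen i (G i) (S.map (Nat.le_succ i)) (W (i + 1)) (hW _) fun g hg =>
      (H (i + 1)).subset_factorSubalgebra <| by
        rw [hG1]
        exact Finset.mem_insert_of_mem (Finset.mem_union_right _ (Finset.mem_image_of_mem _ hg))
  choose d hd using fun i =>
    haveI := hW i
    (H i).homogeneousDimLE_factorSubalgebra (hH i) (G i).1 (G i).2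
  obtain ⟨i₀, hi₀⟩ := h.exists_map_one
  have hmono : ∀ i, (ι i) '' W i ⊆ (ι (i + 1)) '' W (i + 1) := by
    rintro i _ ⟨a, ha, rfl⟩
    exact ⟨_, hWW i a ha, h.compat _ a⟩
  have hrange : ∀ i (hi : i₀ ≤ i),
      Set.range ((unitalHom (ι i) (hi₀ i hi)).comp (W i).subtype) = ι i '' W i := by
    intro i hi
    ext x
    constructor
    · rintro ⟨a, rfl⟩
      exact ⟨a, a.2, rfl⟩
    · rintro ⟨a, ha, rfl⟩
      exact ⟨⟨a, ha⟩, rfl⟩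
  refine ⟨fun k => W (i₀ + k), fun k => haveI := hW (i₀ + k); inferInstance, fun k => d (i₀ + k),
    fun k => (unitalHom (ι (i₀ + k)) (hi₀ _ (Nat.le_add_right _ _))).comp (W (i₀ + k)).subtype,
    fun k => hd _, fun k => ?_, ?_⟩
  · exact (hrange _ (Nat.le_add_right _ _)).subset.trans ((hmono _).trans
      (hrange (i₀ + k + 1) (by omega)).symm.subset)
  · refine Dense.mono (Set.iUnion_mono fun k => (hrange (i₀ + k) (Nat.le_add_right _ _)).symm.subset)
      fun x => ?_
    have h1 : ∀ i, ∀ k, ι i (w i k) ∈ ⋃ k, ι (i₀ + k) '' W (i₀ + k) := by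
      intro i k
      refine Set.mem_iUnion.2 ⟨max i k, S.map (le_add_left (le_max_left i k)) (w i k), hFW _ _ ?_,
        h.compat _ _⟩
      refine Finset.mem_image.2 ⟨(⟨i, ?_⟩, ⟨k, ?_⟩), Finset.mem_univ _, rfl⟩
      · exact Nat.lt_succ_of_le (le_add_left (le_max_left i k))
      · exact Nat.lt_succ_of_le (le_add_left (le_max_right i k))
    have h2 : (⋃ i, Set.range (ι i)) ⊆ closure (⋃ k, ι (i₀ + k) '' W (i₀ + k)) := by
      refine Set.iUnion_subset fun i => ?_
      rintro _ ⟨a, rfl⟩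
      refine (TopologicalSpace.denseRange_denseSeq (S.obj i)).induction_on
        (p := fun a => ι i a ∈ closure (⋃ k, ι (i₀ + k) '' W (i₀ + k))) a
        (isClosed_closure.preimage (continuous_starHom (ι i))) fun k => subset_closure (h1 i k)
    exact closure_minimal h2 isClosed_closure (h.dense x)

end

/-! ### The direct systems with the required growth. -/

section Systems

/-- An increasing sequence of closed subalgebras as a direct system. -/
noncomputable def subalgebraSystem {A : Type u} [CStarAlgebra A] (S : ℕ → StarSubalgebra ℂ A)
    (hcl : ∀ j, IsClosed (S j : Set A)) (hS : Monotone S) : CStarSystem.{u} where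
  obj j := S j
  cstar j := haveI := hcl j; inferInstance
  map hij := (StarSubalgebra.inclusion (hS hij) : _ →⋆ₙₐ[ℂ] _)
  map_self _ _ := rfl
  map_map _ _ _ := rfl

theorem isInductiveLimit_subalgebraSystem {A : Type u} [CStarAlgebra A]
    (S : ℕ → StarSubalgebra ℂ A) (hcl : ∀ j, IsClosed (S j : Set A)) (hS : Monotone S)
    (hd : Dense (⋃ j, (S j : Set A))) :
    IsInductiveLimit (subalgebraSystem S hcl hS) A fun j => ((S j).subtype : S j →⋆ₙₐ[ℂ] A) where
  compat _ _ := rfl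
  dense := hd.mono (Set.iUnion_mono fun _ x hx => ⟨⟨x, hx⟩, rfl⟩)
  norm_eq _ _ := tendsto_const_nhds

/-- Evaluation at a point. -/
noncomputable def evalHom {X n : Type*} [TopologicalSpace X] [Fintype n] [DecidableEq n] (x : X) :
    C(X, Matrix n n ℂ) →ₐ[ℂ] Matrix n n ℂ where
  toFun f := f x
  map_one' := rfl
  map_mul' _ _ := rfl
  map_zero' := rfl
  map_add' _ _ := rfl
  commutes' _ := rfl

theorem RSHDecomposition.exists_value {A : Type u} [CStarAlgebra A] (R : RSHDecomposition A)
    (y : R.total.X) : 0 < R.total.size y ∧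
      ∃ χ : A →ₐ[ℂ] Matrix (Fin (R.total.size y)) (Fin (R.total.size y)) ℂ,
        ∀ a, χ a = R.total.value y a := by
  induction R with
  | base X n hn e => exact ⟨hn, (evalHom y).comp (e : _ →⋆ₐ[ℂ] C(X, Matrix (Fin n) (Fin n) ℂ)).toAlgHom, fun _ => rfl⟩
  | step R X X₀ hX₀ n hn φ p q hinj hrange ih =>
    cases y with
    | inl y =>
      obtain ⟨h, χ, hχ⟩ := ih y
      exact ⟨h, χ.comp p.toAlgHom, fun a => hχ (p a)⟩
    | inr y => exact ⟨hn, (evalHom y).comp q.toAlgHom, fun _ => rfl⟩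

theorem RSHDecomposition.dimFunction_le {A : Type u} [CStarAlgebra A] (R : RSHDecomposition A)
    {d : ℕ} (hd : CoveringDimLE R.total.X d) (y : R.total.X) : R.dimFunction y ≤ d :=
  coveringDim_le (hd.subtype_of_isClosed isClosed_connectedComponent)

/-- The cubic estimate needed for very slow dimension growth also covers the linear one. -/
theorem mul_le_mul_cube {N j : ℕ} (h : N ≤ j) (d : ℕ) : N * d ≤ j * d ^ 3 :=
  Nat.mul_le_mul h (Nat.le_self_pow three_ne_zero d)

theorem tensorClosed_RSHDimLE : TensorClosed.{u} RSHDimLE :=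
  fun _ _ _ _ _ _ _ _ hA hB α β comm hd => hA.tensor hB α β comm hd

theorem tensorClosed_homogeneousDimLE : TensorClosed.{u} HomogeneousDimLE :=
  fun _ _ _ _ _ _ _ _ hA hB α β comm hd => hA.tensor hB α β comm hd

theorem slowDimensionGrowth {A D : Type u} [CStarAlgebra A] [CStarAlgebra D] (hA : IsRSHLimit A)
    (hD : IsRSHLimit D) (hssa : IsStronglySelfAbsorbing D) (hst : IsTensorStable A D) :
    HasSlowDimensionGrowth A ∧ (IsSimpleCStar A → HasStrictSlowDimensionGrowth A) := by
  obtain ⟨S, hcl, δ, hS, j₁, hd, hR, hrank⟩ :=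
    exists_growing_sequence tensorClosed_RSHDimLE hA.hasExhaustion hD.hasExhaustion hssa hst
  choose R hR using hR
  let T := subalgebraSystem S hcl hS
  have hfin : ∀ j, (R j).FiniteDim := fun j =>
    ne_top_of_le_ne_top (ENat.natCast_ne_top _) (coveringDim_le (hR j))
  have hlim := isInductiveLimit_subalgebraSystem S hcl hS hd
  have key : ∀ (i k : ℕ) (p : Matrix (Fin k) (Fin k) (S i)) (N j : ℕ) (hij : i ≤ j), N ≤ j → i < j →
      j₁ ≤ j → ∀ x : (R j).total.X, (R j).matrixValue (p.map (T.map hij)) x ≠ 0 →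
      (N : ℕ∞) * (R j).dimFunction x ≤ (((R j).matrixValue (p.map (T.map hij)) x).rank : ℕ∞) := by
    intro i k p N j hij hN hij' hj x hne
    obtain ⟨-, χ, hχ⟩ := (R j).exists_value x
    have h1 : (R j).matrixValue (p.map (T.map hij)) x =
        Matrix.comp _ _ _ _ ℂ (p.map fun x => χ ⟨x, hS hij x.2⟩) := by
      ext a b
      exact congrFun (congrFun (hχ _).symm a.2) b.2
    rw [h1] at hne ⊢
    have h2 := hrank i j hij' hj (Fin ((R j).total.size x)) (Fin k) (χ : S j →ₙₐ[ℂ] _) p hne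
    calc (N : ℕ∞) * (R j).dimFunction x ≤ N * δ j := by
          gcongr
          exact (R j).dimFunction_le (hR j) x
      _ = ((N * δ j : ℕ) : ℕ∞) := by push_cast; rfl
      _ ≤ _ := by exact_mod_cast (mul_le_mul_cube hN _).trans h2
  refine ⟨⟨T, R, _, hfin, hlim, ?_⟩, fun hsimple => ⟨T, R, _, hfin, hlim, ?_⟩⟩
  · intro i k p _ N
    refine ⟨max (max N (i + 1)) j₁, fun j hij hj x => ?_⟩
    rw [max_le_iff, max_le_iff] at hj
    exact or_iff_not_imp_left.2 (key i k p N j hij hj.1.1 hj.1.2 hj.2 x)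
  · intro i k p _ hp N
    -- A nonzero entry of `p` generates the unit ideal of a later stage. If the value of `p`
    -- vanished at a point, this entry would lie in the kernel of a unital representation on a
    -- nonzero space.
    obtain ⟨a, b, hab⟩ : ∃ a b, p a b ≠ 0 := by
      by_contra! h
      exact hp (Matrix.ext h)
    let y : S i := p a b
    obtain ⟨j₂, hij₂, hspan⟩ := hsimple.exists_span_eq_top S hS hd y hab
    refine ⟨max (max (max N (i + 1)) j₁) j₂, fun j hij hj x => ?_⟩
    rw [max_le_iff, max_le_iff, max_le_iff] at hj
    have hne : (R j).matrixValue (p.map (T.map hij)) x ≠ 0 := by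
      intro h0
      obtain ⟨hpos, χ, hχ⟩ := (R j).exists_value x
      let ψ := χ.comp (StarSubalgebra.inclusion (hS hj.2)).toAlgHom
      have h1 : ψ ⟨y, hS hij₂ y.2⟩ = 0 := by
        refine (hχ _).trans (Matrix.ext fun c d => ?_)
        exact congrFun (congrFun h0 (a, c)) (b, d)
      have h2 : TwoSidedIdeal.span {(⟨y, hS hij₂ y.2⟩ : S j₂)} ≤
          TwoSidedIdeal.ker ψ := by
        rw [TwoSidedIdeal.span_le, Set.singleton_subset_iff]
        exact (TwoSidedIdeal.mem_ker _).2 h1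
      rw [hspan] at h2
      have h3 : ψ 1 = 0 := (TwoSidedIdeal.mem_ker _).1 (h2 trivial)
      rw [map_one] at h3
      have : Nonempty (Fin ((R j).total.size x)) := ⟨⟨0, hpos⟩⟩
      exact one_ne_zero h3
    exact ⟨hne, key i k p N j hij hj.1.1.1 hj.1.1.2 hj.1.2 x hne⟩

theorem verySlowDimensionGrowth {A D : Type u} [CStarAlgebra A] [CStarAlgebra D] (hA : IsAH A)
    (hD : IsAH D) (hssa : IsStronglySelfAbsorbing D) (hst : IsTensorStable A D) :
    HasVerySlowDimensionGrowth A := by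
  obtain ⟨S, hcl, δ, hS, j₁, hd, hH, hrank⟩ :=
    exists_growing_sequence tensorClosed_homogeneousDimLE hA.hasExhaustion hD.hasExhaustion hssa hst
  choose H hH using hH
  have key : ∀ (i j : ℕ) (hij : i ≤ j) (e : S i) (N : ℕ), N ≤ j → i < j → j₁ ≤ j →
      ∀ (t : Fin (H j).r) (x : (H j).X t), (H j).coord t ⟨e, hS hij e.2⟩ x ≠ 0 →
      (N : ℕ∞) * coveringDim ((H j).X t) ^ 3 ≤ (((H j).coord t ⟨e, hS hij e.2⟩ x).rank : ℕ∞) := by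
    intro i j hij e N hN hij' hj t x hne
    let χ : S j →ₙₐ[ℂ] Matrix (Fin ((H j).m t)) (Fin ((H j).m t)) ℂ :=
      { toFun := fun a => (H j).coord t a x
        map_smul' := fun c a => by rw [map_smul]; rfl
        map_zero' := by rw [map_zero]; rfl
        map_add' := fun a b => by rw [map_add]; rfl
        map_mul' := fun a b => by rw [map_mul]; rfl }
    -- Elements are regarded as matrices of size one to apply the rank estimate.
    let p : Matrix Unit Unit (S i) := Matrix.of fun _ _ => e
    have h1 : Matrix.comp Unit Unit _ _ ℂ (p.map fun x => χ ⟨x, hS hij x.2⟩) =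
        ((H j).coord t ⟨e, hS hij e.2⟩ x).submatrix (Equiv.punitProd _) (Equiv.punitProd _) := rfl
    have h2 := hrank i j hij' hj (Fin ((H j).m t)) Unit χ p (by
      rw [h1]
      intro h0
      refine hne (Matrix.ext fun a b => ?_)
      exact congrFun (congrFun h0 ((), a)) ((), b))
    rw [h1, Matrix.rank_submatrix] at h2
    calc (N : ℕ∞) * coveringDim ((H j).X t) ^ 3 ≤ N * (δ j : ℕ∞) ^ 3 := by
          gcongr
          exact coveringDim_le (hH j t).1
      _ = ((N * δ j ^ 3 : ℕ) : ℕ∞) := by push_cast; rfl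
      _ ≤ _ := by exact_mod_cast (Nat.mul_le_mul_right _ hN).trans h2
  refine ⟨subalgebraSystem S hcl hS, H, _, isInductiveLimit_subalgebraSystem S hcl hS hd, ?_, ?_⟩
  · intro N
    refine ⟨max (max N 1) j₁, fun j hj t x => ?_⟩
    rw [max_le_iff, max_le_iff] at hj
    -- The connecting maps are unital, so `P` is the image of the unit of stage `0`, and the first
    -- growth condition is an instance of `key`.
    have h1 : (H j).coord t ⟨(1 : S 0), hS (Nat.zero_le j) (1 : S 0).2⟩ = (H j).P t :=
      (H j).coord_one t
    have := key 0 j (Nat.zero_le j) 1 N hj.1.1 hj.1.2 hj.2 t x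
    rw [h1] at this
    exact this ((hH j t).2 x)
  · intro i s e _ N
    refine ⟨max (max N (i + 1)) j₁, fun j hij hj t x => ?_⟩
    rw [max_le_iff, max_le_iff] at hj
    exact or_iff_not_imp_left.2 (key i j hij e N hj.1.1 hj.1.2 hj.2 t x)

end Systems

end StronglySelfAbsorbingPaper

theorem theorem5p5 (A D : Type u) [CStarAlgebra A] [CStarAlgebra D]
    (hA : StronglySelfAbsorbingPaper.IsRSHLimit A)
    (hD : StronglySelfAbsorbingPaper.IsRSHLimit D)
    (hssa : StronglySelfAbsorbingPaper.IsStronglySelfAbsorbing D)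
    (hstable : StronglySelfAbsorbingPaper.IsTensorStable A D) :
    StronglySelfAbsorbingPaper.HasSlowDimensionGrowth A ∧
    (StronglySelfAbsorbingPaper.IsSimpleCStar A →
      StronglySelfAbsorbingPaper.HasStrictSlowDimensionGrowth A) ∧
    (StronglySelfAbsorbingPaper.IsAH A → StronglySelfAbsorbingPaper.IsAH D →
      StronglySelfAbsorbingPaper.HasVerySlowDimensionGrowth A) := by
  have h := StronglySelfAbsorbingPaper.slowDimensionGrowth hA hD hssa hstable
  exact ⟨h.1, h.2, fun hA' hD' =>
    StronglySelfAbsorbingPaper.verySlowDimensionGrowth hA' hD' hssa hstable⟩
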